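/- Let $E_1,E_2$ be Banach spaces (both real or both complex, with scalar field $\mathbb K$), $n\ge 1$, $T>0$. Let $\alpha_0(t)=0$, $\alpha_n(t)=t$, and let $\alpha_1,\dots,\alpha_{n-1}\in C^1[0,T]$ be real functions with $\alpha_i(0)=0$, $0<\alpha_1(t)<\dots<\alpha_{n-1}(t)<t$ for $0<t\le T$, and $0<\alpha_1'(0)<\dots<\alpha_{n-1}'(0)<1$. Put $\overline D_i=\{(t,s):0\le t\le T,\ \alpha_{i-1}(t)\le s\le\alpha_i(t)\}$. For $i=1,\dots,n$ let $K_i:\overline D_i\to\mathcal L(E_1\to E_2)$ be norm-continuous, with a derivative $K_i^{(1)}=\partial K_i/\partial t$ in the interior of $\overline D_i$ that extends norm-continuously to $\overline D_i$. Let $f\in C^1([0,T];E_2)$ with $f(0)=0$. Consider the Volterra equation of the first kind $$\sum_{i=1}^n\int_{\alpha_{i-1}(t)}^{\alpha_i(t)}K_i(t,s)\,x(s)\,ds=f(t)\qquad(3)$$ and its characteristic operator $B(j)=K_n(0,0)+\sum_{i=1}^{n-1}(\alpha_i'(0))^{1+j}\bigl(K_i(0,0)-K_{i+1}(0,0)\bigr)$;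 write $B^{(k)}(j)$ for its $k$-th derivative in $j$. Let $N\ge N^*\ge 0$ be integers and assume the following. (B) $N\ge1$, and there are Taylor polynomials $\mathcal P_i(t,s)=\sum_{0\le\nu+\mu\le N}K_{i\nu\mu}t^\nu s^\mu$ with $K_{i\nu\mu}\in\mathcal L(E_1\to E_2)$, $f^N(t)=\sum_{\nu=1}^N f_\nu t^\nu$ with $f_\nu\in E_2$, and $\alpha_i^N(t)=\sum_{\nu=1}^N\alpha_{i\nu}t^\nu$ ($1\le i\le n-1$) with $\alpha_{i\nu}\in\mathbb R$, such that, as $t,s\to+0$ in $\overline D_i$, $\|K_i-\mathcal P_i\|=O((t+s)^{N+1})$ and $\|\partial_t K_i-\partial_t\mathcal P_i\|=O((t+s)^{N})$; and, as $t\to+0$, $\|f-f^N\|=O(t^{N+1})$, $\|f'-(f^N)'\|=O(t^N)$, $|\alpha_i-\alpha_i^N|=O(t^{N+1})$, $|\alpha_i'-(\alpha_i^N)'|=O(t^N)$. (D) $0<\varepsilon<1$ and $0<T'\le T$ are such that $|\alpha_i'(t)|\le\varepsilon$ on $[0,T']$ and $\alpha_i(t)/t\le\varepsilon$ on $(0,T']$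 for $i=1,\dots,n-1$; $K_n(t,t)$ has a bounded inverse for every $t\in[0,T']$; and $$\sup_{0<t<T'}\varepsilon^{N^*}\sum_{i=1}^{n-1}|\alpha_i'(t)|\,\bigl\|K_n^{-1}(t,t)\bigl(K_i(t,\alpha_i(t))-K_{i+1}(t,\alpha_i(t))\bigr)\bigr\|<1 .$$ (C1) Among $j\in\{0,1,\dots,N^*\}$ exactly the elements of a set $J$ are singular Fredholm points of $B$ (that is, $B(j)$ is a Fredholm operator of index $0$ without bounded inverse), and each $j\in J$ has a complete generalized Jordan set: there are $r=r_j$ chains of lengths $p_1,\dots,p_r\ge1$ (depending on $j$, possibly different), with elements $\phi_i^{(l)}\in E_1$ ($1\le i\le r$, $1\le l\le p_i$), such that $\phi_1^{(1)},\dots,\phi_r^{(1)}$ is a basis of $\ker B(j)$, $$B(j)\phi_i^{(l+1)}+\sum_{m=1}^{l}\binom{p_i+1-m}{p_i-l}B^{(l+1-m)}(j)\phi_i^{(m)}=0\qquad(1\le i\le r,\ 1\le l\le p_i-1),$$ and $$\det\Bigl[\bigl\langle B^{(p_i)}(j)\phi_i^{(1)}+B^{(p_i-1)}(j)\phi_i^{(2)}+\dots+B^{(1)}(j)\phi_i^{(p_i)},\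 \psi_k\bigr\rangle\Bigr]_{i,k=1}^r\ne0$$ for a basis $\psi_1,\dots,\psi_r$ of the kernel of the conjugate operator of $B(j)$. For every other $j\in\{0,\dots,N^*\}$ the operator $B(j)$ has a bounded inverse. Then equation (3) has on $0<t\le T'$ a family of solutions depending on $m=\sum_{j\in J}\sum_{i=1}^{r_j}p_i$ arbitrary constants, where $p_i=p_i(j)$ are the chain lengths at $j$. More precisely, there are functions $$x_c(t)=\hat x_c(t)+t^{N^*}u_c(t),\qquad \hat x_c(t)=\sum_{j=0}^{N^*}x_{c,j}(\ln t)\,t^j,\qquad c\in\mathbb K^m,$$ where the $x_{c,j}$ are polynomials in $\ln t$ with coefficients in $E_1$, of degree bounded independently of $c$, and these coefficients and $u_c$ depend affinely on $c$, such that: every $x_c$ is continuous on $(0,T']$, integrable on $(0,T']$, and satisfies (3) for all $t\in(0,T']$; $x_c\ne x_{c'}$ on $(0,T']$ whenever $c\ne c'$; $u_c$ is continuous on $(0,T']$ and $t^{\eta}u_c(t)\to0$ as $t\to+0$ for every $\eta>0$. If moreover $N>N^*$, then $u_c$ is continuous on $[0,T']$, and for the given $\hat x_c$ it is the only function in $C([0,T'];E_1)$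 for which $\hat x_c+t^{N^*}u_c$ solves (3) on $(0,T']$. -/

import Mathlib

open Set Filter Topology MeasureTheory Asymptotics

noncomputable section

namespace VolterraFirstKind

/-- Data of the Volterra operator equation of the first kind
`∑_{i=1}^n ∫_{α_{i-1}(t)}^{α_i(t)} K_i(t,s) x(s) ds = f(t)`, `0 < t ≤ T`,
with the standing assumptions on the curves `s = α_i(t)`, the kernels and the right-hand side.
The curves are `α 0 = 0 < α 1 < ⋯ < α (n-1) < α n = t`, the kernels are `K 1, …, K n`;
`α'`, `K'` and `f'` are the derivatives with respect to `t`. -/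
structure Data (𝕜 E₁ E₂ : Type*) [RCLike 𝕜]
    [NormedAddCommGroup E₁] [NormedSpace 𝕜 E₁] [NormedSpace ℝ E₁] [IsScalarTower ℝ 𝕜 E₁]
    [NormedAddCommGroup E₂] [NormedSpace 𝕜 E₂] [NormedSpace ℝ E₂] [IsScalarTower ℝ 𝕜 E₂] where
  /-- the number of kernels -/
  n : ℕ
  /-- the length of the time interval -/
  T : ℝ
  α : ℕ → ℝ → ℝ
  α' : ℕ → ℝ → ℝ
  K : ℕ → ℝ → ℝ → E₁ →L[𝕜] E₂
  K' : ℕ → ℝ → ℝ → E₁ →L[𝕜] E₂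
  f : ℝ → E₂
  f' : ℝ → E₂
  one_le_n : 1 ≤ n
  T_pos : 0 < T
  α_bot : ∀ t ∈ Icc 0 T, α 0 t = 0
  α_top : ∀ t ∈ Icc 0 T, α n t = t
  α_zero : ∀ i ≤ n, α i 0 = 0
  α_lt : ∀ i < n, ∀ t ∈ Ioc 0 T, α i t < α (i + 1) t
  α_hasDeriv : ∀ i ≤ n, ∀ t ∈ Icc 0 T, HasDerivWithinAt (α i) (α' i t) (Icc 0 T) t
  α'_cont : ∀ i ≤ n, ContinuousOn (α' i) (Icc 0 T)
  α'_lt : ∀ i < n, α' i 0 < α' (i + 1) 0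
  K_cont : ∀ i ∈ Finset.Icc 1 n, ContinuousOn (fun z : ℝ × ℝ => K i z.1 z.2)
    {z : ℝ × ℝ | z.1 ∈ Icc 0 T ∧ z.2 ∈ Icc (α (i - 1) z.1) (α i z.1)}
  K_hasDeriv : ∀ i ∈ Finset.Icc 1 n, ∀ t ∈ Ioo 0 T, ∀ s ∈ Ioo (α (i - 1) t) (α i t),
    HasDerivAt (fun τ => K i τ s) (K' i t s) t
  K'_cont : ∀ i ∈ Finset.Icc 1 n, ContinuousOn (fun z : ℝ × ℝ => K' i z.1 z.2)
    {z : ℝ × ℝ | z.1 ∈ Icc 0 T ∧ z.2 ∈ Icc (α (i - 1) z.1) (α i z.1)}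
  f_hasDeriv : ∀ t ∈ Icc 0 T, HasDerivWithinAt f (f' t) (Icc 0 T) t
  f'_cont : ContinuousOn f' (Icc 0 T)

section

variable {𝕜 E₁ E₂ : Type*} [RCLike 𝕜]
  [NormedAddCommGroup E₁] [NormedSpace 𝕜 E₁] [NormedSpace ℝ E₁] [IsScalarTower ℝ 𝕜 E₁]
  [NormedAddCommGroup E₂] [NormedSpace 𝕜 E₂] [NormedSpace ℝ E₂] [IsScalarTower ℝ 𝕜 E₂]

/-- The closed region `{(t, s) : 0 ≤ t ≤ T, α_{i-1}(t) ≤ s ≤ α_i(t)}` on which `K_i` lives. -/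
def Data.region (V : Data 𝕜 E₁ E₂) (i : ℕ) : Set (ℝ × ℝ) :=
  {z : ℝ × ℝ | z.1 ∈ Icc 0 V.T ∧ z.2 ∈ Icc (V.α (i - 1) z.1) (V.α i z.1)}

/-- `x` is a solution of the Volterra equation for `0 < t ≤ T'`: it is continuous on `(0, T']`,
integrable near `0`, and satisfies the equation for every `t ∈ (0, T']`. -/
def Data.IsSolutionOn (V : Data 𝕜 E₁ E₂) (T' : ℝ) (x : ℝ → E₁) : Prop :=
  ContinuousOn x (Ioc 0 T') ∧ IntegrableOn x (Ioc 0 T') ∧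
    ∀ t ∈ Ioc 0 T', ∑ i ∈ Finset.Icc 1 V.n, ∫ s in (V.α (i - 1) t)..(V.α i t), V.K i t s (x s)
      = V.f t

/-- The characteristic operator
`B(j) = K_n(0,0) + ∑_{i=1}^{n-1} α_i'(0)^{1+j} (K_i(0,0) - K_{i+1}(0,0))`. -/
def Data.charOp (V : Data 𝕜 E₁ E₂) (j : ℝ) : E₁ →L[𝕜] E₂ :=
  V.K V.n 0 0 + ∑ i ∈ Finset.Ico 1 V.n, (V.α' i 0 ^ (1 + j)) • (V.K i 0 0 - V.K (i + 1) 0 0)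

/-- Condition (B): the kernels, the right-hand side and the curves have Taylor polynomials
of degree `N`, and the expansions may be differentiated once with respect to `t`. -/
def Data.CondB (V : Data 𝕜 E₁ E₂) (N : ℕ) : Prop :=
  1 ≤ N ∧
  (∀ i ∈ Finset.Icc 1 V.n, ∃ P : ℕ → ℕ → E₁ →L[𝕜] E₂,
    ((fun z : ℝ × ℝ => V.K i z.1 z.2 -
        ∑ ν ∈ Finset.range (N + 1), ∑ μ ∈ Finset.range (N + 1 - ν), (z.1 ^ ν * z.2 ^ μ) • P ν μ)
      =O[𝓝[V.region i] (0, 0)] fun z : ℝ × ℝ => (z.1 + z.2) ^ (N + 1)) ∧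
    ((fun z : ℝ × ℝ => V.K' i z.1 z.2 -
        ∑ ν ∈ Finset.range (N + 1), ∑ μ ∈ Finset.range (N + 1 - ν),
          ((ν : ℝ) * z.1 ^ (ν - 1) * z.2 ^ μ) • P ν μ)
      =O[𝓝[V.region i] (0, 0)] fun z : ℝ × ℝ => (z.1 + z.2) ^ N)) ∧
  (∃ c : ℕ → E₂,
    ((fun t : ℝ => V.f t - ∑ ν ∈ Finset.Icc 1 N, t ^ ν • c ν)
      =O[𝓝[>] 0] fun t : ℝ => t ^ (N + 1)) ∧
    ((fun t : ℝ => V.f' t - ∑ ν ∈ Finset.Icc 1 N, ((ν : ℝ) * t ^ (ν - 1)) • c ν)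
      =O[𝓝[>] 0] fun t : ℝ => t ^ N)) ∧
  (∀ i ∈ Finset.Ico 1 V.n, ∃ c : ℕ → ℝ,
    ((fun t : ℝ => V.α i t - ∑ ν ∈ Finset.Icc 1 N, c ν * t ^ ν)
      =O[𝓝[>] 0] fun t : ℝ => t ^ (N + 1)) ∧
    ((fun t : ℝ => V.α' i t - ∑ ν ∈ Finset.Icc 1 N, c ν * ((ν : ℝ) * t ^ (ν - 1)))
      =O[𝓝[>] 0] fun t : ℝ => t ^ N))

/-- Condition (D), together with the choice of `ε` and `T'` that it refers to. -/
def Data.CondD (V : Data 𝕜 E₁ E₂) (ε T' : ℝ) (Nstar : ℕ) : Prop :=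
  0 < ε ∧ ε < 1 ∧ 0 < T' ∧ T' ≤ V.T ∧
  (∀ i ∈ Finset.Ico 1 V.n, ∀ t ∈ Icc 0 T', |V.α' i t| ≤ ε) ∧
  (∀ i ∈ Finset.Ico 1 V.n, ∀ t ∈ Ioc 0 T', V.α i t / t ≤ ε) ∧
  (∀ t ∈ Icc 0 T', (V.K V.n t t).IsInvertible) ∧
  ∃ q < 1, ∀ t ∈ Ioo 0 T',
    ε ^ Nstar * ∑ i ∈ Finset.Ico 1 V.n, |V.α' i t| *
      ‖(V.K V.n t t).inverse ∘L (V.K i t (V.α i t) - V.K (i + 1) t (V.α i t))‖ ≤ q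

/-- `j` is a singular Fredholm point of the operator function `B`: the operator `B j` is Fredholm
of index zero, but has no bounded inverse. -/
def IsSingularFredholmPoint (B : ℝ → E₁ →L[𝕜] E₂) (j : ℝ) : Prop :=
  (B j).IsFredholm ∧
  Module.finrank 𝕜 (B j).ker = Module.finrank 𝕜 (E₂ ⧸ (B j).range) ∧
  ¬ (B j).IsInvertible

/-- The operator function `B` has at the point `j` a complete generalized Jordan set consisting
of `r` chains of lengths `p 0, …, p (r - 1)`. The element `φ i l` is the `(l + 1)`-st element of
the `i`-th chain, `ψ` is a basis of the kernel of the conjugate operator of `B j`. -/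
def HasCompleteJordanSet (B : ℝ → E₁ →L[𝕜] E₂) (j : ℝ) (r : ℕ) (p : Fin r → ℕ) : Prop :=
  ∃ (φ : Fin r → ℕ → E₁) (ψ : Fin r → StrongDual 𝕜 E₂),
    (∀ i, 1 ≤ p i) ∧
    LinearIndependent 𝕜 (fun i => φ i 0) ∧
    Submodule.span 𝕜 (range fun i => φ i 0) = (B j).ker ∧
    LinearIndependent 𝕜 ψ ∧
    Submodule.span 𝕜 (range ψ) =
      (ContinuousLinearMap.precomp 𝕜 (B j) : StrongDual 𝕜 E₂ →L[𝕜] StrongDual 𝕜 E₁).ker ∧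
    (∀ i, ∀ l < p i, ∑ m ∈ Finset.range (l + 1),
      (p i - m).choose (p i - l) • iteratedDeriv (l - m) B j (φ i m) = 0) ∧
    (Matrix.of fun i k => ψ k (∑ m ∈ Finset.range (p i),
      iteratedDeriv (p i - m) B j (φ i m))).det ≠ 0

/-- Condition (C1): among `0, 1, …, Nstar` exactly the elements of `J` are singular Fredholm points
of the characteristic operator; each `j ∈ J` has a complete generalized Jordan set, with `r j`
chains of lengths `p j i`; the remaining points are regular. -/
def Data.CondC1 (V : Data 𝕜 E₁ E₂) (Nstar : ℕ) (J : Finset ℕ) (r : ℕ → ℕ)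
    (p : (j : ℕ) → Fin (r j) → ℕ) : Prop :=
  (∀ j ∈ J, j ≤ Nstar ∧ IsSingularFredholmPoint V.charOp j ∧
    HasCompleteJordanSet V.charOp j (r j) (p j)) ∧
  ∀ j ≤ Nstar, j ∉ J → (V.charOp j).IsInvertible

/-- The logarithm-power sum `∑_{j=0}^N x_j(ln t) t^j`, where `x_j(z) = ∑_{k=0}^d z^k a_{jk}`. -/
def logPowerSum (N d : ℕ) (a : ℕ → ℕ → E₁) (t : ℝ) : E₁ :=
  ∑ j ∈ Finset.range (N + 1), t ^ j • ∑ k ∈ Finset.range (d + 1), Real.log t ^ k • a j k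

end

end VolterraFirstKind

end

open Set Filter Topology MeasureTheory Asymptotics

noncomputable section

namespace VolterraFirstKind

/-! ### Formal power series behind polynomials in the logarithm -/

section Chains

/-! Differentiation turns the equation of the first kind into `diffOp x = f'`, in which `x(t)`
appears with the invertible coefficient `K_n(t,t)`, together with the values `x(α_i(t))` and
integral terms. Nothing is lost (`intOp_eq_iff`), because both sides of the original equation vanish
at `t = 0`.

Near `0` one has `α_i(t) ≈ α_i'(0) t`, so with `z = ln t` passing from `t` to `α_i(t)` is, to
leading order, a translation of `z` by `ln α_i'(0)`. Hence `diffOp` sends `t^j P(ln t)` to `t^j (B(j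
+ d/dz) P)(ln t)` plus terms of order `j + 1` (`CondB.diffOp_chainFun`). A polynomial `P` is encoded
as the coefficient of `λ^D` in `e^{zλ} ξ(λ)`; then `B(j + d/dz)` becomes multiplication of `ξ` by
the Taylor series of `B` at `j` (`shiftOp_chainFun`).

In this language a Jordan chain of length `p` is a series `ξ` with `B(j + λ) ξ(λ) = O(λ^p)`, so its
truncations give `p` log-polynomials annihilated by the leading operator. Completeness says that the
`λ^p` coefficients, together with the range of `B(j)`, fill `E₂` (`exists_chains`); hence every
polynomial right-hand side is attained, at the price of a higher power of `ln t`
(`exists_opConv_eq`). Condition (B) gives all data expansions modulo `O(t^{N-η})`, where an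
arbitrarily small `η` absorbs logarithms, and residuals are removed order by order
(`CondB.exists_logPow_correction`).

What is left is solved by a fixed point argument. In the weight `t^γ e^{Lt}` the delayed values gain
`(α_i(t)/t)^γ ≤ ε^γ`, which by (D) makes their part contractive for `γ` down to slightly below `N*`,
and a large `L` makes the integrals small (`exists_remOp_bound`). This yields existence and
uniqueness of small remainders (`exists_diffOp_eq`, `eq_zero_of_diffOp_eq_zero`).

The same correction applied to a truncated Jordan chain gives a homogeneous solution with that
leading term. Condition (D) at `t = 0` forces `B(N*)` to be injective, so singular orders lie
strictly below `N*` and the remainders cannot disturb leading terms. Comparing these terms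
(`eq_zero_of_sum_smul_eventually_eq_zero`) proves independence of the `m` homogeneous solutions, and
adding them to one particular solution gives the affine family. -/

/-- The polynomial `∑_{k + l = D} z^k / k! ξ_l` generated by the sequence `ξ`. -/
def chainFun {E : Type*} [AddCommGroup E] [Module ℝ E] (ξ : ℕ → E) (D : ℕ) (z : ℝ) : E :=
  ∑ q ∈ Finset.HasAntidiagonal.antidiagonal D, (z ^ q.1 / (q.1.factorial : ℝ)) • ξ q.2

/-- The convolution of a sequence of operators with a sequence of vectors. -/
def opConv {𝕜 E F : Type*} [NontriviallyNormedField 𝕜] [NormedAddCommGroup E] [NormedSpace 𝕜 E]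
    [NormedAddCommGroup F] [NormedSpace 𝕜 F] (B : ℕ → E →L[𝕜] F) (ξ : ℕ → E) (l : ℕ) : F :=
  ∑ q ∈ Finset.HasAntidiagonal.antidiagonal l, B q.1 (ξ q.2)

/-- The sequence `ξ` shifted `s` places to the right. -/
def seqShift {E : Type*} [Zero E] (s : ℕ) (ξ : ℕ → E) (l : ℕ) : E :=
  if l < s then 0 else ξ (l - s)

lemma sum_antidiagonal_assoc {M : Type*} [AddCommMonoid M] (n : ℕ) (g : ℕ → ℕ → ℕ → M) :
    ∑ q ∈ Finset.HasAntidiagonal.antidiagonal n, ∑ s ∈ Finset.HasAntidiagonal.antidiagonal q.1, g s.1 s.2 q.2 =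
      ∑ q ∈ Finset.HasAntidiagonal.antidiagonal n, ∑ s ∈ Finset.HasAntidiagonal.antidiagonal q.2, g q.1 s.1 s.2 := by
  rw [Finset.sum_sigma', Finset.sum_sigma']
  refine Finset.sum_nbij' (fun x => ⟨(x.2.1, x.2.2 + x.1.2), (x.2.2, x.1.2)⟩)
    (fun x => ⟨(x.1.1 + x.2.1, x.2.2), (x.1.1, x.2.1)⟩) ?_ ?_ ?_ ?_ ?_
  · rintro ⟨⟨a, b⟩, ⟨c, d⟩⟩ h
    simp only [Finset.mem_sigma, Finset.HasAntidiagonal.mem_antidiagonal] at h ⊢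
    obtain ⟨h1, h2⟩ := h
    subst h2 h1
    exact ⟨(add_assoc _ _ _).symm, trivial⟩
  · rintro ⟨⟨a, b⟩, ⟨c, d⟩⟩ h
    simp only [Finset.mem_sigma, Finset.HasAntidiagonal.mem_antidiagonal] at h ⊢
    obtain ⟨h1, h2⟩ := h
    subst h2 h1
    exact ⟨add_assoc _ _ _, trivial⟩
  · rintro ⟨⟨a, b⟩, ⟨c, d⟩⟩ h
    simp only [Finset.mem_sigma, Finset.HasAntidiagonal.mem_antidiagonal] at h
    obtain ⟨h1, h2⟩ := h
    subst h2
    rfl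
  · rintro ⟨⟨a, b⟩, ⟨c, d⟩⟩ h
    simp only [Finset.mem_sigma, Finset.HasAntidiagonal.mem_antidiagonal] at h
    obtain ⟨h1, h2⟩ := h
    subst h2
    rfl
  · rintro ⟨⟨a, b⟩, ⟨c, d⟩⟩ h
    rfl

lemma add_pow_div_factorial (x y : ℝ) (n : ℕ) :
    (x + y) ^ n / (n.factorial : ℝ) = ∑ q ∈ Finset.HasAntidiagonal.antidiagonal n,
      (x ^ q.1 / (q.1.factorial : ℝ)) * (y ^ q.2 / (q.2.factorial : ℝ)) := by
  rw [(Commute.all x y).add_pow', Finset.sum_div]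
  refine Finset.sum_congr rfl fun q hq => ?_
  obtain rfl := Finset.HasAntidiagonal.mem_antidiagonal.1 hq
  have h1 : (((q.1 + q.2).choose q.1 : ℕ) : ℝ) * (q.1.factorial * q.2.factorial) =
      (q.1 + q.2).factorial := by
    have := Nat.choose_mul_factorial_mul_factorial (Nat.le_add_right q.1 q.2)
    rw [Nat.add_sub_cancel_left] at this
    rw [← this]
    push_cast
    ring
  have h2 := Nat.factorial_ne_zero q.1
  have h3 := Nat.factorial_ne_zero q.2
  have h4 := Nat.factorial_ne_zero (q.1 + q.2)
  rw [nsmul_eq_mul, ← h1]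
  have h5 : (((q.1 + q.2).choose q.1 : ℕ) : ℝ) ≠ 0 := by
    intro h
    rw [h, zero_mul] at h1
    exact h4 (by exact_mod_cast h1.symm)
  field_simp

/-- `chainFun ξ D z` is the coefficient of `λ^D` in `e^{zλ} ξ(λ)`, so `e^{(z+a)λ} = e^{zλ} e^{aλ}`
turns a translation of `z` into a multiplication of the series `ξ` by `e^{aλ}`. -/
lemma chainFun_add_arg {E : Type*} [AddCommGroup E] [Module ℝ E] (ξ : ℕ → E) (D : ℕ) (z a : ℝ) :
    chainFun ξ D (z + a) = chainFun (fun l => chainFun ξ l a) D z := by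
  simp only [chainFun, add_pow_div_factorial, Finset.sum_smul, Finset.smul_sum, smul_smul]
  exact sum_antidiagonal_assoc D
    (fun i j k => (z ^ i / (i.factorial : ℝ) * (a ^ j / (j.factorial : ℝ))) • ξ k)

lemma chainFun_congr {E : Type*} [AddCommGroup E] [Module ℝ E] {ξ η : ℕ → E} {D : ℕ}
    (h : ∀ l ≤ D, ξ l = η l) : chainFun ξ D = chainFun η D := by
  funext z
  refine Finset.sum_congr rfl fun q hq => ?_
  rw [h _ (Finset.HasAntidiagonal.antidiagonal.snd_le hq)]

/-- Multiplying `ξ(λ)` by `λ^s` moves the coefficient at `D` to `s + D`. This brings polynomials of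
different degrees to a common order. -/
lemma chainFun_seqShift {E : Type*} [AddCommGroup E] [Module ℝ E] (ξ : ℕ → E) (s D : ℕ) :
    chainFun (seqShift s ξ) (s + D) = chainFun ξ D := by
  funext z
  simp only [chainFun]
  rw [← Finset.Nat.sum_antidiagonal_swap, ← Finset.Nat.sum_antidiagonal_swap (n := D),
    Finset.Nat.sum_antidiagonal_eq_sum_range_succ_mk,
    Finset.Nat.sum_antidiagonal_eq_sum_range_succ_mk, Nat.succ_eq_add_one, add_assoc,
    Finset.sum_range_add]
  rw [Finset.sum_eq_zero, zero_add]
  · refine Finset.sum_congr rfl fun k hk => ?_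
    simp [seqShift, Nat.add_sub_add_left]
  · intro k hk
    simp [seqShift, Finset.mem_range.1 hk]

section OpConv

variable {𝕜 E F : Type*} [NontriviallyNormedField 𝕜] [NormedAddCommGroup E] [NormedSpace 𝕜 E]
    [NormedAddCommGroup F] [NormedSpace 𝕜 F] (B : ℕ → E →L[𝕜] F)

lemma opConv_add (ξ η : ℕ → E) : opConv B (ξ + η) = opConv B ξ + opConv B η := by
  funext l
  simp [opConv, Finset.sum_add_distrib]

lemma opConv_smul (c : 𝕜) (ξ : ℕ → E) : opConv B (c • ξ) = c • opConv B ξ := by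
  funext l
  simp [opConv, Finset.smul_sum]

lemma opConv_sum {ι : Type*} (s : Finset ι) (ξ : ι → ℕ → E) :
    opConv B (∑ i ∈ s, ξ i) = ∑ i ∈ s, opConv B (ξ i) := by
  classical
  induction s using Finset.induction_on with
  | empty => funext l; simp [opConv]
  | insert a s ha ih => rw [Finset.sum_insert ha, Finset.sum_insert ha, opConv_add, ih]

/-- `opConv` is the product `B(λ) ξ(λ)` of series, which commutes with multiplication by `λ^s`. -/
lemma opConv_seqShift (s : ℕ) (ξ : ℕ → E) :
    opConv B (seqShift s ξ) = seqShift s (opConv B ξ) := by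
  funext l
  simp only [opConv]
  rw [← Finset.Nat.sum_antidiagonal_swap, Finset.Nat.sum_antidiagonal_eq_sum_range_succ_mk]
  by_cases hl : l < s
  · simp only [seqShift, if_pos hl]
    refine Finset.sum_eq_zero fun k hk => ?_
    have : k < s := by have := Finset.mem_range.1 hk; omega
    simp [this]
  · obtain ⟨D, rfl⟩ := Nat.exists_eq_add_of_le (not_lt.1 hl)
    simp only [seqShift, if_neg hl, Nat.add_sub_cancel_left]
    rw [opConv, ← Finset.Nat.sum_antidiagonal_swap (n := D),
      Finset.Nat.sum_antidiagonal_eq_sum_range_succ_mk, Nat.succ_eq_add_one, add_assoc,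
      Finset.sum_range_add,
      Finset.sum_eq_zero, zero_add]
    · refine Finset.sum_congr rfl fun k hk => ?_
      simp [show s + D - (s + k) = D - k by omega]
    · intro k hk
      simp [Finset.mem_range.1 hk]

/-- If every constant can be reached by a chain of length `P`, then every sequence can. -/
lemma exists_opConv_eq (P : ℕ)
    (h : ∀ y : F, ∃ ξ : ℕ → E, ∀ l ≤ P, opConv B ξ l = if l = P then y else 0)
    (η : ℕ → F) (D : ℕ) :
    ∃ ξ : ℕ → E, ∀ l ≤ P + D, opConv B ξ l = seqShift P η l := by
  induction D with
  | zero =>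
    obtain ⟨ξ, hξ⟩ := h (η 0)
    refine ⟨ξ, fun l hl => ?_⟩
    rw [hξ l hl, seqShift]
    by_cases h1 : l = P
    · subst h1; simp
    · rw [if_neg h1, if_pos (by omega)]
  | succ D ih =>
    obtain ⟨ξ, hξ⟩ := ih
    -- Shifted by `D + 1`, the new chain leaves all orders below `P + D + 1` unchanged and supplies
    -- the missing vector at that order.
    obtain ⟨ζ, hζ⟩ := h (η (D + 1) - opConv B ξ (P + (D + 1)))
    refine ⟨ξ + seqShift (D + 1) ζ, fun l hl => ?_⟩
    rw [opConv_add, opConv_seqShift, Pi.add_apply]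
    by_cases h1 : l = P + (D + 1)
    · subst h1
      have e1 : ¬ (P + (D + 1) < D + 1) := by omega
      have e2 : P + (D + 1) - (D + 1) = P := by omega
      have e3 : ¬ (P + (D + 1) < P) := by omega
      have e4 : P + (D + 1) - P = D + 1 := by omega
      rw [seqShift, seqShift, if_neg e1, e2, if_neg e3, e4, hζ P le_rfl, if_pos rfl]
      abel
    · rw [hξ l (by omega), add_eq_left]
      rw [seqShift]
      split_ifs with h2
      · rfl
      · rw [hζ _ (by omega), if_neg (by omega)]

/-- Truncated Jordan chains that are complete, i.e. whose last residuals together with the range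
of `B 0` exhaust the space, reach every constant. -/
lemma exists_opConv_eq_single {ι : Type*} [Fintype ι] (p : ι → ℕ) (ξ : ι → ℕ → E)
    (hξ : ∀ i, ∀ l < p i, opConv B (ξ i) l = 0)
    (hsurj : ∀ y : F, ∃ (w : E) (c : ι → 𝕜), y = B 0 w + ∑ i, c i • opConv B (ξ i) (p i))
    (y : F) : ∃ ζ : ℕ → E, ∀ l ≤ Finset.univ.sup p,
      opConv B ζ l = if l = Finset.univ.sup p then y else 0 := by
  obtain ⟨w, c, rfl⟩ := hsurj y
  set P := Finset.univ.sup p with hP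
  have hp : ∀ i, p i ≤ P := fun i => Finset.le_sup (Finset.mem_univ i)
  -- At order `P` the term with `w` contributes `B 0 w`; the shift `P - p i` brings the residual of
  -- chain `i`, located at order `p i`, to order `P` as well.
  refine ⟨seqShift P (fun _ => w) + ∑ i, c i • seqShift (P - p i) (ξ i), fun l hl => ?_⟩
  rw [opConv_add, opConv_sum]
  simp only [opConv_smul, opConv_seqShift, Pi.add_apply, Finset.sum_apply, Pi.smul_apply]
  split_ifs with h1
  · subst h1
    congr 1
    · simp [seqShift, opConv]
    · refine Finset.sum_congr rfl fun i _ => ?_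
      have := hp i
      rw [seqShift, if_neg (by omega), show P - (P - p i) = p i by omega]
  · rw [seqShift, if_pos (by omega), zero_add]
    refine Finset.sum_eq_zero fun i _ => ?_
    rw [seqShift]
    split_ifs
    · exact smul_zero _
    · have := hp i
      rw [hξ i _ (by omega), smul_zero]

end OpConv

/-- The system is triangular: at order `m` the only contributing indices are `l ≥ D - m`; the one
with `l = D - m` multiplies `ξ i 0`, and those with larger `l` have already been shown to have zero
coefficients. -/
lemma linearIndependent_seqShift {𝕜 E ι : Type*} [Field 𝕜] [AddCommGroup E] [Module 𝕜 E]
    [Fintype ι] (p : ι → ℕ) (ξ : ι → ℕ → E)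
    (hli : LinearIndependent 𝕜 fun i => ξ i 0) (c : (i : ι) → Fin (p i) → 𝕜)
    (D : ℕ) (hD : ∀ i, p i ≤ D + 1)
    (h : ∀ m ≤ D, ∑ i, ∑ l : Fin (p i), c i l • seqShift (D - l) (ξ i) m = 0) : c = 0 := by
  have key : ∀ m ≤ D, ∀ i (l : Fin (p i)), (l : ℕ) = D - m → c i l = 0 := by
    intro m
    induction m using Nat.strong_induction_on with
    | _ m ih =>
      intro hm i l hl
      have h0 := h m hm
      have h1 : ∑ i, (if hi : D - m < p i then c i ⟨D - m, hi⟩ else 0) • ξ i 0 = 0 := by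
        rw [← h0]
        refine Finset.sum_congr rfl fun i _ => ?_
        have hz : ∀ l : Fin (p i), (l : ℕ) ≠ D - m → c i l • seqShift (D - l) (ξ i) m = 0 := by
          intro l hl
          have hlt := l.2
          have := hD i
          rw [seqShift]
          split_ifs with h3
          · exact smul_zero _
          · rw [ih (D - l) (by omega) (by omega) i l (by omega), zero_smul]
        split_ifs with hi
        · rw [Finset.sum_eq_single (⟨D - m, hi⟩ : Fin (p i))]
          · simp [seqShift, show D - (D - m) = m by omega]
          · intro b _ hb
            exact hz b fun h => hb (Fin.ext h)
          · simp
        · rw [zero_smul, Finset.sum_eq_zero]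
          intro l _
          exact hz l (by have := l.2; omega)
      have h2 := Fintype.linearIndependent_iff.1 hli _ h1 i
      rw [dif_pos (by rw [← hl]; exact l.2)] at h2
      rw [← h2]
      congr 1
      exact Fin.ext hl
  funext i l
  have := l.2
  have := hD i
  exact key (D - l) (by omega) i l (by omega)

end Chains

/-! ### Jordan chains and the characteristic operator -/

section Jordan

variable {𝕜 E₁ E₂ : Type*} [RCLike 𝕜]
  [NormedAddCommGroup E₁] [NormedSpace 𝕜 E₁] [NormedSpace ℝ E₁] [IsScalarTower ℝ 𝕜 E₁]
  [NormedAddCommGroup E₂] [NormedSpace 𝕜 E₂] [NormedSpace ℝ E₂] [IsScalarTower ℝ 𝕜 E₂]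

/-- A complete generalized Jordan set at a singular Fredholm point, in the normalization of the
Taylor coefficients `C q = B^{(q)}(j) / q!`. -/
lemma HasCompleteJordanSet.exists_chains {B : ℝ → E₁ →L[𝕜] E₂} {j : ℝ} {r : ℕ} {p : Fin r → ℕ}
    (h : HasCompleteJordanSet B j r p) (hs : IsSingularFredholmPoint B j)
    (C : ℕ → E₁ →L[𝕜] E₂) (hC : ∀ q, iteratedDeriv q B j = q.factorial • C q) :
    ∃ ξ : Fin r → ℕ → E₁, LinearIndependent 𝕜 (fun i => ξ i 0) ∧
      (∀ i, 1 ≤ p i) ∧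
      (∀ i, ∀ l < p i, opConv C (ξ i) l = 0) ∧
      ∀ y : E₂, ∃ (w : E₁) (c : Fin r → 𝕜), y = C 0 w + ∑ i, c i • opConv C (ξ i) (p i) := by
  obtain ⟨φ, ψ, hp, hli, hspan, -, hψ, hchain, hdet⟩ := h
  have hC0 : C 0 = B j := by simpa using (hC 0).symm
  -- The weight `(p - l)!` absorbs the binomials, since `choose (p - m) (p - l) * (l - m)! * (p -
  -- l)! = (p - m)!`. Cutting off at `p i` makes the coefficient at order `p i` equal to the vector
  -- in the determinant.
  let ξ : Fin r → ℕ → E₁ := fun i l => if l < p i then (p i - l).factorial • φ i l else 0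
  have hconv : ∀ i, ∀ l < p i, opConv C (ξ i) l = 0 := by
    intro i l hl
    have h1 := hchain i l hl
    rw [← smul_zero ((p i - l).factorial : 𝕜), ← h1, opConv, ← Finset.Nat.sum_antidiagonal_swap,
      Finset.Nat.sum_antidiagonal_eq_sum_range_succ_mk, Finset.smul_sum]
    refine Finset.sum_congr rfl fun m hm => ?_
    have hm' : m ≤ l := Nat.lt_succ_iff.1 (Finset.mem_range.1 hm)
    simp only [Prod.fst_swap, Prod.snd_swap, ξ]
    rw [if_pos (by omega), hC]
    simp only [← Nat.cast_smul_eq_nsmul 𝕜, _root_.smul_apply, map_smul, smul_smul]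
    congr 1
    have := Nat.choose_mul_factorial_mul_factorial (show p i - l ≤ p i - m by omega)
    rw [show p i - m - (p i - l) = l - m by omega] at this
    rw [← this]
    push_cast
    ring
  have hres : ∀ i, opConv C (ξ i) (p i) =
      ∑ m ∈ Finset.range (p i), iteratedDeriv (p i - m) B j (φ i m) := by
    intro i
    rw [opConv, ← Finset.Nat.sum_antidiagonal_swap,
      Finset.Nat.sum_antidiagonal_eq_sum_range_succ_mk, Finset.sum_range_succ]
    simp only [Prod.fst_swap, Prod.snd_swap, ξ]
    rw [if_neg (lt_irrefl _), map_zero, add_zero]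
    refine Finset.sum_congr rfl fun m hm => ?_
    rw [if_pos (Finset.mem_range.1 hm), hC]
    simp
  refine ⟨ξ, ?_, hp, hconv, ?_⟩
  · have hu : ∀ i, ((p i).factorial : 𝕜) ≠ 0 := fun i => by
      exact_mod_cast Nat.factorial_ne_zero _
    have := hli.units_smul (fun i => Units.mk0 _ (hu i))
    convert this using 2 with i
    simp [ξ, Nat.lt_of_lt_of_le Nat.zero_lt_one (hp i), Units.smul_def, Nat.cast_smul_eq_nsmul]
  · intro y
    obtain ⟨hF, hrank, -⟩ := hs
    have hcofin : Module.Finite 𝕜 (E₂ ⧸ (B j).range) := hF.finite_coker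
    have hr : Module.finrank 𝕜 (E₂ ⧸ (B j).range) = r := by
      rw [← hrank, ← hspan, finrank_span_eq_card hli, Fintype.card_fin]
    -- Each `ψ k` annihilates the range of `B j`, so the nonzero determinant makes the residuals
    -- independent modulo the range. Index zero makes `r` the codimension of the range, hence they
    -- span the quotient.
    have hv : LinearIndependent 𝕜
        fun i => (B j).range.mkQ (opConv C (ξ i) (p i)) := by
      rw [Fintype.linearIndependent_iff]
      intro c hc
      have hmem : ∑ i, c i • opConv C (ξ i) (p i) ∈ (B j).range := by
        rw [← Submodule.ker_mkQ (B j).range, LinearMap.mem_ker, map_sum, ← hc]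
        simp only [map_smul]
      obtain ⟨x, hx⟩ := hmem
      have hψ0 : ∀ k, ψ k (∑ i, c i • opConv C (ξ i) (p i)) = 0 := by
        intro k
        have h1 : ψ k ∈ (ContinuousLinearMap.precomp 𝕜 (B j) :
            StrongDual 𝕜 E₂ →L[𝕜] StrongDual 𝕜 E₁).ker := by
          rw [← hψ]
          exact Submodule.subset_span (mem_range_self k)
        rw [← hx]
        exact congrArg (fun g : StrongDual 𝕜 E₁ => g x) h1
      have hvm : Matrix.vecMul c (Matrix.of fun i k => ψ k (∑ m ∈ Finset.range (p i),
          iteratedDeriv (p i - m) B j (φ i m))) = 0 := by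
        funext k
        rw [Pi.zero_apply, ← hψ0 k, map_sum]
        simp only [Matrix.vecMul, dotProduct, Matrix.of_apply, map_smul, smul_eq_mul, hres]
      exact fun i => congrFun (Matrix.eq_zero_of_vecMul_eq_zero hdet hvm) i
    have htop := hv.span_eq_top_of_card_eq_finrank' (by rw [Fintype.card_fin, hr])
    have hy : (B j).range.mkQ y ∈ Submodule.span 𝕜
        (range fun i => (B j).range.mkQ (opConv C (ξ i) (p i))) := by
      rw [htop]; trivial
    obtain ⟨c, hc⟩ := (Submodule.mem_span_range_iff_exists_fun 𝕜).1 hy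
    have hmem : y - ∑ i, c i • opConv C (ξ i) (p i) ∈ (B j).range := by
      rw [← Submodule.ker_mkQ (B j).range, LinearMap.mem_ker, map_sub, ← hc, map_sum]
      simp only [map_smul, sub_self]
    obtain ⟨w, hw⟩ := hmem
    refine ⟨w, c, ?_⟩
    rw [hC0]
    have hw' : B j w = y - ∑ i, c i • opConv C (ξ i) (p i) := hw
    rw [hw']
    abel

/-- The Taylor coefficients at `j` of the characteristic operator. -/
def Data.charCoeff (V : Data 𝕜 E₁ E₂) (j : ℝ) (q : ℕ) : E₁ →L[𝕜] E₂ :=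
  (if q = 0 then V.K V.n 0 0 else 0) + ∑ i ∈ Finset.Ico 1 V.n,
    (V.α' i 0 ^ (1 + j) * (Real.log (V.α' i 0) ^ q / (q.factorial : ℝ))) •
      (V.K i 0 0 - V.K (i + 1) 0 0)

lemma Data.α'_zero_zero (V : Data 𝕜 E₁ E₂) {t : ℝ} (ht : t ∈ Icc 0 V.T) : V.α' 0 t = 0 := by
  have h1 := V.α_hasDeriv 0 (Nat.zero_le _) t ht
  have h2 : HasDerivWithinAt (V.α 0) 0 (Icc 0 V.T) t :=
    (hasDerivWithinAt_const t _ (0 : ℝ)).congr (fun s hs => V.α_bot s hs) (V.α_bot t ht)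
  exact (uniqueDiffOn_Icc V.T_pos t ht).eq_deriv _ h1 h2

lemma Data.α'_top (V : Data 𝕜 E₁ E₂) {t : ℝ} (ht : t ∈ Icc 0 V.T) : V.α' V.n t = 1 := by
  have h1 := V.α_hasDeriv V.n le_rfl t ht
  have h2 : HasDerivWithinAt (V.α V.n) 1 (Icc 0 V.T) t :=
    (hasDerivWithinAt_id t _).congr (fun s hs => V.α_top s hs) (V.α_top t ht)
  exact (uniqueDiffOn_Icc V.T_pos t ht).eq_deriv _ h1 h2

lemma Data.α'_zero_pos (V : Data 𝕜 E₁ E₂) {i : ℕ} (h1 : 1 ≤ i) (hn : i ≤ V.n) :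
    0 < V.α' i 0 := by
  induction i with
  | zero => omega
  | succ k ih =>
    have h2 := V.α'_lt k (by omega)
    rcases Nat.eq_zero_or_pos k with rfl | hk
    · rwa [V.α'_zero_zero ⟨le_rfl, V.T_pos.le⟩] at h2
    · exact (ih hk (by omega)).trans h2

lemma Data.iteratedDeriv_charOp (V : Data 𝕜 E₁ E₂) (q : ℕ) (j : ℝ) :
    iteratedDeriv q V.charOp j = q.factorial • V.charCoeff j q := by
  have key : ∀ q : ℕ, iteratedDeriv q V.charOp = fun x : ℝ =>
      (if q = 0 then V.K V.n 0 0 else 0) + ∑ i ∈ Finset.Ico 1 V.n,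
        (V.α' i 0 ^ (1 + x) * Real.log (V.α' i 0) ^ q) • (V.K i 0 0 - V.K (i + 1) 0 0) := by
    intro q
    induction q with
    | zero =>
      funext x
      simp [Data.charOp]
    | succ q ih =>
      rw [iteratedDeriv_succ, ih]
      funext x
      refine HasDerivAt.deriv ?_
      rw [if_neg (Nat.succ_ne_zero q)]
      refine (hasDerivAt_const x (if q = 0 then V.K V.n 0 0 else 0)).add (HasDerivAt.fun_sum fun i hi => ?_)
      have hi' := Finset.mem_Ico.1 hi
      have hpos := V.α'_zero_pos hi'.1 hi'.2.le
      have h1 : HasDerivAt (fun x : ℝ => V.α' i 0 ^ (1 + x))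
          (Real.log (V.α' i 0) * 1 * V.α' i 0 ^ (1 + x)) x :=
        HasDerivAt.const_rpow hpos ((hasDerivAt_id x).const_add 1)
      have h2 : HasDerivAt (fun x : ℝ => V.α' i 0 ^ (1 + x) * Real.log (V.α' i 0) ^ q)
          (V.α' i 0 ^ (1 + x) * Real.log (V.α' i 0) ^ (q + 1)) x := by
        refine (h1.mul_const (Real.log (V.α' i 0) ^ q)).congr_deriv ?_
        rw [pow_succ]
        ring
      exact h2.smul_const (V.K i 0 0 - V.K (i + 1) 0 0)
  rw [key, Data.charCoeff, smul_add, Finset.smul_sum]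
  beta_reduce
  have hq : ((q.factorial : ℕ) : ℝ) ≠ 0 := by exact_mod_cast Nat.factorial_ne_zero q
  congr 1
  · split_ifs with h
    · subst h; simp
    · simp
  · refine Finset.sum_congr rfl fun i _ => ?_
    rw [← Nat.cast_smul_eq_nsmul ℝ, smul_smul]
    congr 1
    field_simp

lemma Data.charCoeff_zero (V : Data 𝕜 E₁ E₂) (j : ℝ) : V.charCoeff j 0 = V.charOp j := by
  simpa using (V.iteratedDeriv_charOp 0 j).symm

/-- The shift operator `B(j + d/dz)` on functions of the logarithmic variable `z`. -/
def Data.shiftOp (V : Data 𝕜 E₁ E₂) (j : ℕ) (x : ℝ → E₁) (z : ℝ) : E₂ :=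
  V.K V.n 0 0 (x z) + ∑ i ∈ Finset.Ico 1 V.n, V.α' i 0 ^ (1 + j) •
    (V.K i 0 0 - V.K (i + 1) 0 0) (x (z + Real.log (V.α' i 0)))

/-- Translation by `ln a` is `e^{(ln a) d/dz}`, so `a^{1+j}` times it is `a^{1+j+d/dz}` and
`shiftOp` is `B(j + d/dz)`. On `e^{zλ}` it acts as multiplication by `B(j + λ)`; the claim is the
coefficient of `λ^D`. -/
lemma Data.shiftOp_chainFun (V : Data 𝕜 E₁ E₂) (j : ℕ) (ξ : ℕ → E₁) (D : ℕ) :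
    V.shiftOp j (chainFun ξ D) = chainFun (opConv (V.charCoeff j) ξ) D := by
  have hsum : ∀ (L : E₁ →L[𝕜] E₂) (η : ℕ → E₁) (m : ℕ) (w : ℝ),
      L (chainFun η m w) = chainFun (fun l => L (η l)) m w := by
    intro L η m w
    simp only [chainFun, map_sum]
    refine Finset.sum_congr rfl fun q _ => ?_
    exact (L.restrictScalars ℝ).map_smul _ _
  have hsmul : ∀ (L : E₁ →L[𝕜] E₂) (c : ℝ) (v : E₁), L (c • v) = c • L v := fun L c v =>
    (L.restrictScalars ℝ).map_smul c v
  have hopc : ∀ l, opConv (V.charCoeff j) ξ l = V.K V.n 0 0 (ξ l) + ∑ i ∈ Finset.Ico 1 V.n,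
      V.α' i 0 ^ (1 + j) •
        (V.K i 0 0 - V.K (i + 1) 0 0) (chainFun ξ l (Real.log (V.α' i 0))) := by
    intro l
    simp only [opConv, Data.charCoeff, _root_.add_apply, Finset.sum_add_distrib]
    congr 1
    · rw [Finset.sum_eq_single (0, l)]
      · simp
      · rintro ⟨a, b⟩ h1 h2
        have h3 := Finset.HasAntidiagonal.mem_antidiagonal.1 h1
        have : a ≠ 0 := by
          rintro rfl
          exact h2 (by simp_all)
        simp [this]
      · simp
    · simp only [_root_.sum_apply]
      rw [Finset.sum_comm]
      refine Finset.sum_congr rfl fun i _ => ?_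
      rw [hsum, chainFun, Finset.smul_sum]
      refine Finset.sum_congr rfl fun q _ => ?_
      rw [smul_smul, ← Nat.cast_one (R := ℝ), ← Nat.cast_add, Real.rpow_natCast]
      rfl
  funext z
  rw [Data.shiftOp]
  simp only [chainFun_add_arg, hsum]
  simp only [chainFun, hopc, smul_add, Finset.sum_add_distrib, map_sum, hsmul]
  congr 1
  simp only [Finset.smul_sum]
  rw [Finset.sum_comm]
  refine Finset.sum_congr rfl fun q _ => Finset.sum_congr rfl fun i _ =>
    Finset.sum_congr rfl fun s _ => ?_
  rw [smul_comm]

end Jordan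

/-! ### Log-power expansions near zero -/

section LogPower

variable {E F : Type*} [NormedAddCommGroup E] [NormedSpace ℝ E]
  [NormedAddCommGroup F] [NormedSpace ℝ F]

/-- The span of the functions `t ^ j (ln t) ^ i v` with exponent `j ∈ s`. -/
def logPow (E : Type*) [NormedAddCommGroup E] [NormedSpace ℝ E] (s : Set ℕ) :
    Submodule ℝ (ℝ → E) :=
  Submodule.span ℝ {g | ∃ (j i : ℕ) (v : E), j ∈ s ∧ g = fun t => (t ^ j * Real.log t ^ i) • v}

section FunMem

variable {M : Submodule ℝ (ℝ → E)} {g h : ℝ → E}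

lemma fun_zero_mem : (fun _ => 0) ∈ M := M.zero_mem

lemma fun_add_mem (hg : g ∈ M) (hh : h ∈ M) : (fun t => g t + h t) ∈ M := M.add_mem hg hh

lemma fun_sub_mem (hg : g ∈ M) (hh : h ∈ M) : (fun t => g t - h t) ∈ M := M.sub_mem hg hh

lemma fun_smul_mem (c : ℝ) (hg : g ∈ M) : (fun t => c • g t) ∈ M := M.smul_mem c hg

lemma fun_sum_mem {ι : Type*} {s : Finset ι} {g : ι → ℝ → E} (hg : ∀ i ∈ s, g i ∈ M) :
    (fun t => ∑ i ∈ s, g i t) ∈ M := by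
  convert Submodule.sum_mem M hg using 1
  funext t
  simp

end FunMem

lemma isBigO_rpow_rpow_of_le {a b : ℝ} (h : b ≤ a) :
    (fun t : ℝ => t ^ a) =O[𝓝[>] 0] fun t : ℝ => t ^ b := by
  refine IsBigO.of_bound 1 ?_
  filter_upwards [Ioo_mem_nhdsGT (show (0 : ℝ) < 1 by norm_num)] with t ht
  rw [one_mul, Real.norm_of_nonneg (Real.rpow_nonneg ht.1.le _),
    Real.norm_of_nonneg (Real.rpow_nonneg ht.1.le _)]
  exact Real.rpow_le_rpow_of_exponent_ge ht.1 ht.2.le h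

lemma rpow_mul_rpow_eventuallyEq (a b : ℝ) :
    (fun t : ℝ => t ^ a * t ^ b) =ᶠ[𝓝[>] 0] fun t : ℝ => t ^ (a + b) := by
  filter_upwards [self_mem_nhdsWithin] with t ht
  rw [Real.rpow_add ht]

lemma isBigO_log_pow (i : ℕ) {η : ℝ} (hη : 0 < η) :
    (fun t : ℝ => Real.log t ^ i) =O[𝓝[>] 0] fun t : ℝ => t ^ (-η) := by
  have h := (isLittleO_abs_log_rpow_rpow_nhdsGT_zero (i : ℝ) (neg_lt_zero.2 hη)).isBigO
  refine IsBigO.trans (IsBigO.of_bound 1 (Eventually.of_forall fun t => ?_)) h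
  rw [one_mul, Real.rpow_natCast, norm_pow, norm_pow, Real.norm_eq_abs, Real.norm_eq_abs, abs_abs]

lemma mem_logPow {s : Set ℕ} {j : ℕ} (hj : j ∈ s) (i : ℕ) (v : E) :
    (fun t : ℝ => (t ^ j * Real.log t ^ i) • v) ∈ logPow E s :=
  Submodule.subset_span ⟨j, i, v, hj, rfl⟩

lemma logPow_mono {s s' : Set ℕ} (h : s ⊆ s') : logPow E s ≤ logPow E s' := by
  refine Submodule.span_mono ?_
  rintro g ⟨j, i, v, hj, rfl⟩
  exact ⟨j, i, v, h hj, rfl⟩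

lemma logPow_isBigO {k : ℕ} {g : ℝ → E} (hg : g ∈ logPow E (Ici k)) {η : ℝ} (hη : 0 < η) :
    g =O[𝓝[>] 0] fun t : ℝ => t ^ ((k : ℝ) - η) := by
  induction hg using Submodule.span_induction with
  | mem g h =>
    obtain ⟨j, i, v, hj, rfl⟩ := h
    have h1 : (fun t : ℝ => t ^ j) =O[𝓝[>] 0] fun t : ℝ => t ^ (k : ℝ) := by
      have := isBigO_rpow_rpow_of_le (show (k : ℝ) ≤ (j : ℝ) by exact_mod_cast hj)
      simpa using this
    have h2 := (h1.mul (isBigO_log_pow i hη)).trans_eventuallyEq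
      (rpow_mul_rpow_eventuallyEq (k : ℝ) (-η))
    refine IsBigO.trans (IsBigO.of_bound ‖v‖ (Eventually.of_forall fun t => ?_))
      (h2.congr_right fun t => by rw [sub_eq_add_neg])
    rw [norm_smul, mul_comm]
  | zero => exact isBigO_zero _ _
  | add g h _ _ h1 h2 => exact h1.add h2
  | smul c g _ h1 => exact h1.const_smul_left c

lemma logPow_smul {s s' s'' : Set ℕ} (hs : ∀ a ∈ s, ∀ b ∈ s', a + b ∈ s'') {g : ℝ → ℝ} {h : ℝ → E}
    (hg : g ∈ logPow ℝ s) (hh : h ∈ logPow E s') : (fun t => g t • h t) ∈ logPow E s'' := by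
  induction hg using Submodule.span_induction with
  | mem g hg =>
    obtain ⟨j, i, v, hj, rfl⟩ := hg
    induction hh using Submodule.span_induction with
    | mem h hh =>
      obtain ⟨j', i', v', hj', rfl⟩ := hh
      convert mem_logPow (hs j hj j' hj') (i + i') (v • v') using 2 with t
      simp only [smul_smul, smul_eq_mul]
      congr 1
      ring
    | zero =>
      convert (logPow E s'').zero_mem using 1
      funext t; simp
    | add h h' _ _ h1 h2 =>
      convert (logPow E s'').add_mem h1 h2 using 1
      funext t; simp [smul_add]
    | smul c h _ h1 =>
      convert (logPow E s'').smul_mem c h1 using 1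
      funext t; simp only [Pi.smul_apply]; rw [smul_comm]
  | zero =>
    convert (logPow E s'').zero_mem using 1
    funext t; simp
  | add h h' _ _ h1 h2 =>
    convert (logPow E s'').add_mem h1 h2 using 1
    funext t; simp [add_smul]
  | smul c h _ h1 =>
    convert (logPow E s'').smul_mem c h1 using 1
    funext t; simp [smul_smul]

/-- Functions that are `O(t ^ (N - η))` at `0` for every `η > 0`. -/
def negl (E : Type*) [NormedAddCommGroup E] [NormedSpace ℝ E] (N : ℕ) :
    Submodule ℝ (ℝ → E) where
  carrier := {g | ∀ η : ℝ, 0 < η → g =O[𝓝[>] 0] fun t : ℝ => t ^ ((N : ℝ) - η)}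
  add_mem' := fun h1 h2 η hη => (h1 η hη).add (h2 η hη)
  zero_mem' := fun _ _ => isBigO_zero _ _
  smul_mem' := fun c _ h1 η hη => (h1 η hη).const_smul_left c

/-- Functions with a log-power expansion at `0`, with exponents at least `k`, up to an error
that is negligible of order `N`. -/
def logExp (E : Type*) [NormedAddCommGroup E] [NormedSpace ℝ E] (N k : ℕ) :
    Submodule ℝ (ℝ → E) :=
  logPow E (Ici k) ⊔ negl E N

variable {N : ℕ}

lemma negl_le_logExp {k : ℕ} : negl E N ≤ logExp E N k := le_sup_right

lemma logPow_le_logExp {s : Set ℕ} {k : ℕ} (h : ∀ j ∈ s, k ≤ j) : logPow E s ≤ logExp E N k :=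
  (logPow_mono h).trans le_sup_left

lemma logExp_anti {k k' : ℕ} (h : k ≤ k') : logExp E N k' ≤ logExp E N k :=
  sup_le_sup_right (logPow_mono (Ici_subset_Ici.2 h)) _

lemma mem_negl_of_isBigO {g : ℝ → E} (h : g =O[𝓝[>] 0] fun t : ℝ => t ^ N) : g ∈ negl E N := by
  intro η hη
  have := isBigO_rpow_rpow_of_le (show (N : ℝ) - η ≤ (N : ℝ) by linarith)
  exact h.trans (by simpa using this)

/-- Only the germ at `0+` matters, since a function vanishing near `0` is negligible. Identities
valid only on `(0, T]` can therefore be used freely. -/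
lemma mem_logExp_congr {k : ℕ} {g h : ℝ → E} (hg : g ∈ logExp E N k) (heq : g =ᶠ[𝓝[>] 0] h) :
    h ∈ logExp E N k := by
  have : h - g ∈ negl E N := by
    refine mem_negl_of_isBigO (EventuallyEq.trans_isBigO ?_ (isBigO_zero _ _))
    filter_upwards [heq] with t ht
    simp [ht]
  have h2 := (logExp E N k).add_mem hg (negl_le_logExp this)
  rwa [add_sub_cancel] at h2

lemma logExp_isBigO {k : ℕ} (hk : k ≤ N) {g : ℝ → E} (hg : g ∈ logExp E N k) {η : ℝ}
    (hη : 0 < η) : g =O[𝓝[>] 0] fun t : ℝ => t ^ ((k : ℝ) - η) := by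
  obtain ⟨m, hm, e, he, rfl⟩ := Submodule.mem_sup.1 hg
  refine (logPow_isBigO hm hη).add ((he η hη).trans (isBigO_rpow_rpow_of_le ?_))
  have : (k : ℝ) ≤ N := by exact_mod_cast hk
  linarith

lemma logExp_smul {a b : ℕ} {g : ℝ → ℝ} {h : ℝ → E} (hg : g ∈ logExp ℝ N a)
    (hh : h ∈ logExp E N b) : (fun t => g t • h t) ∈ logExp E N (a + b) := by
  obtain ⟨m, hm, e, he, rfl⟩ := Submodule.mem_sup.1 hg
  obtain ⟨m', hm', e', he', rfl⟩ := Submodule.mem_sup.1 hh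
  -- Each factor receives half of the loss `η`. Any product involving an error term has order at
  -- least `N`, because the other factor has nonnegative order up to logarithms.
  have key : ∀ (u : ℝ → ℝ) (w : ℝ → E) (x y : ℝ), (N : ℝ) ≤ x + y →
      (∀ η : ℝ, 0 < η → u =O[𝓝[>] 0] fun t : ℝ => t ^ (x - η)) →
      (∀ η : ℝ, 0 < η → w =O[𝓝[>] 0] fun t : ℝ => t ^ (y - η)) →
      (fun t => u t • w t) ∈ negl E N := by
    intro u w x y hxy hu hw η hη
    have h1 := (hu (η / 2) (by linarith)).smul (hw (η / 2) (by linarith))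
    have h2 : (fun t : ℝ => t ^ (x - η / 2) • t ^ (y - η / 2)) =ᶠ[𝓝[>] 0]
      fun t : ℝ => t ^ (x - η / 2 + (y - η / 2)) := rpow_mul_rpow_eventuallyEq _ _
    exact (h1.trans_eventuallyEq h2).trans (isBigO_rpow_rpow_of_le (by linarith))
  have e1 : (fun t => m t • m' t) ∈ logPow E (Ici (a + b)) :=
    logPow_smul (fun x hx y hy => add_le_add hx hy) hm hm'
  have e2 := key m e' a N (by simp) (fun η hη => logPow_isBigO hm hη) he'
  have e3 := key e m' N b (by simp) he (fun η hη => logPow_isBigO hm' hη)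
  have e4 := key e e' N N (by simp) he he'
  convert (logExp E N (a + b)).add_mem (Submodule.mem_sup_left e1)
    (Submodule.mem_sup_right ((negl E N).add_mem e2 ((negl E N).add_mem e3 e4))) using 1
  funext t
  simp only [Pi.add_apply, add_smul, smul_add]
  abel

lemma logExp_mul {a b : ℕ} {g h : ℝ → ℝ} (hg : g ∈ logExp ℝ N a)
    (hh : h ∈ logExp ℝ N b) : (fun t => g t * h t) ∈ logExp ℝ N (a + b) :=
  logExp_smul hg hh

lemma logExp_clm {k : ℕ} (L : E →L[ℝ] F) {g : ℝ → E} (hg : g ∈ logExp E N k) :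
    (fun t => L (g t)) ∈ logExp F N k := by
  obtain ⟨m, hm, e, he, rfl⟩ := Submodule.mem_sup.1 hg
  have h1 : (fun t => L (m t)) ∈ logPow F (Ici k) := by
    clear hg
    induction hm using Submodule.span_induction with
    | mem g h =>
      obtain ⟨j, i, v, hj, rfl⟩ := h
      simpa using mem_logPow hj i (L v)
    | zero =>
      simp only [Pi.zero_apply, map_zero]
      exact fun_zero_mem
    | add g h _ _ h1 h2 =>
      simp only [Pi.add_apply, map_add]
      exact fun_add_mem h1 h2
    | smul c g _ h1 =>
      simp only [Pi.smul_apply, map_smul]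
      exact fun_smul_mem c h1
  have h2 : (fun t => L (e t)) ∈ negl F N := fun η hη => (L.isBigO_comp e _).trans (he η hη)
  simp only [Pi.add_apply, map_add]
  exact Submodule.add_mem_sup h1 h2

lemma const_mem_logExp (v : E) : (fun _ => v) ∈ logExp E N 0 := by
  refine logPow_le_logExp (s := {0}) (by simp) ?_
  simpa using mem_logPow (mem_singleton 0) 0 v

lemma pow_mem_logExp (j : ℕ) : (fun t : ℝ => t ^ j) ∈ logExp ℝ N j := by
  refine logPow_le_logExp (s := {j}) (by simp) ?_
  simpa using mem_logPow (mem_singleton j) 0 (1 : ℝ)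

lemma log_mem_logExp : Real.log ∈ logExp ℝ N 0 := by
  refine logPow_le_logExp (s := {0}) (by simp) ?_
  simpa using mem_logPow (mem_singleton 0) 1 (1 : ℝ)

lemma logExp_pow {a : ℕ} {g : ℝ → ℝ} (hg : g ∈ logExp ℝ N a) (k : ℕ) :
    (fun t => g t ^ k) ∈ logExp ℝ N (k * a) := by
  induction k with
  | zero => simpa using const_mem_logExp (1 : ℝ)
  | succ k ih =>
    simp only [pow_succ, add_mul, one_mul]
    exact logExp_mul ih hg

/-- Congruences of log-power expansions multiply. -/
lemma logExp_smul_sub {a b : ℕ} {g g' : ℝ → ℝ} {h h' : ℝ → E}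
    (hg : g ∈ logExp ℝ N a) (hgg : (fun t => g t - g' t) ∈ logExp ℝ N (a + 1))
    (hh' : h' ∈ logExp E N b) (hhh : (fun t => h t - h' t) ∈ logExp E N (b + 1)) :
    (fun t => g t • h t - g' t • h' t) ∈ logExp E N (a + b + 1) := by
  have h1 := logExp_smul hg hhh
  have h2 := logExp_smul hgg hh'
  rw [show a + 1 + b = a + b + 1 by ring] at h2
  convert (logExp E N (a + b + 1)).add_mem h1 h2 using 1
  funext t
  simp only [Pi.add_apply, smul_sub, sub_smul]
  abel

lemma logExp_pow_sub {a : ℕ} {g g' : ℝ → ℝ} (hg : g ∈ logExp ℝ N a) (hg' : g' ∈ logExp ℝ N a)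
    (hgg : (fun t => g t - g' t) ∈ logExp ℝ N (a + 1)) (k : ℕ) :
    (fun t => g t ^ k - g' t ^ k) ∈ logExp ℝ N (k * a + 1) := by
  induction k with
  | zero =>
    simp only [pow_zero, sub_self]
    exact fun_zero_mem
  | succ k ih =>
    have := logExp_smul_sub (logExp_pow hg k) ih hg' hgg
    simpa [pow_succ, add_mul] using this

/-- A polynomial in `ln t` as a chain function. -/
lemma chainFun_mem_logPow (k : ℕ) (ξ : ℕ → E) (D : ℕ) :
    (fun t : ℝ => t ^ k • chainFun ξ D (Real.log t)) ∈ logPow E {k} := by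
  have : (fun t : ℝ => t ^ k • chainFun ξ D (Real.log t)) =
      fun t => ∑ q ∈ Finset.HasAntidiagonal.antidiagonal D, (1 / (q.1.factorial : ℝ)) •
        (t ^ k * Real.log t ^ q.1) • ξ q.2 := by
    funext t
    simp only [chainFun, Finset.smul_sum, smul_smul]
    refine Finset.sum_congr rfl fun q _ => ?_
    congr 1
    ring
  rw [this]
  exact fun_sum_mem fun q _ => fun_smul_mem _ (mem_logPow (mem_singleton k) q.1 (ξ q.2))

lemma chainFun_single (i : ℕ) (v : E) (z : ℝ) :
    chainFun (fun l => if l = 0 then (i.factorial : ℝ) • v else 0) i z = z ^ i • v := by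
  rw [chainFun, Finset.sum_eq_single (i, 0)]
  · have : ((i.factorial : ℕ) : ℝ) ≠ 0 := by exact_mod_cast Nat.factorial_ne_zero i
    simp [smul_smul, this]
  · rintro ⟨a, b⟩ h1 h2
    have h3 := Finset.HasAntidiagonal.mem_antidiagonal.1 h1
    have : b ≠ 0 := by
      rintro rfl
      exact h2 (by simp_all)
    simp [this]
  · simp

lemma chainFun_add (ξ η : ℕ → E) (D : ℕ) (z : ℝ) :
    chainFun (ξ + η) D z = chainFun ξ D z + chainFun η D z := by
  simp [chainFun, Finset.sum_add_distrib]

lemma chainFun_smul (c : ℝ) (ξ : ℕ → E) (D : ℕ) (z : ℝ) :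
    chainFun (c • ξ) D z = c • chainFun ξ D z := by
  simp only [chainFun, Finset.smul_sum, Pi.smul_apply]
  exact Finset.sum_congr rfl fun q _ => smul_comm _ _ _

lemma logPow_leading {k : ℕ} {g : ℝ → E} (hg : g ∈ logPow E (Ici k)) :
    ∃ (ξ : ℕ → E) (D : ℕ),
      (fun t => g t - t ^ k • chainFun ξ D (Real.log t)) ∈ logPow E (Ici (k + 1)) := by
  induction hg using Submodule.span_induction with
  | mem g h =>
    obtain ⟨j, i, v, hj, rfl⟩ := h
    rcases eq_or_lt_of_le (mem_Ici.1 hj) with rfl | hj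
    · refine ⟨fun l => if l = 0 then (i.factorial : ℝ) • v else 0, i, ?_⟩
      simp only [chainFun_single i v, smul_smul, sub_self]
      exact fun_zero_mem
    · refine ⟨0, 0, ?_⟩
      simpa [chainFun] using mem_logPow (s := Ici (k + 1)) hj i v
  | zero =>
    refine ⟨0, 0, ?_⟩
    simp only [chainFun, Pi.zero_apply, smul_zero, Finset.sum_const_zero, sub_self]
    exact fun_zero_mem
  | add g h _ _ h1 h2 =>
    obtain ⟨ξ, D, h1⟩ := h1
    obtain ⟨ξ', D', h2⟩ := h2
    -- Each sequence is shifted by the order of the other, so both polynomials are read off at the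
    -- common order `D' + D`.
    refine ⟨seqShift D' ξ + seqShift D ξ', D' + D, ?_⟩
    convert (logPow E (Ici (k + 1))).add_mem h1 h2 using 1
    funext t
    have e : chainFun (seqShift D ξ') (D' + D) = chainFun ξ' D' := by
      rw [add_comm, chainFun_seqShift]
    simp only [chainFun_add, chainFun_seqShift, e, Pi.add_apply, smul_add]
    abel
  | smul c g _ h1 =>
    obtain ⟨ξ, D, h1⟩ := h1
    refine ⟨c • ξ, D, ?_⟩
    convert (logPow E (Ici (k + 1))).smul_mem c h1 using 1
    funext t
    simp only [chainFun_smul, Pi.smul_apply, smul_sub]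
    rw [smul_comm]

lemma logExp_leading {k : ℕ} {g : ℝ → E} (hg : g ∈ logExp E N k) :
    ∃ (ξ : ℕ → E) (D : ℕ),
      (fun t => g t - t ^ k • chainFun ξ D (Real.log t)) ∈ logExp E N (k + 1) := by
  obtain ⟨m, hm, e, he, rfl⟩ := Submodule.mem_sup.1 hg
  obtain ⟨ξ, D, h⟩ := logPow_leading hm
  refine ⟨ξ, D, ?_⟩
  have h1 : (fun t => (m t - t ^ k • chainFun ξ D (Real.log t)) + e t) ∈ logExp E N (k + 1) :=
    Submodule.add_mem_sup h he
  convert h1 using 2 with t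
  simp only [Pi.add_apply]
  abel

/-- The Taylor series of the logarithm is cut after `N` terms. Since `y = O(t^{1-η})`, the tail
`O(y^{N+1})` is negligible; taking the loss `η / (N + 1)` in `y` leaves a total loss `η`. -/
lemma logExp_log_one_add (hN : 1 ≤ N) {y : ℝ → ℝ} (hy : y ∈ logExp ℝ N 1) :
    (fun t => Real.log (1 + y t)) ∈ logExp ℝ N 1 := by
  have hO : ∀ η : ℝ, 0 < η → y =O[𝓝[>] 0] fun t : ℝ => t ^ ((1 : ℝ) - η) := fun η hη => by
    simpa using logExp_isBigO hN hy hη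
  have hlim : Tendsto y (𝓝[>] 0) (𝓝 0) := by
    refine (hO (1 / 2) (by norm_num)).trans_tendsto ?_
    have : Tendsto (fun t : ℝ => t ^ ((1 : ℝ) - 1 / 2)) (𝓝 0) (𝓝 (0 ^ ((1 : ℝ) - 1 / 2))) :=
      (Real.continuousAt_rpow_const 0 _ (Or.inr (by norm_num))).tendsto
    rw [Real.zero_rpow (by norm_num)] at this
    exact this.mono_left nhdsWithin_le_nhds
  set S : ℝ → ℝ := fun t => ∑ i ∈ Finset.range N, (-y t) ^ (i + 1) / ((i : ℝ) + 1) with hS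
  have h1 : S ∈ logExp ℝ N 1 := by
    have : S = fun t => ∑ i ∈ Finset.range N, ((-1) ^ (i + 1) / ((i : ℝ) + 1)) •
        y t ^ (i + 1) := by
      funext t
      simp only [hS, smul_eq_mul]
      refine Finset.sum_congr rfl fun i _ => ?_
      rw [neg_pow]
      ring
    rw [this]
    refine fun_sum_mem fun i _ => fun_smul_mem _ ?_
    exact logExp_anti (by omega) (logExp_pow hy (i + 1))
  have h2 : (fun t => S t + Real.log (1 + y t)) ∈ negl ℝ N := by
    intro η hη
    have h3 : (fun t => S t + Real.log (1 + y t)) =O[𝓝[>] 0] fun t => y t ^ (N + 1) := by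
      refine IsBigO.of_bound 2 ?_
      have hev : ∀ᶠ t in 𝓝[>] (0 : ℝ), |y t| < 1 / 2 := by
        have := hlim.abs
        rw [abs_zero] at this
        exact this.eventually_lt_const (by norm_num)
      filter_upwards [hev] with t ht
      have h4 := Real.abs_log_sub_add_sum_range_le (x := -y t) (by rw [abs_neg]; linarith) N
      rw [sub_neg_eq_add, abs_neg] at h4
      rw [Real.norm_eq_abs, norm_pow, Real.norm_eq_abs]
      refine h4.trans ?_
      rw [div_le_iff₀ (by linarith)]
      have : 0 ≤ |y t| ^ (N + 1) := by positivity
      nlinarith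
    have h5 := (hO (η / (N + 1)) (by positivity)).pow (N + 1)
    refine h3.trans (h5.trans ?_)
    have h6 : (fun t : ℝ => (t ^ ((1 : ℝ) - η / (N + 1))) ^ (N + 1)) =ᶠ[𝓝[>] 0]
        fun t : ℝ => t ^ ((N : ℝ) + 1 - η) := by
      filter_upwards [self_mem_nhdsWithin] with t ht
      rw [← Real.rpow_natCast, ← Real.rpow_mul (le_of_lt ht)]
      congr 1
      push_cast
      field_simp
    exact h6.trans_isBigO (isBigO_rpow_rpow_of_le (by linarith))
  have h3 := fun_sub_mem (negl_le_logExp (k := 1) h2) h1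
  simpa only [add_sub_cancel_left] using h3

/-- The curve `β` has an expansion `β(t) = a t (1 + ⋯)` with `a > 0`. -/
def CurveExp (N : ℕ) (β : ℝ → ℝ) (a : ℝ) : Prop :=
  0 < a ∧ ∃ y ∈ logExp ℝ N 1, ∀ᶠ t in 𝓝[>] (0 : ℝ), β t = a * t * (1 + y t)

lemma CurveExp.sub_mem {β : ℝ → ℝ} {a : ℝ} (h : CurveExp N β a) :
    (fun t => β t - a * t) ∈ logExp ℝ N 2 := by
  obtain ⟨ha, y, hy, hβ⟩ := h
  have h1 : (fun t : ℝ => a • (t ^ 1 * y t)) ∈ logExp ℝ N 2 :=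
    fun_smul_mem a (logExp_mul (a := 1) (b := 1) (pow_mem_logExp 1) hy)
  refine mem_logExp_congr h1 ?_
  filter_upwards [hβ] with t ht
  rw [ht, smul_eq_mul, pow_one]
  ring

lemma linear_mem_logExp (a : ℝ) : (fun t : ℝ => a * t) ∈ logExp ℝ N 1 := by
  have h : (fun t : ℝ => a • t ^ 1) ∈ logExp ℝ N 1 := fun_smul_mem a (pow_mem_logExp 1)
  simpa only [pow_one, smul_eq_mul] using h

lemma CurveExp.mem {β : ℝ → ℝ} {a : ℝ} (h : CurveExp N β a) : β ∈ logExp ℝ N 1 := by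
  have h1 := fun_add_mem (logExp_anti (show 1 ≤ 2 by norm_num) h.sub_mem) (linear_mem_logExp a)
  simpa only [sub_add_cancel] using h1

/-- `ln β = ln t + ln a + ln (1 + y)`: up to higher order the curve translates the logarithmic
variable by `ln a`. -/
lemma CurveExp.log_sub_mem (hN : 1 ≤ N) {β : ℝ → ℝ} {a : ℝ} (h : CurveExp N β a) :
    (fun t => Real.log (β t) - (Real.log t + Real.log a)) ∈ logExp ℝ N 1 := by
  obtain ⟨ha, y, hy, hβ⟩ := h
  refine mem_logExp_congr (logExp_log_one_add hN hy) ?_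
  have hlim : Tendsto y (𝓝[>] 0) (𝓝 0) := by
    refine (logExp_isBigO hN hy (show (0 : ℝ) < 1 / 2 by norm_num)).trans_tendsto ?_
    have : Tendsto (fun t : ℝ => t ^ (((1 : ℕ) : ℝ) - 1 / 2)) (𝓝 0)
        (𝓝 (0 ^ (((1 : ℕ) : ℝ) - 1 / 2))) :=
      (Real.continuousAt_rpow_const 0 _ (Or.inr (by norm_num))).tendsto
    rw [Real.zero_rpow (by norm_num)] at this
    exact this.mono_left nhdsWithin_le_nhds
  filter_upwards [hβ, self_mem_nhdsWithin,
    hlim.eventually_const_lt (show (-1 : ℝ) < 0 by norm_num)] with t ht ht0 hy1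
  have ht0' : (0 : ℝ) < t := ht0
  rw [ht, Real.log_mul (by positivity) (by linarith), Real.log_mul ha.ne' ht0'.ne']
  ring

lemma CurveExp.pow_mul_log_pow_mem (hN : 1 ≤ N) {β : ℝ → ℝ} {a : ℝ} (h : CurveExp N β a)
    (j k : ℕ) : (fun t => β t ^ j * Real.log (β t) ^ k) ∈ logExp ℝ N j ∧
    (fun t => β t ^ j * Real.log (β t) ^ k - (a * t) ^ j * (Real.log t + Real.log a) ^ k) ∈
      logExp ℝ N (j + 1) := by
  have h1 : (fun t => Real.log t + Real.log a) ∈ logExp ℝ N 0 :=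
    fun_add_mem log_mem_logExp (const_mem_logExp _)
  have h2 : (fun t => Real.log (β t)) ∈ logExp ℝ N 0 := by
    have h3 := fun_add_mem (logExp_anti (Nat.zero_le 1) (h.log_sub_mem hN)) h1
    simpa only [sub_add_cancel] using h3
  have h3 := logExp_pow_sub h2 h1 (h.log_sub_mem hN) k
  have h4 := logExp_pow_sub h.mem (linear_mem_logExp a) h.sub_mem j
  have h5 := logExp_pow h.mem j
  have h6 := logExp_pow h2 k
  have h7 := logExp_pow h1 k
  rw [mul_zero] at h3 h6 h7
  rw [mul_one] at h4 h5
  refine ⟨logExp_mul (b := 0) h5 h6, ?_⟩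
  have h8 := logExp_smul_sub (b := 0) h5 h4 h7 h3
  simpa only [smul_eq_mul, add_zero] using h8

/-- An antiderivative of `s ^ m (ln s) ^ k`. -/
lemma exists_antideriv_pow_mul_log_pow (m k : ℕ) : ∃ Q ∈ logPow ℝ {m + 1},
    ∀ s : ℝ, 0 < s → HasDerivAt Q (s ^ m * Real.log s ^ k) s := by
  have hm : ((m : ℝ) + 1) ≠ 0 := by positivity
  induction k with
  | zero =>
    refine ⟨fun t => (t ^ (m + 1) * Real.log t ^ 0) • (1 / ((m : ℝ) + 1)),
      mem_logPow (mem_singleton (m + 1)) 0 (1 / ((m : ℝ) + 1)), fun s hs => ?_⟩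
    have h1 := (hasDerivAt_pow (m + 1) s).mul_const (1 / ((m : ℝ) + 1))
    simp only [pow_zero, mul_one, smul_eq_mul]
    refine h1.congr_deriv ?_
    push_cast
    field_simp
  | succ k ih =>
    obtain ⟨Q, hQ, hd⟩ := ih
    refine ⟨fun t => (1 / ((m : ℝ) + 1)) • ((t ^ (m + 1) * Real.log t ^ (k + 1)) • (1 : ℝ) -
      ((k : ℝ) + 1) • Q t), fun_smul_mem _ (fun_sub_mem
        (mem_logPow (mem_singleton (m + 1)) (k + 1) (1 : ℝ))
        (fun_smul_mem _ hQ)), fun s hs => ?_⟩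
    have h0 : HasDerivAt (fun t : ℝ => t ^ (m + 1) * Real.log t ^ (k + 1))
        (((m + 1 : ℕ) : ℝ) * s ^ m * Real.log s ^ (k + 1) +
          s ^ (m + 1) * (((k + 1 : ℕ) : ℝ) * Real.log s ^ k * s⁻¹)) s :=
      (hasDerivAt_pow (m + 1) s).mul ((Real.hasDerivAt_log hs.ne').pow (k + 1))
    have h1 := (h0.sub ((hd s hs).const_mul ((k : ℝ) + 1))).const_mul (1 / ((m : ℝ) + 1))
    simp only [smul_eq_mul, mul_one]
    refine h1.congr_deriv ?_
    have := hs.ne'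
    push_cast
    field_simp
    ring

/-- A positive power of `t` dominates every power of `ln t`. Needed to evaluate antiderivatives at
the bottom curve `α 0 = 0`. -/
lemma logPow_continuousOn_Ici {k : ℕ} (hk : 1 ≤ k) {Q : ℝ → E} (hQ : Q ∈ logPow E (Ici k)) :
    Q 0 = 0 ∧ ContinuousOn Q (Ici 0) := by
  have h0 : Q 0 = 0 := by
    induction hQ using Submodule.span_induction with
    | mem g h =>
      obtain ⟨j, i, v, hj, rfl⟩ := h
      have : j ≠ 0 := by have := mem_Ici.1 hj; omega
      simp [this]
    | zero => rfl
    | add g h _ _ h1 h2 => simp [h1, h2]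
    | smul c g _ h1 => simp [h1]
  refine ⟨h0, fun t ht => ?_⟩
  rcases eq_or_lt_of_le (mem_Ici.1 ht) with rfl | ht
  · rw [← continuousWithinAt_sdiff_self, Ici_sdiff_left, ContinuousWithinAt, h0]
    refine (logPow_isBigO hQ (show (0 : ℝ) < 1 / 2 by norm_num)).trans_tendsto ?_
    have hk' : (1 : ℝ) ≤ k := by exact_mod_cast hk
    have : Tendsto (fun t : ℝ => t ^ ((k : ℝ) - 1 / 2)) (𝓝 0) (𝓝 (0 ^ ((k : ℝ) - 1 / 2))) :=
      (Real.continuousAt_rpow_const 0 _ (Or.inr (by linarith))).tendsto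
    rw [Real.zero_rpow (by linarith)] at this
    exact this.mono_left nhdsWithin_le_nhds
  · refine ContinuousAt.continuousWithinAt ?_
    clear h0
    induction hQ using Submodule.span_induction with
    | mem g h =>
      obtain ⟨j, i, v, hj, rfl⟩ := h
      exact ((continuousAt_id.pow j).mul ((Real.continuousAt_log ht.ne').pow i)).smul
        continuousAt_const
    | zero => exact continuousAt_const
    | add g h _ _ h1 h2 => exact h1.add h2
    | smul c g _ h1 => exact h1.const_smul c

lemma logPow_continuousOn_Ioi {s : Set ℕ} {Q : ℝ → E} (hQ : Q ∈ logPow E s) :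
    ContinuousOn Q (Ioi 0) := by
  intro t ht
  refine ContinuousAt.continuousWithinAt ?_
  have ht' : t ≠ 0 := ne_of_gt ht
  induction hQ using Submodule.span_induction with
  | mem g h =>
    obtain ⟨j, i, v, hj, rfl⟩ := h
    exact ((continuousAt_id.pow j).mul ((Real.continuousAt_log ht').pow i)).smul
      continuousAt_const
  | zero => exact continuousAt_const
  | add g h _ _ h1 h2 => exact h1.add h2
  | smul c g _ h1 => exact h1.const_smul c

lemma logPow_mem_curve (hN : 1 ≤ N) {k : ℕ} {Q : ℝ → ℝ} (hQ : Q ∈ logPow ℝ {k}) {β : ℝ → ℝ} {a : ℝ}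
    (h : CurveExp N β a) : (fun t => Q (β t)) ∈ logExp ℝ N k := by
  induction hQ using Submodule.span_induction with
  | mem g hg =>
    obtain ⟨j, i, v, rfl, rfl⟩ := hg
    have h1 := fun_smul_mem v (h.pow_mul_log_pow_mem hN j i).1
    simpa only [smul_eq_mul, mul_comm] using h1
  | zero => exact fun_zero_mem
  | add g h _ _ h1 h2 => exact fun_add_mem h1 h2
  | smul c g _ h1 => exact fun_smul_mem c h1

/-- A polynomial that tends to `0` along `ln t`, `t → 0`, vanishes. -/
lemma chainFun_log_eq_zero {ξ : ℕ → E} {D : ℕ}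
    (h : Tendsto (fun t => chainFun ξ D (Real.log t)) (𝓝[>] 0) (𝓝 0)) : ∀ l ≤ D, ξ l = 0 := by
  have key : ∀ l ≤ D, (∀ m < l, ξ m = 0) → ξ l = 0 := by
    intro l hl hm
    obtain ⟨D, rfl⟩ := Nat.exists_eq_add_of_le hl
    clear hl
    have h1 : ∀ t : ℝ, chainFun ξ (l + D) t = chainFun (fun m => ξ (l + m)) D t := by
      intro t
      rw [← chainFun_seqShift (fun m => ξ (l + m)) l D]
      refine congrFun (chainFun_congr fun m _ => ?_) t
      rw [seqShift]
      split_ifs with h2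
      · exact hm m h2
      · rw [Nat.add_sub_cancel' (not_lt.1 h2)]
    simp only [h1] at h
    have hinv : Tendsto (fun t : ℝ => (Real.log t)⁻¹) (𝓝[>] 0) (𝓝 0) :=
      tendsto_inv_atBot_zero.comp Real.tendsto_log_nhdsGT_zero
    -- With the coefficients below `l` gone, `ξ l / D!` is the coefficient of the highest power of
    -- `ln t`; division by `(ln t)^D` isolates it.
    have h2 : Tendsto (fun t : ℝ => (Real.log t)⁻¹ ^ D • chainFun (fun m => ξ (l + m)) D
        (Real.log t)) (𝓝[>] 0) (𝓝 0) := by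
      have := (hinv.pow D).smul h
      simpa using this
    have h3 : Tendsto (fun t : ℝ => ∑ q ∈ Finset.HasAntidiagonal.antidiagonal D,
        ((Real.log t)⁻¹ ^ q.2 / (q.1.factorial : ℝ)) • ξ (l + q.2)) (𝓝[>] 0)
        (𝓝 (∑ q ∈ Finset.HasAntidiagonal.antidiagonal D,
          ((0 : ℝ) ^ q.2 / (q.1.factorial : ℝ)) • ξ (l + q.2))) :=
      tendsto_finsetSum _ fun q _ => ((hinv.pow q.2).div_const _).smul_const _
    have h4 : (fun t : ℝ => (Real.log t)⁻¹ ^ D • chainFun (fun m => ξ (l + m)) D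
        (Real.log t)) =ᶠ[𝓝[>] 0] (fun t : ℝ => ∑ q ∈ Finset.HasAntidiagonal.antidiagonal D,
        ((Real.log t)⁻¹ ^ q.2 / (q.1.factorial : ℝ)) • ξ (l + q.2)) := by
      filter_upwards [Ioo_mem_nhdsGT (show (0 : ℝ) < 1 by norm_num)] with t ht
      have hlog : Real.log t ≠ 0 := (Real.log_neg ht.1 ht.2).ne
      rw [chainFun, Finset.smul_sum]
      refine Finset.sum_congr rfl fun q hq => ?_
      rw [smul_smul, ← Finset.HasAntidiagonal.mem_antidiagonal.1 hq, pow_add, inv_pow, inv_pow]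
      congr 1
      field_simp
    have h5 := tendsto_nhds_unique (h3.congr' h4.symm) h2
    rw [Finset.sum_eq_single (D, 0)] at h5
    · have : ((D.factorial : ℕ) : ℝ) ≠ 0 := by exact_mod_cast Nat.factorial_ne_zero D
      simpa [this] using h5
    · rintro ⟨a, b⟩ h1 h2
      have h3 := Finset.HasAntidiagonal.mem_antidiagonal.1 h1
      have : b ≠ 0 := by
        rintro rfl
        exact h2 (by simp_all)
      simp [this]
    · simp
  intro l
  induction l using Nat.strong_induction_on with
  | _ l ih => exact fun hl => key l hl fun m hm => ih m hm (by omega)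

end LogPower

/-! ### The integral operator and its formal derivative -/

section Volterra

variable {𝕜 E₁ E₂ : Type*} [RCLike 𝕜]
  [NormedAddCommGroup E₁] [NormedSpace 𝕜 E₁] [NormedSpace ℝ E₁] [IsScalarTower ℝ 𝕜 E₁]
  [NormedAddCommGroup E₂] [NormedSpace 𝕜 E₂] [NormedSpace ℝ E₂] [IsScalarTower ℝ 𝕜 E₂]

lemma clm_map_real_smul (L : E₁ →L[𝕜] E₂) (c : ℝ) (v : E₁) : L (c • v) = c • L v :=
  (L.restrictScalars ℝ).map_smul c v

variable (V : Data 𝕜 E₁ E₂)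

namespace Data

lemma α_continuousOn {i : ℕ} (hi : i ≤ V.n) : ContinuousOn (V.α i) (Icc 0 V.T) :=
  fun t ht => (V.α_hasDeriv i hi t ht).continuousWithinAt

lemma α_le_succ {i : ℕ} (hi : i < V.n) {t : ℝ} (ht : t ∈ Icc 0 V.T) :
    V.α i t ≤ V.α (i + 1) t := by
  rcases eq_or_lt_of_le ht.1 with rfl | h
  · rw [V.α_zero i hi.le, V.α_zero (i + 1) hi]
  · exact (V.α_lt i hi t ⟨h, ht.2⟩).le

lemma α_pred_le {i : ℕ} (hi : i ∈ Finset.Icc 1 V.n) {t : ℝ} (ht : t ∈ Icc 0 V.T) :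
    V.α (i - 1) t ≤ V.α i t := by
  have h := Finset.mem_Icc.1 hi
  have := V.α_le_succ (i := i - 1) (by omega) ht
  rwa [Nat.sub_add_cancel h.1] at this

lemma α_pred_lt {i : ℕ} (hi : i ∈ Finset.Icc 1 V.n) {t : ℝ} (ht : t ∈ Ioc 0 V.T) :
    V.α (i - 1) t < V.α i t := by
  have h := Finset.mem_Icc.1 hi
  have := V.α_lt (i - 1) (by omega) t ht
  rwa [Nat.sub_add_cancel h.1] at this

lemma α_nonneg {i : ℕ} (hi : i ≤ V.n) {t : ℝ} (ht : t ∈ Icc 0 V.T) : 0 ≤ V.α i t := by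
  induction i with
  | zero => exact (V.α_bot t ht).ge
  | succ k ih => exact (ih (by omega)).trans (V.α_le_succ (by omega) ht)

lemma α_le_self {i : ℕ} (hi : i ≤ V.n) {t : ℝ} (ht : t ∈ Icc 0 V.T) : V.α i t ≤ t := by
  induction hi using Nat.decreasingInduction with
  | self => exact (V.α_top t ht).le
  | of_succ k hk ih => exact (V.α_le_succ hk ht).trans ih

lemma α_pos {i : ℕ} (h1 : 1 ≤ i) (hi : i ≤ V.n) {t : ℝ} (ht : t ∈ Ioc 0 V.T) : 0 < V.α i t :=
  (V.α_nonneg (by omega) ⟨ht.1.le, ht.2⟩).trans_lt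
    (V.α_pred_lt (Finset.mem_Icc.2 ⟨h1, hi⟩) ht)

/-- The region is the image of `[0,T] × [0,1]` under convex combination of the two boundary curves,
also where the fibre degenerates to a point. Compactness supplies uniform kernel bounds. -/
lemma isCompact_region {i : ℕ} (hi : i ∈ Finset.Icc 1 V.n) : IsCompact (V.region i) := by
  have h := Finset.mem_Icc.1 hi
  have hc : ContinuousOn (fun z : ℝ × ℝ => (z.1, (1 - z.2) * V.α (i - 1) z.1 + z.2 * V.α i z.1))
      (Icc 0 V.T ×ˢ Icc 0 1) := by
    have h1 : ContinuousOn (fun z : ℝ × ℝ => V.α (i - 1) z.1) (Icc 0 V.T ×ˢ Icc 0 1) :=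
      (V.α_continuousOn (by omega)).comp continuousOn_fst fun z hz => hz.1
    have h2 : ContinuousOn (fun z : ℝ × ℝ => V.α i z.1) (Icc 0 V.T ×ˢ Icc 0 1) :=
      (V.α_continuousOn h.2).comp continuousOn_fst fun z hz => hz.1
    fun_prop
  convert (isCompact_Icc.prod isCompact_Icc).image_of_continuousOn hc using 1
  ext ⟨t, s⟩
  constructor
  · rintro ⟨ht, hs⟩
    simp only at ht hs
    rcases eq_or_lt_of_le (V.α_pred_le hi ht) with he | hlt
    · refine ⟨(t, 0), ⟨ht, by simp⟩, ?_⟩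
      have : s = V.α (i - 1) t := le_antisymm (hs.2.trans he.ge) hs.1
      simp [this]
    · refine ⟨(t, (s - V.α (i - 1) t) / (V.α i t - V.α (i - 1) t)), ⟨ht, ?_, ?_⟩, ?_⟩
      · exact div_nonneg (by linarith [hs.1]) (by linarith)
      · rw [div_le_one (by linarith)]
        linarith [hs.2]
      · have : V.α i t - V.α (i - 1) t ≠ 0 := by linarith
        simp only [Prod.mk.injEq, true_and]
        field_simp
        ring
  · rintro ⟨⟨τ, l⟩, ⟨hτ, hl⟩, hz⟩
    simp only [Prod.mk.injEq] at hz hτ hl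
    obtain ⟨rfl, rfl⟩ := hz
    have := V.α_pred_le hi hτ
    refine ⟨hτ, ?_, ?_⟩
    · nlinarith [hl.1, hl.2]
    · nlinarith [hl.1, hl.2]

lemma exists_kernel_bound {i : ℕ} (hi : i ∈ Finset.Icc 1 V.n) {k : ℝ → ℝ → E₁ →L[𝕜] E₂}
    (hk : ContinuousOn (fun z : ℝ × ℝ => k z.1 z.2) (V.region i)) :
    ∃ M, 0 ≤ M ∧ ∀ t ∈ Icc 0 V.T, ∀ s ∈ Icc (V.α (i - 1) t) (V.α i t), ‖k t s‖ ≤ M := by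
  obtain ⟨M, hM⟩ := (V.isCompact_region hi).exists_bound_of_continuousOn hk
  refine ⟨max M 0, le_max_right _ _, fun t ht s hs => (hM (t, s) ⟨ht, hs⟩).trans (le_max_left _ _)⟩

end Data

/-- Functions that are continuous on `(0, T']` and integrable there. -/
def admissible (𝕜 E₁ : Type*) [RCLike 𝕜] [NormedAddCommGroup E₁] [NormedSpace 𝕜 E₁] (T' : ℝ) :
    Submodule 𝕜 (ℝ → E₁) where
  carrier := {x | ContinuousOn x (Ioc 0 T') ∧ IntegrableOn x (Ioc 0 T') volume}
  add_mem' := fun h1 h2 => ⟨h1.1.add h2.1, h1.2.add h2.2⟩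
  zero_mem' := ⟨continuousOn_const, integrableOn_zero⟩
  smul_mem' := fun c _ h => ⟨h.1.const_smul c, h.2.smul c⟩

variable {T' : ℝ} {x y : ℝ → E₁}

namespace Data

variable {V}

lemma continuousOn_kernel_apply {i : ℕ} {k : ℝ → ℝ → E₁ →L[𝕜] E₂}
    (hk : ContinuousOn (fun z : ℝ × ℝ => k z.1 z.2) (V.region i))
    (hx : x ∈ admissible 𝕜 E₁ T') :
    ContinuousOn (fun z : ℝ × ℝ => k z.1 z.2 (x z.2)) (V.region i ∩ {z | z.2 ∈ Ioc 0 T'}) :=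
  (hk.mono inter_subset_left).clm_apply
    (hx.1.comp continuousOn_snd fun _ hz => hz.2)

lemma Ioc_α_subset (hT : T' ≤ V.T) {i : ℕ} (hi : i ∈ Finset.Icc 1 V.n) {t : ℝ}
    (ht : t ∈ Icc 0 T') : Ioc (V.α (i - 1) t) (V.α i t) ⊆ Ioc 0 T' := by
  have h := Finset.mem_Icc.1 hi
  have ht' : t ∈ Icc 0 V.T := ⟨ht.1, ht.2.trans hT⟩
  exact Ioc_subset_Ioc (V.α_nonneg (by omega) ht') ((V.α_le_self h.2 ht').trans ht.2)

lemma aestronglyMeasurable_kernel_apply (hT : T' ≤ V.T) {i : ℕ} (hi : i ∈ Finset.Icc 1 V.n)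
    {k : ℝ → ℝ → E₁ →L[𝕜] E₂} (hk : ContinuousOn (fun z : ℝ × ℝ => k z.1 z.2) (V.region i))
    (hx : x ∈ admissible 𝕜 E₁ T') {t : ℝ} (ht : t ∈ Icc 0 T') :
    AEStronglyMeasurable (fun s => k t s (x s))
      (volume.restrict (Ioc (V.α (i - 1) t) (V.α i t))) := by
  refine ContinuousOn.aestronglyMeasurable ?_ measurableSet_Ioc
  refine (continuousOn_kernel_apply hk hx).comp (f := fun s => (t, s)) (by fun_prop) ?_
  intro s hs
  exact ⟨⟨⟨ht.1, ht.2.trans hT⟩, ⟨hs.1.le, hs.2⟩⟩, Ioc_α_subset hT hi ht hs⟩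

lemma integrableOn_kernel_apply (hT : T' ≤ V.T) {i : ℕ} (hi : i ∈ Finset.Icc 1 V.n)
    {k : ℝ → ℝ → E₁ →L[𝕜] E₂} (hk : ContinuousOn (fun z : ℝ × ℝ => k z.1 z.2) (V.region i))
    (hx : x ∈ admissible 𝕜 E₁ T') {t : ℝ} (ht : t ∈ Icc 0 T') :
    IntegrableOn (fun s => k t s (x s)) (Ioc (V.α (i - 1) t) (V.α i t)) := by
  obtain ⟨M, hM0, hM⟩ := V.exists_kernel_bound hi hk
  have hx' := (hx.2.mono_set (Ioc_α_subset hT hi ht)).norm.const_mul M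
  refine hx'.mono' (aestronglyMeasurable_kernel_apply hT hi hk hx ht) ?_
  refine (ae_restrict_iff' measurableSet_Ioc).2 (Eventually.of_forall fun s hs => ?_)
  exact (k t s).le_of_opNorm_le (hM t ⟨ht.1, ht.2.trans hT⟩ s ⟨hs.1.le, hs.2⟩) _

lemma intervalIntegrable_kernel_apply (hT : T' ≤ V.T) {i : ℕ} (hi : i ∈ Finset.Icc 1 V.n)
    {k : ℝ → ℝ → E₁ →L[𝕜] E₂} (hk : ContinuousOn (fun z : ℝ × ℝ => k z.1 z.2) (V.region i))
    (hx : x ∈ admissible 𝕜 E₁ T') {t : ℝ} (ht : t ∈ Icc 0 T') {c d : ℝ}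
    (hc : V.α (i - 1) t ≤ c) (hcd : c ≤ d) (hd : d ≤ V.α i t) :
    IntervalIntegrable (fun s => k t s (x s)) volume c d :=
  (intervalIntegrable_iff_integrableOn_Ioc_of_le hcd).2
    ((integrableOn_kernel_apply hT hi hk hx ht).mono_set (Ioc_subset_Ioc hc hd))

lemma integral_eq_indicator (hT : T' ≤ V.T) {i : ℕ} (hi : i ∈ Finset.Icc 1 V.n)
    (g : ℝ → E₂) {t : ℝ} (ht : t ∈ Icc 0 T') :
    ∫ s in (V.α (i - 1) t)..(V.α i t), g s =
      ∫ s in Ioc 0 T', (Ioc (V.α (i - 1) t) (V.α i t)).indicator g s := by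
  rw [setIntegral_indicator measurableSet_Ioc,
    inter_eq_self_of_subset_right (Ioc_α_subset hT hi ht),
    intervalIntegral.integral_of_le (V.α_pred_le hi ⟨ht.1, ht.2.trans hT⟩)]

/-- Written over the fixed interval `(0, T']` with an indicator, the integrand is dominated by `M ‖x
s‖` and depends continuously on `t` except possibly at the two values of `s` on the boundary curves.
Dominated convergence needs no boundedness of `x` near `0`. -/
lemma continuousOn_integral (hT : T' ≤ V.T) {i : ℕ} (hi : i ∈ Finset.Icc 1 V.n)
    {k : ℝ → ℝ → E₁ →L[𝕜] E₂} (hk : ContinuousOn (fun z : ℝ × ℝ => k z.1 z.2) (V.region i))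
    (hx : x ∈ admissible 𝕜 E₁ T') :
    ContinuousOn (fun t => ∫ s in (V.α (i - 1) t)..(V.α i t), k t s (x s)) (Icc 0 T') := by
  obtain ⟨M, hM0, hM⟩ := V.exists_kernel_bound hi hk
  have h := Finset.mem_Icc.1 hi
  have hsub : Icc 0 T' ⊆ Icc 0 V.T := Icc_subset_Icc_right hT
  have hα1 := (V.α_continuousOn (i := i - 1) (by omega)).mono hsub
  have hα2 := (V.α_continuousOn h.2).mono hsub
  refine ContinuousOn.congr (f := fun t => ∫ s in Ioc 0 T',
    (Ioc (V.α (i - 1) t) (V.α i t)).indicator (fun s => k t s (x s)) s) ?_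
    fun t ht => integral_eq_indicator hT hi _ ht
  intro t₀ ht₀
  refine continuousWithinAt_of_dominated (bound := fun s => M * ‖x s‖) ?_ ?_
    (hx.2.norm.const_mul M) ?_
  · filter_upwards [self_mem_nhdsWithin] with t ht
    rw [aestronglyMeasurable_indicator_iff measurableSet_Ioc]
    refine (aestronglyMeasurable_kernel_apply hT hi hk hx ht).mono_measure ?_
    rw [Measure.restrict_restrict measurableSet_Ioc]
    exact Measure.restrict_mono inter_subset_left le_rfl
  · filter_upwards [self_mem_nhdsWithin] with t ht
    refine Eventually.of_forall fun s => ?_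
    by_cases hs : s ∈ Ioc (V.α (i - 1) t) (V.α i t)
    · rw [indicator_of_mem hs]
      exact (k t s).le_of_opNorm_le (hM t (hsub ht) s ⟨hs.1.le, hs.2⟩) _
    · rw [indicator_of_notMem hs, norm_zero]
      positivity
  · have hne : ∀ᵐ s ∂(volume.restrict (Ioc 0 T')),
        s ≠ V.α (i - 1) t₀ ∧ s ≠ V.α i t₀ := by
      refine ae_restrict_of_ae ?_
      filter_upwards [Measure.ae_ne volume (V.α (i - 1) t₀), Measure.ae_ne volume (V.α i t₀)]
        with s h1 h2 using ⟨h1, h2⟩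
    filter_upwards [hne, ae_restrict_mem measurableSet_Ioc] with s hs hs0
    rcases lt_or_gt_of_ne hs.1 with h1 | h1
    · have hev : ∀ᶠ t in 𝓝[Icc 0 T'] t₀, s < V.α (i - 1) t := (hα1 t₀ ht₀).eventually_const_lt h1
      refine (continuousWithinAt_const (b := (0 : E₂))).congr_of_eventuallyEq ?_ ?_
      · filter_upwards [hev] with t ht
        exact indicator_of_notMem (fun h => ht.not_gt h.1) _
      · exact indicator_of_notMem (fun h => h1.not_gt h.1) _
    rcases lt_or_gt_of_ne hs.2 with h2 | h2
    · have hev1 : ∀ᶠ t in 𝓝[Icc 0 T'] t₀, V.α (i - 1) t < s := (hα1 t₀ ht₀).eventually_lt_const h1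
      have hev2 : ∀ᶠ t in 𝓝[Icc 0 T'] t₀, s < V.α i t := (hα2 t₀ ht₀).eventually_const_lt h2
      have hmem : (t₀, s) ∈ V.region i ∩ {z | z.2 ∈ Ioc 0 T'} :=
        ⟨⟨hsub ht₀, ⟨h1.le, h2.le⟩⟩, hs0⟩
      have hcw : ContinuousWithinAt (fun t => k t s (x s))
          {t | t ∈ Icc 0 T' ∧ V.α (i - 1) t < s ∧ s < V.α i t} t₀ := by
        refine (continuousOn_kernel_apply hk hx _ hmem).comp (f := fun t => (t, s))
          (by fun_prop) ?_
        rintro t ⟨ht, h3, h4⟩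
        exact ⟨⟨hsub ht, ⟨h3.le, h4.le⟩⟩, hs0⟩
      have hcw2 : ContinuousWithinAt (fun t => k t s (x s)) (Icc 0 T') t₀ := by
        refine hcw.mono_of_mem_nhdsWithin ?_
        filter_upwards [hev1, hev2, self_mem_nhdsWithin] with t h3 h4 h5 using ⟨h5, h3, h4⟩
      refine hcw2.congr_of_eventuallyEq ?_ ?_
      · filter_upwards [hev1, hev2] with t h3 h4
        exact indicator_of_mem (mem_Ioc.2 ⟨h3, h4.le⟩) _
      · exact indicator_of_mem (mem_Ioc.2 ⟨h1, h2.le⟩) _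
    · have hev : ∀ᶠ t in 𝓝[Icc 0 T'] t₀, V.α i t < s := (hα2 t₀ ht₀).eventually_lt_const h2
      refine (continuousWithinAt_const (b := (0 : E₂))).congr_of_eventuallyEq ?_ ?_
      · filter_upwards [hev] with t ht
        exact indicator_of_notMem (fun h => ht.not_ge h.2) _
      · exact indicator_of_notMem (fun h => h2.not_ge h.2) _

variable (V) in
/-- The left-hand side of the equation of the first kind. -/
def intOp (x : ℝ → E₁) (t : ℝ) : E₂ :=
  ∑ i ∈ Finset.Icc 1 V.n, ∫ s in (V.α (i - 1) t)..(V.α i t), V.K i t s (x s)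

variable (V) in
/-- The left-hand side of the differentiated equation. -/
def diffOp (x : ℝ → E₁) (t : ℝ) : E₂ :=
  V.K V.n t t (x t) +
    ∑ i ∈ Finset.Ico 1 V.n, V.α' i t • (V.K i t (V.α i t) - V.K (i + 1) t (V.α i t)) (x (V.α i t)) +
    ∑ i ∈ Finset.Icc 1 V.n, ∫ s in (V.α (i - 1) t)..(V.α i t), V.K' i t s (x s)

lemma diffOp_add (hT : T' ≤ V.T) (hx : x ∈ admissible 𝕜 E₁ T') (hy : y ∈ admissible 𝕜 E₁ T')
    {t : ℝ} (ht : t ∈ Icc 0 T') : V.diffOp (x + y) t = V.diffOp x t + V.diffOp y t := by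
  have h1 : ∀ i ∈ Finset.Icc 1 V.n,
      ∫ s in (V.α (i - 1) t)..(V.α i t), V.K' i t s ((x + y) s) =
      (∫ s in (V.α (i - 1) t)..(V.α i t), V.K' i t s (x s)) +
        ∫ s in (V.α (i - 1) t)..(V.α i t), V.K' i t s (y s) := by
    intro i hi
    have hle := V.α_pred_le hi ⟨ht.1, ht.2.trans hT⟩
    rw [← intervalIntegral.integral_add
      (intervalIntegrable_kernel_apply hT hi (V.K'_cont i hi) hx ht le_rfl hle le_rfl)
      (intervalIntegrable_kernel_apply hT hi (V.K'_cont i hi) hy ht le_rfl hle le_rfl)]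
    simp only [Pi.add_apply, map_add]
  rw [diffOp, Finset.sum_congr rfl h1]
  simp only [diffOp, Pi.add_apply, map_add, smul_add, Finset.sum_add_distrib]
  abel

lemma diffOp_smul (c : 𝕜) (x : ℝ → E₁) (t : ℝ) : V.diffOp (c • x) t = c • V.diffOp x t := by
  simp only [diffOp, Pi.smul_apply, map_smul, smul_add, Finset.smul_sum,
    intervalIntegral.integral_smul]
  simp only [smul_comm c]

lemma diffOp_sum (hT : T' ≤ V.T) {ι : Type*} (u : Finset ι) {x : ι → ℝ → E₁}
    (hx : ∀ i ∈ u, x i ∈ admissible 𝕜 E₁ T') {t : ℝ} (ht : t ∈ Icc 0 T') :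
    V.diffOp (∑ i ∈ u, x i) t = ∑ i ∈ u, V.diffOp (x i) t := by
  classical
  induction u using Finset.induction_on with
  | empty => simp [diffOp]
  | insert a u ha ih =>
    rw [Finset.sum_insert ha, Finset.sum_insert ha, diffOp_add hT
      (hx a (Finset.mem_insert_self _ _))
      (Submodule.sum_mem _ fun i hi => hx i (Finset.mem_insert_of_mem hi)) ht,
      ih fun i hi => hx i (Finset.mem_insert_of_mem hi)]

lemma continuousOn_comp_α (hT : T' ≤ V.T) {i j : ℕ} (hj : j ∈ Finset.Icc 1 V.n)
    (hi : i = j ∨ i = j - 1) {k : ℝ → ℝ → E₁ →L[𝕜] E₂}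
    (hk : ContinuousOn (fun z : ℝ × ℝ => k z.1 z.2) (V.region j)) :
    ContinuousOn (fun t => k t (V.α i t)) (Icc 0 T') := by
  have h := Finset.mem_Icc.1 hj
  have hsub : Icc 0 T' ⊆ Icc 0 V.T := Icc_subset_Icc_right hT
  refine hk.comp (f := fun t => (t, V.α i t))
    (continuousOn_id.prodMk ((V.α_continuousOn (by omega)).mono hsub)) fun t ht => ?_
  have := V.α_pred_le hj (hsub ht)
  rcases hi with rfl | rfl
  · exact ⟨hsub ht, this, le_rfl⟩
  · exact ⟨hsub ht, le_rfl, this⟩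

lemma continuousOn_diag (hT : T' ≤ V.T) : ContinuousOn (fun t => V.K V.n t t) (Icc 0 T') := by
  have hn : V.n ∈ Finset.Icc 1 V.n := Finset.mem_Icc.2 ⟨V.one_le_n, le_rfl⟩
  refine (continuousOn_comp_α hT hn (Or.inl rfl) (V.K_cont _ hn)).congr fun t ht => ?_
  simp only [V.α_top t ⟨ht.1, ht.2.trans hT⟩]

lemma continuousOn_jump (hT : T' ≤ V.T) {i : ℕ} (hi : i ∈ Finset.Ico 1 V.n) :
    ContinuousOn (fun t => V.K i t (V.α i t) - V.K (i + 1) t (V.α i t)) (Icc 0 T') := by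
  have h := Finset.mem_Ico.1 hi
  have h1 : i ∈ Finset.Icc 1 V.n := Finset.mem_Icc.2 ⟨h.1, h.2.le⟩
  have h2 : i + 1 ∈ Finset.Icc 1 V.n := Finset.mem_Icc.2 ⟨by omega, h.2⟩
  exact (continuousOn_comp_α hT h1 (Or.inl rfl) (V.K_cont _ h1)).sub
    (continuousOn_comp_α hT h2 (Or.inr rfl) (V.K_cont _ h2))

lemma α_mapsTo (hT : T' ≤ V.T) {i : ℕ} (h1 : 1 ≤ i) (hi : i ≤ V.n) :
    MapsTo (V.α i) (Ioc 0 T') (Ioc 0 T') := fun t ht =>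
  have ht' : t ∈ Ioc 0 V.T := ⟨ht.1, ht.2.trans hT⟩
  ⟨V.α_pos h1 hi ht', (V.α_le_self hi ⟨ht'.1.le, ht'.2⟩).trans ht.2⟩

lemma continuousOn_diffOp (hT : T' ≤ V.T) (hx : x ∈ admissible 𝕜 E₁ T') :
    ContinuousOn (V.diffOp x) (Ioc 0 T') := by
  have hsub : Ioc 0 T' ⊆ Icc 0 T' := Ioc_subset_Icc_self
  have hsub' : Ioc 0 T' ⊆ Icc 0 V.T := hsub.trans (Icc_subset_Icc_right hT)
  refine (ContinuousOn.add ?_ ?_).add ?_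
  · exact ((continuousOn_diag hT).mono hsub).clm_apply hx.1
  · refine continuousOn_finsetSum _ fun i hi => ?_
    have h := Finset.mem_Ico.1 hi
    refine ContinuousOn.smul ((V.α'_cont i h.2.le).mono hsub') ?_
    exact ((continuousOn_jump hT hi).mono hsub).clm_apply
      (hx.1.comp ((V.α_continuousOn h.2.le).mono hsub') (α_mapsTo hT h.1 h.2.le))
  · exact continuousOn_finsetSum _ fun i hi =>
      (continuousOn_integral hT hi (V.K'_cont i hi) hx).mono hsub

end Data

end Volterra

/-! ### The Leibniz rule and reduction to the differentiated equation -/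

section Leibniz

lemma norm_integral_sub_const_le {F : Type*} [NormedAddCommGroup F] [NormedSpace ℝ F]
    [CompleteSpace F] {g : ℝ → F} {v : F} {c d ε : ℝ} (hg : IntervalIntegrable g volume c d)
    (h : ∀ s ∈ uIcc c d, ‖g s - v‖ ≤ ε) : ‖(∫ s in c..d, g s) - (d - c) • v‖ ≤ ε * |d - c| := by
  rw [← intervalIntegral.integral_const,
    ← intervalIntegral.integral_sub hg intervalIntegrable_const]
  exact intervalIntegral.norm_integral_le_of_norm_le_const
    fun s hs => h s (uIoc_subset_uIcc hs)

/-- The contribution of a moving end point to the derivative of an integral. -/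
lemma hasDerivAt_integral_boundary {F : Type*} [NormedAddCommGroup F] [NormedSpace ℝ F]
    [CompleteSpace F] {Φ : ℝ → ℝ → F} {b c : ℝ → ℝ} {b' t₀ L : ℝ} {v : F}
    (hb : HasDerivAt b b' t₀) (hc : ∀ t, |c t - b t₀| ≤ L * |t - t₀|) (hL : 0 ≤ L)
    (hbL : ∀ᶠ t in 𝓝 t₀, |b t - b t₀| ≤ L * |t - t₀|)
    (hi₁ : ∀ᶠ t in 𝓝 t₀, IntervalIntegrable (Φ t) volume (c t) (b t))
    (hi₂ : ∀ᶠ t in 𝓝 t₀, IntervalIntegrable (Φ t₀) volume (c t) (b t₀))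
    (h₁ : ∀ ε > 0, ∀ᶠ t in 𝓝 t₀, ∀ s ∈ uIcc (c t) (b t), ‖Φ t s - v‖ ≤ ε)
    (h₂ : ∀ ε > 0, ∀ᶠ t in 𝓝 t₀, ∀ s ∈ uIcc (c t) (b t₀), ‖Φ t₀ s - v‖ ≤ ε) :
    HasDerivAt (fun t => (∫ s in (c t)..(b t), Φ t s) - ∫ s in (c t)..(b t₀), Φ t₀ s)
      (b' • v) t₀ := by
  have hsmall : (fun t => (∫ s in (c t)..(b t), Φ t s) - (∫ s in (c t)..(b t₀), Φ t₀ s) -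
      (b t - b t₀) • v) =o[𝓝 t₀] fun t => t - t₀ := by
    refine IsLittleO.of_bound fun ε hε => ?_
    -- The two strips have lengths at most `2 L |t - t₀|` and `L |t - t₀|`; this explains the 3, and
    -- `L + 1` keeps the denominator positive.
    have hε' : 0 < ε / (3 * (L + 1)) := by positivity
    filter_upwards [hbL, hi₁, hi₂, h₁ _ hε', h₂ _ hε'] with t e1 e2 e3 e4 e5
    have f1 := norm_integral_sub_const_le e2 e4
    have f2 := norm_integral_sub_const_le e3 e5
    have e : (∫ s in (c t)..(b t), Φ t s) - (∫ s in (c t)..(b t₀), Φ t₀ s) - (b t - b t₀) • v =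
        ((∫ s in (c t)..(b t), Φ t s) - (b t - c t) • v) -
          ((∫ s in (c t)..(b t₀), Φ t₀ s) - (b t₀ - c t) • v) := by
      rw [show b t - b t₀ = (b t - c t) - (b t₀ - c t) by ring, sub_smul]
      abel
    rw [e]
    refine (norm_sub_le _ _).trans ((add_le_add f1 f2).trans ?_)
    have g1 : |b t₀ - c t| ≤ L * |t - t₀| := by rw [abs_sub_comm]; exact hc t
    have g2 : |b t - c t| ≤ 2 * (L * |t - t₀|) := by
      have := abs_sub_le (b t) (b t₀) (c t)
      linarith
    rw [← mul_add, Real.norm_eq_abs]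
    calc ε / (3 * (L + 1)) * (|b t - c t| + |b t₀ - c t|)
        ≤ ε / (3 * (L + 1)) * (3 * ((L + 1) * |t - t₀|)) := by
          gcongr
          nlinarith [abs_nonneg (t - t₀)]
      _ = ε * |t - t₀| := by field_simp
  have hb' := (hasDerivAt_iff_isLittleO.1 (hb.smul_const v))
  rw [hasDerivAt_iff_isLittleO]
  refine (hsmall.add hb').congr_left fun t => ?_
  have : c t₀ = b t₀ := by
    have := hc t₀
    rw [sub_self, abs_zero, mul_zero] at this
    exact sub_eq_zero.1 (abs_eq_zero.1 (le_antisymm this (abs_nonneg _)))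
  rw [sub_self, sub_zero, sub_smul]
  abel

lemma eventually_abs_sub_le_of_hasDerivAt {b : ℝ → ℝ} {b' t₀ L : ℝ} (hb : HasDerivAt b b' t₀)
    (hL : |b'| < L) : ∀ᶠ t in 𝓝 t₀, |b t - b t₀| ≤ L * |t - t₀| := by
  have h := (hasDerivAt_iff_isLittleO.1 hb).bound (sub_pos.2 hL)
  filter_upwards [h] with t ht
  rw [Real.norm_eq_abs, Real.norm_eq_abs, smul_eq_mul] at ht
  have h1 : |b t - b t₀| ≤ |b t - b t₀ - (t - t₀) * b'| + |(t - t₀) * b'| := by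
    have := abs_add_le (b t - b t₀ - (t - t₀) * b') ((t - t₀) * b')
    rwa [sub_add_cancel] at this
  rw [abs_mul] at h1
  nlinarith

variable {𝕜 E₁ E₂ : Type*} [RCLike 𝕜]
  [NormedAddCommGroup E₁] [NormedSpace 𝕜 E₁] [NormedSpace ℝ E₁] [IsScalarTower ℝ 𝕜 E₁]
  [NormedAddCommGroup E₂] [NormedSpace 𝕜 E₂] [NormedSpace ℝ E₂] [IsScalarTower ℝ 𝕜 E₂]

variable {V : Data 𝕜 E₁ E₂} {T' : ℝ} {x : ℝ → E₁}

namespace Data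

/-- Near an end point `(t₀, s₀)`, `s₀ > 0`, of the region the integrand is almost constant. -/
lemma eventually_norm_kernel_apply_sub_le (hT : T' ≤ V.T) {i : ℕ}
    (hx : x ∈ admissible 𝕜 E₁ T') {k : ℝ → ℝ → E₁ →L[𝕜] E₂}
    (hk : ContinuousOn (fun z : ℝ × ℝ => k z.1 z.2) (V.region i)) {t₀ s₀ : ℝ}
    (ht₀ : t₀ ∈ Ioo 0 T') (hs₀ : s₀ ∈ Ioo 0 T') (hmem : (t₀, s₀) ∈ V.region i) (L : ℝ)
    {ε : ℝ} (hε : 0 < ε) :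
    ∀ᶠ t in 𝓝 t₀, ∀ τ, |τ - t₀| ≤ |t - t₀| → ∀ s, |s - s₀| ≤ L * |t - t₀| →
      s ∈ Icc (V.α (i - 1) τ) (V.α i τ) → ‖k τ s (x s) - k t₀ s₀ (x s₀)‖ ≤ ε := by
  have h := continuousOn_kernel_apply hk hx (t₀, s₀) ⟨hmem, hs₀.1, hs₀.2.le⟩
  obtain ⟨δ, hδ, hd⟩ := Metric.continuousWithinAt_iff.1 h ε hε
  have l1 : Tendsto (fun t => |t - t₀|) (𝓝 t₀) (𝓝 0) := by
    have : Tendsto (fun t => |t - t₀|) (𝓝 t₀) (𝓝 |t₀ - t₀|) :=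
      ((continuous_id.sub continuous_const).abs).tendsto t₀
    simpa using this
  have l2 : Tendsto (fun t => L * |t - t₀|) (𝓝 t₀) (𝓝 0) := by simpa using l1.const_mul L
  filter_upwards [l1.eventually_lt_const hδ, l2.eventually_lt_const hδ,
    l1.eventually_lt_const ht₀.1, l1.eventually_lt_const (sub_pos.2 ht₀.2),
    l2.eventually_lt_const hs₀.1, l2.eventually_lt_const (sub_pos.2 hs₀.2)]
    with t e1 e2 e3 e4 e5 e6 τ hτ s hs hsmem
  have a1 := abs_le.1 hτ
  have a2 := abs_le.1 hs
  have hz : (τ, s) ∈ V.region i ∩ {z | z.2 ∈ Ioc 0 T'} :=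
    ⟨⟨⟨by linarith, by linarith⟩, hsmem⟩, ⟨by linarith, by linarith⟩⟩
  have := hd hz (by
    rw [Prod.dist_eq, Real.dist_eq, Real.dist_eq]
    exact max_lt (hτ.trans_lt e1) (hs.trans_lt e2))
  rw [dist_eq_norm] at this
  exact this.le

lemma α_hasDerivAt (hT : T' ≤ V.T) {i : ℕ} (hi : i ≤ V.n) {t₀ : ℝ} (ht₀ : t₀ ∈ Ioo 0 T') :
    HasDerivAt (V.α i) (V.α' i t₀) t₀ :=
  (V.α_hasDeriv i hi t₀ ⟨ht₀.1.le, ht₀.2.le.trans hT⟩).hasDerivAt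
    (Icc_mem_nhds ht₀.1 (ht₀.2.trans_le hT))

/-- The interior contribution to the derivative of the integral over a moving interval. -/
lemma hasDerivAt_integral_interior (hT : T' ≤ V.T) {i : ℕ} (hi : i ∈ Finset.Icc 1 V.n)
    (hx : x ∈ admissible 𝕜 E₁ T') {t₀ : ℝ} (ht₀ : t₀ ∈ Ioo 0 T') {p q : ℝ → ℝ}
    (hp : Tendsto p (𝓝 t₀) (𝓝 (V.α (i - 1) t₀))) (hq : Tendsto q (𝓝 t₀) (𝓝 (V.α i t₀)))
    (hpq : ∀ᶠ t in 𝓝[≠] t₀, V.α (i - 1) t₀ ≤ p t ∧ q t < V.α i t₀ ∧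
      ∀ τ, |τ - t₀| ≤ |t - t₀| → V.α (i - 1) τ ≤ p t ∧ q t < V.α i τ) :
    HasDerivAt (fun t => ∫ s in Ioc (p t) (q t), (V.K i t s (x s) - V.K i t₀ s (x s)))
      (∫ s in (V.α (i - 1) t₀)..(V.α i t₀), V.K' i t₀ s (x s)) t₀ := by
  obtain ⟨M, hM0, hM⟩ := V.exists_kernel_bound hi (V.K'_cont i hi)
  have ht₀' : t₀ ∈ Icc 0 T' := ⟨ht₀.1.le, ht₀.2.le⟩
  rw [hasDerivAt_iff_tendsto_slope]
  have hslope : ∀ t ∈ Ioo 0 T', t ≠ t₀ → (V.α (i - 1) t₀ ≤ p t ∧ q t < V.α i t₀ ∧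
      ∀ τ, |τ - t₀| ≤ |t - t₀| → V.α (i - 1) τ ≤ p t ∧ q t < V.α i τ) →
      slope (fun t => ∫ s in Ioc (p t) (q t), (V.K i t s (x s) - V.K i t₀ s (x s))) t₀ t =
      ∫ s in Ioc 0 T', (Ioc (p t) (q t)).indicator
        (fun s => (t - t₀)⁻¹ • (V.K i t s (x s) - V.K i t₀ s (x s))) s := by
    intro t ht hne hpq
    have hsub : Ioc (p t) (q t) ⊆ Ioc 0 T' :=
      (Ioc_subset_Ioc hpq.1 hpq.2.1.le).trans (Ioc_α_subset hT hi ht₀')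
    rw [setIntegral_indicator measurableSet_Ioc, inter_eq_self_of_subset_right hsub, slope,
      vsub_eq_sub, integral_smul]
    simp
  have hnear : ∀ᶠ t in 𝓝[≠] t₀, t ∈ Ioo 0 T' ∧ t ≠ t₀ :=
    (eventually_nhdsWithin_of_eventually_nhds (Ioo_mem_nhds ht₀.1 ht₀.2)).and self_mem_nhdsWithin
  have hcongr : (fun t => ∫ s in Ioc 0 T', (Ioc (p t) (q t)).indicator
      (fun s => (t - t₀)⁻¹ • (V.K i t s (x s) - V.K i t₀ s (x s))) s) =ᶠ[𝓝[≠] t₀]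
      slope (fun t => ∫ s in Ioc (p t) (q t), (V.K i t s (x s) - V.K i t₀ s (x s))) t₀ := by
    filter_upwards [hpq, hnear] with t h1 h2
    exact (hslope t h2.1 h2.2 h1).symm
  refine Tendsto.congr' hcongr ?_
  rw [integral_eq_indicator hT hi _ ht₀']
  refine tendsto_integral_filter_of_dominated_convergence (fun s => M * ‖x s‖) ?_ ?_
    (hx.2.norm.const_mul M) ?_
  · filter_upwards [hpq, hnear] with t h1 h2
    have ht : t ∈ Icc 0 T' := ⟨h2.1.1.le, h2.1.2.le⟩
    rw [aestronglyMeasurable_indicator_iff measurableSet_Ioc]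
    have hh := h1.2.2 t le_rfl
    have m1 := (aestronglyMeasurable_kernel_apply hT hi (V.K_cont i hi) hx ht).mono_set
      (Ioc_subset_Ioc hh.1 hh.2.le)
    have m2 := (aestronglyMeasurable_kernel_apply hT hi (V.K_cont i hi) hx ht₀').mono_set
      (Ioc_subset_Ioc h1.1 h1.2.1.le)
    refine ((m1.sub m2).const_smul (t - t₀)⁻¹).mono_measure ?_
    rw [Measure.restrict_restrict measurableSet_Ioc]
    exact Measure.restrict_mono inter_subset_left le_rfl
  · filter_upwards [hpq, hnear] with t h1 h2
    refine Eventually.of_forall fun s => ?_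
    by_cases hs : s ∈ Ioc (p t) (q t)
    · rw [indicator_of_mem hs, ← _root_.sub_apply, norm_smul]
      -- The mean value inequality is applied in the first variable at fixed `s`; the cut-offs `p`,
      -- `q` keep the whole segment between `t₀` and `t` inside the open region where `K_i` is
      -- differentiable.
      have hconv : ‖V.K i t s - V.K i t₀ s‖ ≤ M * ‖t - t₀‖ := by
        have hτ : ∀ τ ∈ uIcc t₀ t, τ ∈ Ioo 0 V.T ∧ s ∈ Ioo (V.α (i - 1) τ) (V.α i τ) := by
          intro τ hτ
          have h3 : |τ - t₀| ≤ |t - t₀| := abs_sub_left_of_mem_uIcc hτ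
          have h4 := h1.2.2 τ h3
          have h5 : τ ∈ Ioo 0 T' := (ordConnected_Ioo.uIcc_subset ht₀ h2.1) hτ
          exact ⟨⟨h5.1, h5.2.trans_le hT⟩, ⟨h4.1.trans_lt hs.1, hs.2.trans_lt h4.2⟩⟩
        refine Convex.norm_image_sub_le_of_norm_hasDerivWithin_le (s := uIcc t₀ t)
          (f := fun τ => V.K i τ s) (f' := fun τ => V.K' i τ s) ?_ ?_ (convex_uIcc _ _)
          left_mem_uIcc right_mem_uIcc
        · exact fun τ h => (V.K_hasDeriv i hi τ (hτ τ h).1 s (hτ τ h).2).hasDerivWithinAt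
        · exact fun τ h => hM τ (Ioo_subset_Icc_self (hτ τ h).1) s
            (Ioo_subset_Icc_self (hτ τ h).2)
      have h3 : 0 < ‖t - t₀‖ := norm_pos_iff.2 (sub_ne_zero.2 h2.2)
      rw [norm_inv, inv_mul_le_iff₀ h3]
      refine ((V.K i t s - V.K i t₀ s).le_of_opNorm_le hconv (x s)).trans (le_of_eq ?_)
      ring
    · rw [indicator_of_notMem hs, norm_zero]
      positivity
  · have hne : ∀ᵐ s ∂(volume.restrict (Ioc 0 T')), s ≠ V.α i t₀ :=
      ae_restrict_of_ae (Measure.ae_ne volume (V.α i t₀))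
    filter_upwards [hne] with s hs0
    by_cases hs : s ∈ Ioc (V.α (i - 1) t₀) (V.α i t₀)
    · have hs' : s ∈ Ioo (V.α (i - 1) t₀) (V.α i t₀) := ⟨hs.1, lt_of_le_of_ne hs.2 hs0⟩
      rw [indicator_of_mem hs]
      have hd := hasDerivAt_iff_tendsto_slope.1
        (V.K_hasDeriv i hi t₀ ⟨ht₀.1, ht₀.2.trans_le hT⟩ s hs')
      have hd2 : Tendsto (fun t => slope (fun τ => V.K i τ s) t₀ t (x s)) (𝓝[≠] t₀)
          (𝓝 (V.K' i t₀ s (x s))) :=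
        ((ContinuousLinearMap.apply 𝕜 E₂ (x s)).continuous.tendsto _).comp hd
      refine hd2.congr' ?_
      have e1 : ∀ᶠ t in 𝓝[≠] t₀, p t < s :=
        eventually_nhdsWithin_of_eventually_nhds (hp.eventually_lt_const hs'.1)
      have e2 : ∀ᶠ t in 𝓝[≠] t₀, s < q t :=
        eventually_nhdsWithin_of_eventually_nhds (hq.eventually_const_lt hs'.2)
      filter_upwards [e1, e2] with t h1 h2
      rw [indicator_of_mem (mem_Ioc.2 ⟨h1, h2.le⟩)]
      simp [slope]
    · rw [indicator_of_notMem hs]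
      refine tendsto_const_nhds.congr' ?_
      filter_upwards [hpq] with t h1
      rw [indicator_of_notMem]
      exact fun h => hs ⟨h1.1.trans_lt h.1, h.2.trans h1.2.1.le⟩

/-- The strip between the cut-off and the moving endpoint has width `O(|t - t₀|)`, and there the
integrand is nearly constant. Positivity of the endpoint is needed because `x` may be unbounded at
`0`. -/
lemma hasDerivAt_integral_endpoint [CompleteSpace E₂] (hT : T' ≤ V.T) {i e : ℕ}
    (hi : i ∈ Finset.Icc 1 V.n) (he : e ≤ V.n) (hx : x ∈ admissible 𝕜 E₁ T') {t₀ L : ℝ}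
    (ht₀ : t₀ ∈ Ioo 0 T') (hpos : 0 < V.α e t₀) (hL : |V.α' e t₀| < L) {c : ℝ → ℝ}
    (hc : ∀ t, |c t - V.α e t₀| ≤ L * |t - t₀|)
    (hin : ∀ᶠ t in 𝓝 t₀, uIcc (c t) (V.α e t) ⊆ Icc (V.α (i - 1) t) (V.α i t) ∧
      uIcc (c t) (V.α e t₀) ⊆ Icc (V.α (i - 1) t₀) (V.α i t₀)) :
    HasDerivAt (fun t => (∫ s in (c t)..(V.α e t), V.K i t s (x s)) -
      ∫ s in (c t)..(V.α e t₀), V.K i t₀ s (x s))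
      (V.α' e t₀ • V.K i t₀ (V.α e t₀) (x (V.α e t₀))) t₀ := by
  have ht₀' : t₀ ∈ Icc 0 T' := ⟨ht₀.1.le, ht₀.2.le⟩
  have hd := α_hasDerivAt hT he ht₀
  have hbL := eventually_abs_sub_le_of_hasDerivAt hd hL
  have hmem : (t₀, V.α e t₀) ∈ V.region i :=
    ⟨⟨ht₀.1.le, ht₀.2.le.trans hT⟩, hin.self_of_nhds.2 right_mem_uIcc⟩
  have hs₀ : V.α e t₀ ∈ Ioo 0 T' :=
    ⟨hpos, (V.α_le_self he ⟨ht₀.1.le, ht₀.2.le.trans hT⟩).trans_lt ht₀.2⟩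
  have hnear : ∀ᶠ t in 𝓝 t₀, t ∈ Icc 0 T' := Icc_mem_nhds ht₀.1 ht₀.2
  have hii : ∀ t ∈ Icc 0 T', ∀ p q, uIcc p q ⊆ Icc (V.α (i - 1) t) (V.α i t) →
      IntervalIntegrable (fun s => V.K i t s (x s)) volume p q := by
    intro t ht p q hpq
    rcases le_total p q with h | h
    · rw [uIcc_of_le h] at hpq
      exact intervalIntegrable_kernel_apply hT hi (V.K_cont i hi) hx ht
        (hpq (left_mem_Icc.2 h)).1 h (hpq (right_mem_Icc.2 h)).2
    · rw [uIcc_of_ge h] at hpq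
      exact (intervalIntegrable_kernel_apply hT hi (V.K_cont i hi) hx ht
        (hpq (left_mem_Icc.2 h)).1 h (hpq (right_mem_Icc.2 h)).2).symm
  have hclose : ∀ {t p s : ℝ}, |p - V.α e t₀| ≤ L * |t - t₀| → s ∈ uIcc (c t) p →
      |s - V.α e t₀| ≤ L * |t - t₀| := by
    intro t p s hp hs
    have h1 := abs_le.1 hp
    have h2 := abs_le.1 (hc t)
    rw [mem_uIcc] at hs
    rw [abs_le]
    rcases hs with hs | hs <;> constructor <;> linarith [hs.1, hs.2]
  refine hasDerivAt_integral_boundary hd hc ((abs_nonneg _).trans hL.le) hbL ?_ ?_ ?_ ?_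
  · filter_upwards [hin, hnear] with t h1 h2 using hii t h2 _ _ h1.1
  · filter_upwards [hin] with t h1 using hii t₀ ht₀' _ _ h1.2
  · intro ε hε
    filter_upwards [eventually_norm_kernel_apply_sub_le hT hx (V.K_cont i hi) ht₀ hs₀ hmem L hε,
      hin, hbL] with t h1 h2 h3 s hs
    exact h1 t le_rfl s (hclose h3 hs) (h2.1 hs)
  · intro ε hε
    filter_upwards [eventually_norm_kernel_apply_sub_le hT hx (V.K_cont i hi) ht₀ hs₀ hmem L hε,
      hin, hbL] with t h1 h2 h3 s hs
    refine h1 t₀ (by simp) s (hclose ?_ hs) (h2.2 hs)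
    rw [sub_self, abs_zero]
    exact mul_nonneg ((abs_nonneg _).trans hL.le) (abs_nonneg _)

lemma eventually_forall_abs_sub_le {P : ℝ → Prop} {t₀ : ℝ} (h : ∀ᶠ t in 𝓝 t₀, P t) :
    ∀ᶠ t in 𝓝 t₀, ∀ τ, |τ - t₀| ≤ |t - t₀| → P τ := by
  obtain ⟨δ, hδ, hd⟩ := Metric.eventually_nhds_iff.1 h
  refine Metric.eventually_nhds_iff.2 ⟨δ, hδ, fun t ht τ hτ => hd ?_⟩
  rw [Real.dist_eq] at ht ⊢
  exact hτ.trans_lt ht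

/-- The Leibniz rule for one of the integrals of the equation. -/
lemma hasDerivAt_integral [CompleteSpace E₂] (hT : T' ≤ V.T) {i : ℕ}
    (hi : i ∈ Finset.Icc 1 V.n) (hx : x ∈ admissible 𝕜 E₁ T') {t₀ : ℝ} (ht₀ : t₀ ∈ Ioo 0 T') :
    HasDerivAt (fun t => ∫ s in (V.α (i - 1) t)..(V.α i t), V.K i t s (x s))
      (V.α' i t₀ • V.K i t₀ (V.α i t₀) (x (V.α i t₀)) -
        V.α' (i - 1) t₀ • V.K i t₀ (V.α (i - 1) t₀) (x (V.α (i - 1) t₀)) +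
        ∫ s in (V.α (i - 1) t₀)..(V.α i t₀), V.K' i t₀ s (x s)) t₀ := by
  have hi' := Finset.mem_Icc.1 hi
  have ht₀T : t₀ ∈ Ioc 0 V.T := ⟨ht₀.1, ht₀.2.le.trans hT⟩
  have hlt := V.α_pred_lt hi ht₀T
  have hda := α_hasDerivAt hT (i := i - 1) (by omega) ht₀
  have hdb := α_hasDerivAt hT hi'.2 ht₀
  have hnear : ∀ᶠ t in 𝓝 t₀, t ∈ Icc 0 T' := Icc_mem_nhds ht₀.1 ht₀.2
  have habs : ∀ L : ℝ, Tendsto (fun t => L * |t - t₀|) (𝓝 t₀) (𝓝 0) := by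
    intro L
    have : Tendsto (fun t => L * |t - t₀|) (𝓝 t₀) (𝓝 (L * |t₀ - t₀|)) :=
      (continuous_const.mul (continuous_id.sub continuous_const).abs).tendsto t₀
    simpa using this
  -- the moving lower cut-off
  obtain ⟨La, hLa0, hLa, hA⟩ : ∃ La : ℝ, 0 ≤ La ∧
      (∀ᶠ t in 𝓝 t₀, V.α (i - 1) t ≤ V.α (i - 1) t₀ + La * |t - t₀|) ∧
      HasDerivAt (fun t => (∫ s in (V.α (i - 1) t₀ + La * |t - t₀|)..(V.α (i - 1) t),
          V.K i t s (x s)) -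
        ∫ s in (V.α (i - 1) t₀ + La * |t - t₀|)..(V.α (i - 1) t₀), V.K i t₀ s (x s))
      (V.α' (i - 1) t₀ • V.K i t₀ (V.α (i - 1) t₀) (x (V.α (i - 1) t₀))) t₀ := by
    -- The bottom curve is the constant `0`, where `x` may be singular; there no cut-off is made and
    -- `La = 0`. On every other curve `x` is continuous.
    by_cases h1 : i = 1
    · subst h1
      refine ⟨0, le_rfl, ?_, ?_⟩
      · filter_upwards [hnear] with t ht
        rw [Nat.sub_self, V.α_bot t ⟨ht.1, ht.2.trans hT⟩, V.α_bot t₀ ⟨ht₀T.1.le, ht₀T.2⟩]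
        simp
      · rw [Nat.sub_self, V.α'_zero_zero ⟨ht₀T.1.le, ht₀T.2⟩, zero_smul]
        refine (hasDerivAt_const t₀ (0 : E₂)).congr_of_eventuallyEq ?_
        filter_upwards [hnear] with t ht
        rw [V.α_bot t ⟨ht.1, ht.2.trans hT⟩, V.α_bot t₀ ⟨ht₀T.1.le, ht₀T.2⟩]
        simp
    · have hL : |V.α' (i - 1) t₀| < |V.α' (i - 1) t₀| + 1 := by linarith
      have hL0 : 0 ≤ |V.α' (i - 1) t₀| + 1 := by positivity
      have hbd := eventually_abs_sub_le_of_hasDerivAt hda hL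
      refine ⟨_, hL0, ?_, ?_⟩
      · filter_upwards [hbd] with t ht
        linarith [(abs_le.1 ht).2]
      · refine hasDerivAt_integral_endpoint hT hi (by omega) hx ht₀
          (V.α_pos (by omega) (by omega) ht₀T) hL (fun t => ?_) ?_
        · rw [add_sub_cancel_left, abs_of_nonneg (by positivity)]
        · have e1 : Tendsto (fun t => V.α (i - 1) t₀ + (|V.α' (i - 1) t₀| + 1) * |t - t₀|) (𝓝 t₀)
              (𝓝 (V.α (i - 1) t₀)) := by
            simpa using (habs (|V.α' (i - 1) t₀| + 1)).const_add (V.α (i - 1) t₀)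
          filter_upwards [hbd, e1.eventually_lt_const hlt,
            e1.eventually_lt hdb.continuousAt.tendsto hlt] with t f1 f2 f3
          have f4 := (abs_le.1 f1).2
          have f5 : 0 ≤ (|V.α' (i - 1) t₀| + 1) * |t - t₀| := by positivity
          rw [uIcc_of_ge (by linarith), uIcc_of_ge (by linarith)]
          exact ⟨Icc_subset_Icc le_rfl f3.le, Icc_subset_Icc le_rfl f2.le⟩
  -- the moving upper cut-off
  set Lb : ℝ := |V.α' i t₀| + 2 with hLb
  have hLb0 : 0 ≤ Lb := by positivity
  have hbd1 := eventually_abs_sub_le_of_hasDerivAt hdb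
    (show |V.α' i t₀| < |V.α' i t₀| + 1 by linarith)
  have q1 : Tendsto (fun t => V.α i t₀ - Lb * |t - t₀|) (𝓝 t₀) (𝓝 (V.α i t₀)) := by
    simpa using (habs Lb).const_sub (V.α i t₀)
  have p1 : Tendsto (fun t => V.α (i - 1) t₀ + La * |t - t₀|) (𝓝 t₀) (𝓝 (V.α (i - 1) t₀)) := by
    simpa using (habs La).const_add (V.α (i - 1) t₀)
  have hB : HasDerivAt (fun t => (∫ s in (V.α i t₀ - Lb * |t - t₀|)..(V.α i t),
          V.K i t s (x s)) -
        ∫ s in (V.α i t₀ - Lb * |t - t₀|)..(V.α i t₀), V.K i t₀ s (x s))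
      (V.α' i t₀ • V.K i t₀ (V.α i t₀) (x (V.α i t₀))) t₀ := by
    refine hasDerivAt_integral_endpoint hT hi hi'.2 hx ht₀ (V.α_pos hi'.1 hi'.2 ht₀T)
      (show |V.α' i t₀| < Lb by linarith) (fun t => ?_) ?_
    · rw [sub_sub_cancel_left, abs_neg, abs_of_nonneg (by positivity)]
    · filter_upwards [hbd1, q1.eventually_const_lt hlt,
        hda.continuousAt.tendsto.eventually_lt q1 hlt] with t f1 f2 f3
      have f4 := (abs_le.1 f1).1
      have f5 : 0 ≤ Lb * |t - t₀| := by positivity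
      have f6 : (|V.α' i t₀| + 1) * |t - t₀| ≤ Lb * |t - t₀| := by gcongr; linarith
      rw [uIcc_of_le (by linarith), uIcc_of_le (by linarith)]
      exact ⟨Icc_subset_Icc f3.le le_rfl, Icc_subset_Icc f2.le le_rfl⟩
  have hI := hasDerivAt_integral_interior hT hi hx ht₀ p1 q1 (by
    have h1 := eventually_forall_abs_sub_le hbd1
    have h2 := eventually_forall_abs_sub_le hbd1
    have hLa' : ∀ᶠ t in 𝓝 t₀, ∀ τ, |τ - t₀| ≤ |t - t₀| →
        V.α (i - 1) τ ≤ V.α (i - 1) t₀ + La * |τ - t₀| := eventually_forall_abs_sub_le hLa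
    filter_upwards [eventually_nhdsWithin_of_eventually_nhds h1,
      eventually_nhdsWithin_of_eventually_nhds hLa', self_mem_nhdsWithin] with t e1 e2 e3
    have e4 : 0 < |t - t₀| := abs_pos.2 (sub_ne_zero.2 e3)
    have e5 : 0 ≤ |V.α' i t₀| := abs_nonneg _
    -- `Lb` exceeds the slope bound `|α'| + 1` by one unit, which makes the upper cut-off lie
    -- strictly below the curve.
    refine ⟨by nlinarith, by nlinarith, fun τ hτ => ⟨?_, ?_⟩⟩
    · exact (e2 τ hτ).trans (by gcongr)
    · have e6 := (abs_le.1 (e1 τ hτ)).1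
      have e7 : (|V.α' i t₀| + 1) * |τ - t₀| ≤ (|V.α' i t₀| + 1) * |t - t₀| := by gcongr
      nlinarith)
  -- Near `t₀` the integral is the upper strip minus the lower strip plus the change of kernel on
  -- the common core, up to its constant value at `t₀`.
  have hsum := ((hB.sub hA).add hI).add_const
    (∫ s in (V.α (i - 1) t₀)..(V.α i t₀), V.K i t₀ s (x s))
  refine hsum.congr_of_eventuallyEq ?_
  filter_upwards [hnear, hLa, hbd1, p1.eventually_lt q1 hlt] with t ht f1 f2 f3
  have ht₀' : t₀ ∈ Icc 0 T' := ⟨ht₀.1.le, ht₀.2.le⟩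
  have f5 : 0 ≤ Lb * |t - t₀| := by positivity
  have f6 : (|V.α' i t₀| + 1) * |t - t₀| ≤ Lb * |t - t₀| := by gcongr; linarith
  have f7 : 0 ≤ La * |t - t₀| := by positivity
  have f8 := (abs_le.1 f2).1
  have i1 : ∀ {c d}, V.α (i - 1) t ≤ c → c ≤ d → d ≤ V.α i t →
      IntervalIntegrable (fun s => V.K i t s (x s)) volume c d :=
    intervalIntegrable_kernel_apply hT hi (V.K_cont i hi) hx ht
  have i2 : ∀ {c d}, V.α (i - 1) t₀ ≤ c → c ≤ d → d ≤ V.α i t₀ →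
      IntervalIntegrable (fun s => V.K i t₀ s (x s)) volume c d :=
    intervalIntegrable_kernel_apply hT hi (V.K_cont i hi) hx ht₀'
  simp only [Pi.add_apply, Pi.sub_apply]
  rw [← intervalIntegral.integral_of_le f3.le, intervalIntegral.integral_sub
    (i1 (by linarith) f3.le (by linarith)) (i2 (by linarith) f3.le (by linarith))]
  have g1 := intervalIntegral.integral_add_adjacent_intervals
    (i1 le_rfl f1 (by linarith)) (i1 f1 f3.le (by linarith))
  have g2 := intervalIntegral.integral_add_adjacent_intervals
    (i1 le_rfl (by linarith) (by linarith)) (i1 (c := V.α i t₀ - Lb * |t - t₀|) (d := V.α i t)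
      (by linarith) (by linarith) le_rfl)
  have g3 := intervalIntegral.integral_add_adjacent_intervals
    (i2 le_rfl (d := V.α (i - 1) t₀ + La * |t - t₀|) (by linarith) (by linarith))
    (i2 (by linarith) f3.le (by linarith))
  have g4 := intervalIntegral.integral_add_adjacent_intervals
    (i2 le_rfl (by linarith) (by linarith)) (i2 (c := V.α i t₀ - Lb * |t - t₀|) (d := V.α i t₀)
      (by linarith) (by linarith) le_rfl)
  rw [← g2, ← g1, ← g4, ← g3, intervalIntegral.integral_symm (V.α (i - 1) t),
    intervalIntegral.integral_symm (V.α (i - 1) t₀)]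
  abel

/-- The endpoint contributions of neighbouring integrals combine into jumps `K_i - K_{i+1}` along
each inner curve. At the bottom `α_0' = 0`, and at the top `α_n' = 1` leaves the term `K_n(t,t)
x(t)`. -/
lemma hasDerivAt_intOp [CompleteSpace E₂] (hT : T' ≤ V.T) (hx : x ∈ admissible 𝕜 E₁ T')
    {t : ℝ} (ht : t ∈ Ioo 0 T') : HasDerivAt (V.intOp x) (V.diffOp x t) t := by
  have ht' : t ∈ Icc 0 V.T := ⟨ht.1.le, ht.2.le.trans hT⟩
  refine (HasDerivAt.fun_sum fun i hi => hasDerivAt_integral hT hi hx ht).congr_deriv ?_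
  rw [Finset.sum_add_distrib, diffOp]
  congr 1
  have h1 : ∀ g : ℕ → E₂, ∑ i ∈ Finset.Icc 1 V.n, g i =
      ∑ i ∈ Finset.Ico 1 V.n, g i + g V.n := by
    intro g
    rw [← Finset.Ico_add_one_right_eq_Icc, Finset.sum_Ico_succ_top V.one_le_n]
  have h2 : ∀ g : ℕ → E₂, ∑ i ∈ Finset.Icc 1 V.n, g i =
      g 1 + ∑ i ∈ Finset.Ico 1 V.n, g (i + 1) := by
    intro g
    rw [← Finset.Ico_add_one_right_eq_Icc, Finset.sum_eq_sum_Ico_succ_bot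
      (by have := V.one_le_n; omega), Finset.sum_Ico_add' g 1 V.n 1]
  rw [Finset.sum_sub_distrib, h1, h2, Nat.sub_self, V.α'_zero_zero ht', V.α'_top ht',
    V.α_top t ht', zero_smul, zero_add, one_smul, add_sub_right_comm, ← Finset.sum_sub_distrib,
    add_comm]
  congr 1
  refine Finset.sum_congr rfl fun i _ => ?_
  rw [Nat.add_sub_cancel, ← smul_sub, ← _root_.sub_apply]

/-- Differentiation gives the forward direction inside the interval, and continuity adds the point
`T'`. Conversely, equal derivatives make the difference of the two sides constant, and that constant
is its limit at `0`, where the intervals of integration degenerate and `f` vanishes. -/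
lemma intOp_eq_iff [CompleteSpace E₂] (hT : T' ≤ V.T) (hf0 : V.f 0 = 0)
    (hx : x ∈ admissible 𝕜 E₁ T') :
    (∀ t ∈ Ioc 0 T', V.intOp x t = V.f t) ↔ ∀ t ∈ Ioc 0 T', V.diffOp x t = V.f' t := by
  have hsub : Icc 0 T' ⊆ Icc 0 V.T := Icc_subset_Icc_right hT
  have hfd : ∀ t ∈ Ioo 0 T', HasDerivAt V.f (V.f' t) t := fun t ht =>
    (V.f_hasDeriv t ⟨ht.1.le, ht.2.le.trans hT⟩).hasDerivAt
      (Icc_mem_nhds ht.1 (ht.2.trans_le hT))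
  have hG : ContinuousOn (V.intOp x) (Icc 0 T') :=
    continuousOn_finsetSum _ fun i hi => continuousOn_integral hT hi (V.K_cont i hi) hx
  have hf : ContinuousOn V.f (Icc 0 T') := fun t ht =>
    ((V.f_hasDeriv t (hsub ht)).continuousWithinAt).mono hsub
  constructor
  · intro h
    have hIoo : ∀ t ∈ Ioo 0 T', V.diffOp x t = V.f' t := by
      intro t ht
      refine (hasDerivAt_intOp hT hx ht).unique ((hfd t ht).congr_of_eventuallyEq ?_)
      filter_upwards [Ioo_mem_nhds ht.1 ht.2] with s hs using h s ⟨hs.1, hs.2.le⟩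
    intro t ht
    have hT' : 0 < T' := ht.1.trans_le ht.2
    refine Set.EqOn.of_subset_closure (s := Ioo 0 T') hIoo (continuousOn_diffOp hT hx)
      (V.f'_cont.mono (Ioc_subset_Icc_self.trans hsub)) Ioo_subset_Ioc_self ?_ ht
    rw [closure_Ioo hT'.ne]
    exact Ioc_subset_Icc_self
  · intro h t ht
    have hT' : 0 < T' := ht.1.trans_le ht.2
    have hconst : ∀ s ∈ Ioc 0 t, V.intOp x t - V.f t = V.intOp x s - V.f s := by
      intro s hs
      have hss : Icc s t ⊆ Icc 0 T' := Icc_subset_Icc hs.1.le ht.2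
      refine constant_of_has_deriv_right_zero (f := fun t => V.intOp x t - V.f t)
        ((hG.sub hf).mono hss) (fun τ hτ => ?_) t ⟨hs.2, le_rfl⟩
      have hτ' : τ ∈ Ioo 0 T' := ⟨hs.1.trans_le hτ.1, hτ.2.trans_le ht.2⟩
      have hd := (hasDerivAt_intOp hT hx hτ').sub (hfd τ hτ')
      rw [h τ ⟨hτ'.1, hτ'.2.le⟩, sub_self] at hd
      exact hd.hasDerivWithinAt
    have h0 : V.intOp x 0 - V.f 0 = 0 := by
      rw [hf0, sub_zero, intOp]
      refine Finset.sum_eq_zero fun i hi => ?_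
      have := Finset.mem_Icc.1 hi
      rw [V.α_zero i this.2, V.α_zero (i - 1) (by omega), intervalIntegral.integral_same]
    have hlim : Tendsto (fun s => V.intOp x s - V.f s) (𝓝[Ioc 0 t] 0) (𝓝 0) := by
      have := (hG.sub hf) 0 ⟨le_rfl, hT'.le⟩
      rw [ContinuousWithinAt] at this
      simp only [Pi.sub_apply, h0] at this
      exact this.mono_left (nhdsWithin_mono _
        (Ioc_subset_Icc_self.trans (Icc_subset_Icc_right ht.2)))
    have hlim2 : Tendsto (fun s => V.intOp x s - V.f s) (𝓝[Ioc 0 t] 0)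
        (𝓝 (V.intOp x t - V.f t)) := by
      refine tendsto_const_nhds.congr' ?_
      filter_upwards [self_mem_nhdsWithin] with s hs using hconst s hs
    have hne : (𝓝[Ioc 0 t] (0 : ℝ)).NeBot := by
      rw [nhdsWithin_Ioc_eq_nhdsGT ht.1]
      infer_instance
    exact sub_eq_zero.1 (tendsto_nhds_unique hlim2 hlim)

end Data

end Leibniz

/-! ### Contraction in weighted spaces -/

section Contraction

variable {𝕜 E₁ E₂ : Type*} [RCLike 𝕜]
  [NormedAddCommGroup E₁] [NormedSpace 𝕜 E₁] [NormedSpace ℝ E₁] [IsScalarTower ℝ 𝕜 E₁]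
  [NormedAddCommGroup E₂] [NormedSpace 𝕜 E₂] [NormedSpace ℝ E₂] [IsScalarTower ℝ 𝕜 E₂]

variable {V : Data 𝕜 E₁ E₂} {T' : ℝ} {x y : ℝ → E₁}

lemma admissible_of_bound {D : ℝ} (hx : ContinuousOn x (Ioc 0 T'))
    (hD : ∀ t ∈ Ioc 0 T', ‖x t‖ ≤ D) : x ∈ admissible 𝕜 E₁ T' := by
  refine ⟨hx, Integrable.mono' (integrable_const D)
    (hx.aestronglyMeasurable measurableSet_Ioc) ?_⟩
  exact (ae_restrict_iff' measurableSet_Ioc).2 (Eventually.of_forall hD)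

namespace Data

variable (V) in
/-- The operator `x ↦ K_n(t,t)⁻¹ (diffOp x)(t) - x(t)`. -/
def remOp (x : ℝ → E₁) (t : ℝ) : E₁ := (V.K V.n t t).inverse (V.diffOp x t) - x t

lemma remOp_eq {t : ℝ} (hinv : (V.K V.n t t).IsInvertible) :
    V.remOp x t = (∑ i ∈ Finset.Ico 1 V.n, V.α' i t • ((V.K V.n t t).inverse ∘L
      (V.K i t (V.α i t) - V.K (i + 1) t (V.α i t))) (x (V.α i t))) +
    (V.K V.n t t).inverse
      (∑ i ∈ Finset.Icc 1 V.n, ∫ s in (V.α (i - 1) t)..(V.α i t), V.K' i t s (x s)) := by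
  have h : (V.K V.n t t).inverse (V.K V.n t t (x t)) = x t := hinv.inverse_apply_eq.2 rfl
  rw [remOp, diffOp, map_add, map_add, h, add_assoc, add_sub_cancel_left, map_sum]
  congr 1
  refine Finset.sum_congr rfl fun i _ => ?_
  exact clm_map_real_smul _ _ _

lemma continuousOn_inverse_diag [CompleteSpace E₁] (hT : T' ≤ V.T)
    (hinv : ∀ t ∈ Icc 0 T', (V.K V.n t t).IsInvertible) :
    ContinuousOn (fun t => (V.K V.n t t).inverse) (Icc 0 T') := by
  intro t ht
  obtain ⟨e, he⟩ := hinv t ht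
  have h1 : ContinuousAt ContinuousLinearMap.inverse (V.K V.n t t) := by
    rw [← he]
    exact (contDiffAt_map_inverse (𝕜 := 𝕜) (n := 0) e).continuousAt
  exact ContinuousAt.comp_continuousWithinAt (f := fun t => V.K V.n t t) h1
    (continuousOn_diag hT t ht)

lemma continuousOn_remOp [CompleteSpace E₁] (hT : T' ≤ V.T)
    (hinv : ∀ t ∈ Icc 0 T', (V.K V.n t t).IsInvertible) (hx : x ∈ admissible 𝕜 E₁ T') :
    ContinuousOn (V.remOp x) (Ioc 0 T') :=
  (((continuousOn_inverse_diag hT hinv).mono Ioc_subset_Icc_self).clm_apply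
    (continuousOn_diffOp hT hx)).sub hx.1

lemma remOp_sub (hT : T' ≤ V.T) (hx : x ∈ admissible 𝕜 E₁ T') (hy : y ∈ admissible 𝕜 E₁ T')
    {t : ℝ} (ht : t ∈ Icc 0 T') : V.remOp (x - y) t = V.remOp x t - V.remOp y t := by
  have h1 : x - y = x + (-1 : 𝕜) • y := by rw [neg_one_smul, sub_eq_add_neg]
  have h2 : V.diffOp (x - y) t = V.diffOp x t - V.diffOp y t := by
    rw [h1, diffOp_add hT hx (Submodule.smul_mem _ _ hy) ht, diffOp_smul, neg_one_smul,
      sub_eq_add_neg]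
  rw [remOp, h2, map_sub, Pi.sub_apply, remOp, remOp]
  abel

/-- In the weight `t ^ γ e ^ (L t)` with large `L` the operator `remOp` is a contraction. -/
lemma exists_remOp_bound [CompleteSpace E₁] (hT : T' ≤ V.T) (hT0 : 0 < T')
    (hinv : ∀ t ∈ Icc 0 T', (V.K V.n t t).IsInvertible) {γ q : ℝ} (hγ : 0 ≤ γ) (hq : q < 1)
    (hcond : ∀ t ∈ Ioc 0 T', ∑ i ∈ Finset.Ico 1 V.n, |V.α' i t| *
      ‖(V.K V.n t t).inverse ∘L (V.K i t (V.α i t) - V.K (i + 1) t (V.α i t))‖ *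
        (V.α i t / t) ^ γ ≤ q) :
    ∃ L q₁ : ℝ, 0 ≤ q₁ ∧ q₁ < 1 ∧ ∀ x : ℝ → E₁, ∀ C : ℝ, 0 ≤ C →
      (∀ t ∈ Ioc 0 T', ‖x t‖ ≤ C * (t ^ γ * Real.exp (L * t))) →
      ∀ t ∈ Ioc 0 T', ‖V.remOp x t‖ ≤ q₁ * (C * (t ^ γ * Real.exp (L * t))) := by
  have hq0 : 0 ≤ q := by
    refine le_trans (Finset.sum_nonneg fun i hi => ?_) (hcond T' ⟨hT0, le_rfl⟩)
    have h := Finset.mem_Ico.1 hi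
    have := V.α_nonneg h.2.le ⟨hT0.le, hT⟩
    positivity
  obtain ⟨I, hI⟩ := isCompact_Icc.exists_bound_of_continuousOn (continuousOn_inverse_diag hT hinv)
  have hI0 : 0 ≤ I := (norm_nonneg _).trans (hI 0 ⟨le_rfl, hT0.le⟩)
  have hMex : ∀ i, ∃ M, 0 ≤ M ∧ (i ∈ Finset.Icc 1 V.n →
      ∀ t ∈ Icc 0 V.T, ∀ s ∈ Icc (V.α (i - 1) t) (V.α i t), ‖V.K' i t s‖ ≤ M) := by
    intro i
    by_cases hi : i ∈ Finset.Icc 1 V.n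
    · obtain ⟨M, h0, hM⟩ := V.exists_kernel_bound hi (V.K'_cont i hi)
      exact ⟨M, h0, fun _ => hM⟩
    · exact ⟨0, le_rfl, fun h => absurd h hi⟩
  choose M hM0 hM using hMex
  set S : ℝ := I * ∑ i ∈ Finset.Icc 1 V.n, M i with hS
  have hS0 : 0 ≤ S := mul_nonneg hI0 (Finset.sum_nonneg fun i _ => hM0 i)
  -- Chosen so that the integral terms contribute at most `S / L ≤ (1 - q) / 2`; together with `q`
  -- from the delayed values this gives the factor `(1 + q) / 2`. The `+ 1` ensures `L > 0`.
  set L : ℝ := 2 * S / (1 - q) + 1 with hL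
  have h1q : 0 < 1 - q := by linarith
  have hL0 : 0 < L := by positivity
  refine ⟨L, (1 + q) / 2, by linarith, by linarith, fun x C hC hx t ht => ?_⟩
  have ht' : t ∈ Icc 0 T' := ⟨ht.1.le, ht.2⟩
  have htT : t ∈ Icc 0 V.T := ⟨ht.1.le, ht.2.trans hT⟩
  have hω : 0 ≤ t ^ γ * Real.exp (L * t) :=
    mul_nonneg (Real.rpow_nonneg ht.1.le _) (Real.exp_pos _).le
  have hfirst : ‖∑ i ∈ Finset.Ico 1 V.n, V.α' i t • ((V.K V.n t t).inverse ∘L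
      (V.K i t (V.α i t) - V.K (i + 1) t (V.α i t))) (x (V.α i t))‖ ≤
      q * (C * (t ^ γ * Real.exp (L * t))) := by
    refine (norm_sum_le _ _).trans ?_
    refine le_trans ?_ (mul_le_mul_of_nonneg_right (hcond t ht) (mul_nonneg hC hω))
    rw [Finset.sum_mul]
    refine Finset.sum_le_sum fun i hi => ?_
    have h := Finset.mem_Ico.1 hi
    have hα := α_mapsTo hT h.1 h.2.le ht
    have hαt : V.α i t ≤ t := V.α_le_self h.2.le htT
    have hxb : ‖x (V.α i t)‖ ≤ (V.α i t / t) ^ γ * (C * (t ^ γ * Real.exp (L * t))) := by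
      refine (hx _ hα).trans ?_
      have e1 : V.α i t ^ γ = (V.α i t / t) ^ γ * t ^ γ := by
        rw [← Real.mul_rpow (div_nonneg hα.1.le ht.1.le) ht.1.le, div_mul_cancel₀ _ ht.1.ne']
      have e2 : Real.exp (L * V.α i t) ≤ Real.exp (L * t) :=
        Real.exp_le_exp.2 (mul_le_mul_of_nonneg_left hαt hL0.le)
      rw [e1]
      have e3 : 0 ≤ (V.α i t / t) ^ γ := Real.rpow_nonneg (div_nonneg hα.1.le ht.1.le) _
      have e4 : 0 ≤ t ^ γ := Real.rpow_nonneg ht.1.le _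
      calc C * ((V.α i t / t) ^ γ * t ^ γ * Real.exp (L * V.α i t))
          ≤ C * ((V.α i t / t) ^ γ * t ^ γ * Real.exp (L * t)) := by gcongr
        _ = _ := by ring
    rw [norm_smul, Real.norm_eq_abs, mul_assoc, mul_assoc]
    refine mul_le_mul_of_nonneg_left ?_ (abs_nonneg _)
    exact ((V.K V.n t t).inverse ∘L
      (V.K i t (V.α i t) - V.K (i + 1) t (V.α i t))).le_opNorm_of_le hxb
  have hsecond : ‖(V.K V.n t t).inverse
      (∑ i ∈ Finset.Icc 1 V.n, ∫ s in (V.α (i - 1) t)..(V.α i t), V.K' i t s (x s))‖ ≤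
      (1 - q) / 2 * (C * (t ^ γ * Real.exp (L * t))) := by
    have hint : ∀ i ∈ Finset.Icc 1 V.n,
        ‖∫ s in (V.α (i - 1) t)..(V.α i t), V.K' i t s (x s)‖ ≤
          M i * (C * (t ^ γ * Real.exp (L * t)) / L) := by
      intro i hi
      have h := Finset.mem_Icc.1 hi
      have hle := V.α_pred_le hi htT
      -- For `γ ≥ 0` one has `s^γ ≤ t^γ`, so only `e^{Ls}` remains under the integral; integrating
      -- it yields the gain `1 / L`.
      have e1 : ∀ s ∈ Ioc (V.α (i - 1) t) (V.α i t),
          ‖V.K' i t s (x s)‖ ≤ M i * (C * t ^ γ) * Real.exp (L * s) := by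
        intro s hs
        have hs' := Ioc_α_subset hT hi ht' hs
        have hst : s ≤ t := hs.2.trans (V.α_le_self h.2 htT)
        refine ((V.K' i t s).le_of_opNorm_le (hM i hi t htT s ⟨hs.1.le, hs.2⟩) _).trans ?_
        rw [mul_assoc (M i)]
        refine mul_le_mul_of_nonneg_left ((hx s hs').trans ?_) (hM0 i)
        rw [mul_assoc]
        refine mul_le_mul_of_nonneg_left ?_ hC
        exact mul_le_mul_of_nonneg_right (Real.rpow_le_rpow hs'.1.le hst hγ) (Real.exp_pos _).le
      refine (intervalIntegral.norm_integral_le_of_norm_le hle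
        (Eventually.of_forall e1) (Continuous.intervalIntegrable (by fun_prop) _ _)).trans ?_
      have e2 : ∫ s in (V.α (i - 1) t)..(V.α i t), Real.exp (L * s) =
          L⁻¹ * (Real.exp (L * V.α i t) - Real.exp (L * V.α (i - 1) t)) := by
        rw [intervalIntegral.integral_comp_mul_left (fun s => Real.exp s) hL0.ne', integral_exp,
          smul_eq_mul]
      rw [intervalIntegral.integral_const_mul, e2]
      have e3 : Real.exp (L * V.α i t) - Real.exp (L * V.α (i - 1) t) ≤ Real.exp (L * t) := by
        have := Real.exp_le_exp.2 (mul_le_mul_of_nonneg_left (V.α_le_self h.2 htT) hL0.le)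
        linarith [Real.exp_pos (L * V.α (i - 1) t)]
      have e4 : 0 ≤ t ^ γ := Real.rpow_nonneg ht.1.le _
      have e5 := hM0 i
      calc M i * (C * t ^ γ) * (L⁻¹ * (Real.exp (L * V.α i t) - Real.exp (L * V.α (i - 1) t)))
          ≤ M i * (C * t ^ γ) * (L⁻¹ * Real.exp (L * t)) := by gcongr
        _ = _ := by rw [div_eq_mul_inv]; ring
    refine ((V.K V.n t t).inverse.le_of_opNorm_le (hI t ht') _).trans ?_
    have e1 := (norm_sum_le _ _).trans (Finset.sum_le_sum hint)
    rw [← Finset.sum_mul] at e1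
    refine (mul_le_mul_of_nonneg_left e1 hI0).trans ?_
    have e2 : S / L ≤ (1 - q) / 2 := by
      rw [div_le_iff₀ hL0, hL, mul_add, mul_one]
      have : (1 - q) / 2 * (2 * S / (1 - q)) = S := by field_simp
      linarith
    calc I * ((∑ i ∈ Finset.Icc 1 V.n, M i) * (C * (t ^ γ * Real.exp (L * t)) / L))
        = S / L * (C * (t ^ γ * Real.exp (L * t))) := by rw [hS]; ring
      _ ≤ _ := mul_le_mul_of_nonneg_right e2 (mul_nonneg hC hω)
  rw [remOp_eq (hinv t ht')]
  refine (norm_add_le _ _).trans ((add_le_add hfirst hsecond).trans (le_of_eq ?_))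
  ring

variable [CompleteSpace E₁]

/-- Uniqueness of small solutions of the differentiated equation. -/
lemma eq_zero_of_diffOp_eq_zero (hT : T' ≤ V.T) (hT0 : 0 < T')
    (hinv : ∀ t ∈ Icc 0 T', (V.K V.n t t).IsInvertible) {γ q : ℝ} (hγ : 0 ≤ γ) (hq : q < 1)
    (hcond : ∀ t ∈ Ioc 0 T', ∑ i ∈ Finset.Ico 1 V.n, |V.α' i t| *
      ‖(V.K V.n t t).inverse ∘L (V.K i t (V.α i t) - V.K (i + 1) t (V.α i t))‖ *
        (V.α i t / t) ^ γ ≤ q) {C : ℝ} (hC : ∀ t ∈ Ioc 0 T', ‖x t‖ ≤ C * t ^ γ)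
    (hx0 : ∀ t ∈ Ioc 0 T', V.diffOp x t = 0) : ∀ t ∈ Ioc 0 T', x t = 0 := by
  obtain ⟨L, q₁, hq₀, hq₁, hb⟩ := exists_remOp_bound hT hT0 hinv hγ hq hcond
  have hrem : ∀ t ∈ Ioc 0 T', ‖V.remOp x t‖ = ‖x t‖ := by
    intro t ht
    rw [remOp, hx0 t ht, map_zero, zero_sub, norm_neg]
  set D : ℝ := |C| * Real.exp (|L| * T') with hD
  have hD0 : 0 ≤ D := by positivity
  have hbase : ∀ t ∈ Ioc 0 T', ‖x t‖ ≤ D * (t ^ γ * Real.exp (L * t)) := by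
    intro t ht
    have e1 : 0 ≤ t ^ γ := Real.rpow_nonneg ht.1.le _
    have e2 : 1 ≤ Real.exp (|L| * T') * Real.exp (L * t) := by
      rw [← Real.exp_add, Real.one_le_exp_iff]
      have h1 : -(|L| * t) ≤ L * t := by
        have := mul_le_mul_of_nonneg_right (neg_abs_le L) ht.1.le
        linarith
      have h2 : |L| * t ≤ |L| * T' := mul_le_mul_of_nonneg_left ht.2 (abs_nonneg _)
      linarith
    calc ‖x t‖ ≤ C * t ^ γ := hC t ht
      _ ≤ |C| * t ^ γ := mul_le_mul_of_nonneg_right (le_abs_self _) e1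
      _ ≤ |C| * t ^ γ * (Real.exp (|L| * T') * Real.exp (L * t)) :=
          le_mul_of_one_le_right (by positivity) e2
      _ = _ := by rw [hD]; ring
  -- A homogeneous solution satisfies `x = -remOp x`, so its weighted bound improves by `q₁` at each
  -- application.
  have hiter : ∀ k : ℕ, ∀ t ∈ Ioc 0 T', ‖x t‖ ≤ q₁ ^ k * D * (t ^ γ * Real.exp (L * t)) := by
    intro k
    induction k with
    | zero => simpa using hbase
    | succ k ih =>
      intro t ht
      rw [← hrem t ht]
      refine (hb x _ (by positivity) ih t ht).trans (le_of_eq ?_)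
      ring
  intro t ht
  have hlim : Tendsto (fun k : ℕ => q₁ ^ k * D * (t ^ γ * Real.exp (L * t))) atTop (𝓝 0) := by
    have := ((tendsto_pow_atTop_nhds_zero_of_lt_one hq₀ hq₁).mul_const D).mul_const
      (t ^ γ * Real.exp (L * t))
    simpa using this
  exact norm_le_zero_iff.1 (ge_of_tendsto' hlim fun k => hiter k t ht)

/-- Existence of small solutions of the differentiated equation with small right-hand side. -/
lemma exists_diffOp_eq (hT : T' ≤ V.T) (hT0 : 0 < T')
    (hinv : ∀ t ∈ Icc 0 T', (V.K V.n t t).IsInvertible) {γ q : ℝ} (hγ : 0 ≤ γ) (hq : q < 1)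
    (hcond : ∀ t ∈ Ioc 0 T', ∑ i ∈ Finset.Ico 1 V.n, |V.α' i t| *
      ‖(V.K V.n t t).inverse ∘L (V.K i t (V.α i t) - V.K (i + 1) t (V.α i t))‖ *
        (V.α i t / t) ^ γ ≤ q) {ρ : ℝ → E₂} (hρ : ContinuousOn ρ (Ioc 0 T')) {C : ℝ}
    (hC : ∀ t ∈ Ioc 0 T', ‖ρ t‖ ≤ C * t ^ γ) :
    ∃ w : ℝ → E₁, ContinuousOn w (Ioc 0 T') ∧ (∃ D, ∀ t ∈ Ioc 0 T', ‖w t‖ ≤ D * t ^ γ) ∧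
      ∀ t ∈ Ioc 0 T', V.diffOp w t = ρ t := by
  obtain ⟨L, q₁, hq₀, hq₁, hb⟩ := exists_remOp_bound hT hT0 hinv hγ hq hcond
  set ω : ℝ → ℝ := fun t => t ^ γ * Real.exp (L * t) with hω
  have hω0 : ∀ t ∈ Ioc 0 T', 0 < ω t := fun t ht =>
    mul_pos (Real.rpow_pos_of_pos ht.1 _) (Real.exp_pos _)
  have hωle : ∀ t ∈ Ioc 0 T', ω t ≤ Real.exp (|L| * T') * t ^ γ := by
    intro t ht
    change t ^ γ * Real.exp (L * t) ≤ _
    rw [mul_comm]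
    refine mul_le_mul_of_nonneg_right (Real.exp_le_exp.2 ?_) (Real.rpow_nonneg ht.1.le _)
    calc L * t ≤ |L| * t := mul_le_mul_of_nonneg_right (le_abs_self _) ht.1.le
      _ ≤ |L| * T' := mul_le_mul_of_nonneg_left ht.2 (abs_nonneg _)
  have hωge : ∀ t ∈ Ioc 0 T', t ^ γ ≤ Real.exp (|L| * T') * ω t := by
    intro t ht
    have e1 : 0 ≤ t ^ γ := Real.rpow_nonneg ht.1.le _
    have e2 : 1 ≤ Real.exp (|L| * T') * Real.exp (L * t) := by
      rw [← Real.exp_add, Real.one_le_exp_iff]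
      have h1 : -(|L| * t) ≤ L * t := by
        have := mul_le_mul_of_nonneg_right (neg_abs_le L) ht.1.le
        linarith
      have h2 : |L| * t ≤ |L| * T' := mul_le_mul_of_nonneg_left ht.2 (abs_nonneg _)
      linarith
    calc t ^ γ ≤ t ^ γ * (Real.exp (|L| * T') * Real.exp (L * t)) :=
          le_mul_of_one_le_right e1 e2
      _ = _ := by rw [hω]; ring
  have hωc : ContinuousOn ω (Ioc 0 T') := by
    refine ContinuousOn.mul (fun t ht => ?_) (by fun_prop)
    exact (Real.continuousAt_rpow_const t γ (Or.inl ht.1.ne')).continuousWithinAt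
  have hωT : ∀ t ∈ Ioc 0 T', ω t ≤ Real.exp (|L| * T') * T' ^ γ := fun t ht =>
    (hωle t ht).trans (mul_le_mul_of_nonneg_left (Real.rpow_le_rpow ht.1.le ht.2 hγ)
      (Real.exp_pos _).le)
  -- the extension of a bounded function, multiplied by the weight
  let ext : BoundedContinuousFunction (Ioc (0 : ℝ) T') E₁ → ℝ → E₁ := fun v t =>
    if h : t ∈ Ioc 0 T' then ω t • v ⟨t, h⟩ else 0
  have hext : ∀ v, ∀ t (h : t ∈ Ioc 0 T'), ext v t = ω t • v ⟨t, h⟩ := fun v t h => dif_pos h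
  have hextb : ∀ v, ∀ t ∈ Ioc 0 T', ‖ext v t‖ ≤ ‖v‖ * ω t := by
    intro v t ht
    rw [hext v t ht, norm_smul, Real.norm_of_nonneg (hω0 t ht).le, mul_comm]
    exact mul_le_mul_of_nonneg_right (v.norm_coe_le_norm _) (hω0 t ht).le
  have hextc : ∀ v, ContinuousOn (ext v) (Ioc 0 T') := by
    intro v
    rw [continuousOn_iff_continuous_domRestrict]
    have : (Ioc 0 T').domRestrict (ext v) = fun t => (Ioc 0 T').domRestrict ω t • v t := by
      funext t
      exact hext v t t.2
    rw [this]
    exact (continuousOn_iff_continuous_domRestrict.1 hωc).smul v.continuous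
  have hadm : ∀ v, ext v ∈ admissible 𝕜 E₁ T' := fun v =>
    admissible_of_bound (D := ‖v‖ * (Real.exp (|L| * T') * T' ^ γ)) (hextc v) fun t ht =>
      (hextb v t ht).trans (mul_le_mul_of_nonneg_left (hωT t ht) (norm_nonneg _))
  set g : ℝ → E₁ := fun t => (V.K V.n t t).inverse (ρ t) with hg
  have hgc : ContinuousOn g (Ioc 0 T') :=
    ((continuousOn_inverse_diag hT hinv).mono Ioc_subset_Icc_self).clm_apply hρ
  obtain ⟨I, hI⟩ := isCompact_Icc.exists_bound_of_continuousOn (continuousOn_inverse_diag hT hinv)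
  have hI0 : 0 ≤ I := (norm_nonneg _).trans (hI 0 ⟨le_rfl, hT0.le⟩)
  set G : ℝ := I * (|C| * Real.exp (|L| * T')) with hG
  have hgb : ∀ t ∈ Ioc 0 T', ‖g t‖ ≤ G * ω t := by
    intro t ht
    refine ((V.K V.n t t).inverse.le_of_opNorm_le (hI t ⟨ht.1.le, ht.2⟩) _).trans ?_
    rw [hG, mul_assoc]
    refine mul_le_mul_of_nonneg_left ((hC t ht).trans ?_) hI0
    rw [mul_assoc]
    exact mul_le_mul (le_abs_self _) (hωge t ht) (Real.rpow_nonneg ht.1.le _) (abs_nonneg _)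
  -- With `x = ω v` and `v` bounded continuous, the equation multiplied by `K_n(t,t)⁻¹` reads `x = g
  -- - remOp x`; `Φ` is this iteration in terms of `v`.
  let Φ : BoundedContinuousFunction (Ioc (0 : ℝ) T') E₁ →
      BoundedContinuousFunction (Ioc (0 : ℝ) T') E₁ := fun v =>
    BoundedContinuousFunction.ofNormedAddCommGroup
      (fun t => (ω t)⁻¹ • (g t - V.remOp (ext v) t))
      (by
        have hc : ContinuousOn (fun t => (ω t)⁻¹ • (g t - V.remOp (ext v) t)) (Ioc 0 T') :=
          (hωc.inv₀ fun t ht => (hω0 t ht).ne').smul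
            (hgc.sub (continuousOn_remOp hT hinv (hadm v)))
        exact continuousOn_iff_continuous_domRestrict.1 hc)
      (G + q₁ * ‖v‖)
      (fun t => by
        have h1 := hω0 t t.2
        rw [norm_smul, norm_inv, Real.norm_of_nonneg h1.le, inv_mul_le_iff₀ h1]
        refine (norm_sub_le _ _).trans ((add_le_add (hgb t t.2)
          (hb (ext v) ‖v‖ (norm_nonneg _) (hextb v) t t.2)).trans (le_of_eq ?_))
        simp only [hω]
        ring)
  have hΦ : ∀ v (t : Ioc (0 : ℝ) T'), Φ v t = (ω t)⁻¹ • (g t - V.remOp (ext v) t) :=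
    fun v t => rfl
  have hcontr : ContractingWith ⟨q₁, hq₀⟩ Φ := by
    refine ⟨by exact_mod_cast hq₁, LipschitzWith.of_dist_le_mul fun v v' => ?_⟩
    change dist (Φ v) (Φ v') ≤ q₁ * dist v v'
    rw [BoundedContinuousFunction.dist_le (mul_nonneg hq₀ dist_nonneg)]
    intro t
    have h1 := hω0 t t.2
    have ht' : (t : ℝ) ∈ Icc 0 T' := ⟨t.2.1.le, t.2.2⟩
    have hsub : ext v' - ext v = ext (v' - v) := by
      funext s
      by_cases hs : s ∈ Ioc 0 T'
      · rw [Pi.sub_apply, hext _ s hs, hext _ s hs, hext _ s hs, ← smul_sub]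
        rfl
      · simp only [ext, dif_neg hs, Pi.sub_apply, sub_zero]
    rw [dist_eq_norm, hΦ, hΦ, ← smul_sub, sub_sub_sub_cancel_left,
      ← remOp_sub hT (hadm v') (hadm v) ht', hsub, norm_smul, norm_inv,
      Real.norm_of_nonneg h1.le, inv_mul_le_iff₀ h1]
    refine (hb _ ‖v' - v‖ (norm_nonneg _) (hextb _) t t.2).trans (le_of_eq ?_)
    rw [dist_comm, dist_eq_norm]
    simp only [hω]
    ring
  set v := hcontr.fixedPoint Φ with hv
  have hfix : Φ v = v := hcontr.fixedPoint_isFixedPt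
  refine ⟨ext v, hextc v, ⟨‖v‖ * Real.exp (|L| * T'), fun t ht => ?_⟩, fun t ht => ?_⟩
  · refine (hextb v t ht).trans ?_
    rw [mul_assoc]
    exact mul_le_mul_of_nonneg_left (hωle t ht) (norm_nonneg _)
  · have h1 := hext v t ht
    rw [← hfix, hΦ, smul_inv_smul₀ (hω0 t ht).ne', hfix, remOp, sub_sub_eq_add_sub] at h1
    have h2 : (V.K V.n t t).inverse (ρ t) = (V.K V.n t t).inverse (V.diffOp (ext v) t) := by
      have h3 : g t + ext v t = (V.K V.n t t).inverse (V.diffOp (ext v) t) + ext v t := by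
        rw [eq_sub_iff_add_eq] at h1
        rw [← h1, add_comm]
      exact add_right_cancel h3
    obtain ⟨e, he⟩ := hinv t ⟨ht.1.le, ht.2⟩
    rw [← he, ContinuousLinearMap.inverse_equiv] at h2
    exact (e.symm.injective h2).symm

end Data

end Contraction

/-! ### Expansions of the data and the leading term of the differentiated operator -/

section Expansion

lemma exists_bound_of_isBigO_rpow {E : Type*} [NormedAddCommGroup E] {g : ℝ → E} {T' s : ℝ}
    (hg : ContinuousOn g (Ioc 0 T')) (hO : g =O[𝓝[>] 0] fun t : ℝ => t ^ s) :
    ∃ C, ∀ t ∈ Ioc 0 T', ‖g t‖ ≤ C * t ^ s := by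
  obtain ⟨C₁, hC₁⟩ := hO.bound
  obtain ⟨δ, hδ, hδb⟩ := mem_nhdsGT_iff_exists_Ioc_subset.1 hC₁
  have hsub : Icc δ T' ⊆ Ioc 0 T' := fun t ht => ⟨lt_of_lt_of_le hδ ht.1, ht.2⟩
  have hc : ContinuousOn (fun t => ‖g t‖ * (t ^ s)⁻¹) (Icc δ T') := by
    refine (hg.mono hsub).norm.mul (ContinuousOn.inv₀ (fun t ht => ?_) fun t ht => ?_)
    · exact (Real.continuousAt_rpow_const t s (Or.inl (hsub ht).1.ne')).continuousWithinAt
    · exact (Real.rpow_pos_of_pos (hsub ht).1 s).ne'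
  obtain ⟨C₂, hC₂⟩ := isCompact_Icc.exists_bound_of_continuousOn hc
  refine ⟨max C₁ C₂, fun t ht => ?_⟩
  have hpos := Real.rpow_pos_of_pos ht.1 s
  rcases le_total t δ with h | h
  · have h1 : ‖g t‖ ≤ C₁ * ‖t ^ s‖ := hδb ⟨ht.1, h⟩
    rw [Real.norm_of_nonneg hpos.le] at h1
    exact h1.trans (mul_le_mul_of_nonneg_right (le_max_left _ _) hpos.le)
  · have h1 := hC₂ t ⟨h, ht.2⟩
    rw [norm_mul, norm_norm, norm_inv, Real.norm_of_nonneg hpos.le, ← div_eq_mul_inv,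
      div_le_iff₀ hpos] at h1
    exact h1.trans (mul_le_mul_of_nonneg_right (le_max_right _ _) hpos.le)

lemma pow_mem_logExp_sub {N : ℕ} (m : ℕ) :
    (fun t : ℝ => t ^ m - (0 : ℝ) ^ m) ∈ logExp ℝ N 1 := by
  rcases Nat.eq_zero_or_pos m with rfl | hm
  · simp only [pow_zero, sub_self]
    exact fun_zero_mem
  · rw [zero_pow hm.ne']
    simp only [sub_zero]
    exact logExp_anti hm (pow_mem_logExp m)

variable {𝕜 E₁ E₂ : Type*} [RCLike 𝕜]
  [NormedAddCommGroup E₁] [NormedSpace 𝕜 E₁] [NormedSpace ℝ E₁] [IsScalarTower ℝ 𝕜 E₁]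
  [NormedAddCommGroup E₂] [NormedSpace 𝕜 E₂] [NormedSpace ℝ E₂] [IsScalarTower ℝ 𝕜 E₂]

lemma admissible_of_isBigO {x : ℝ → E₁} {T' s : ℝ} (hs : -1 < s)
    (hx : ContinuousOn x (Ioc 0 T')) (hO : x =O[𝓝[>] 0] fun t : ℝ => t ^ s) :
    x ∈ admissible 𝕜 E₁ T' := by
  rcases le_or_gt T' 0 with hT0 | hT0
  · refine ⟨hx, ?_⟩
    rw [Ioc_eq_empty (not_lt.2 hT0)]
    exact integrableOn_empty
  obtain ⟨C, hC⟩ := exists_bound_of_isBigO_rpow hx hO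
  have hint := (intervalIntegrable_iff_integrableOn_Ioc_of_le hT0.le).1
    (intervalIntegral.intervalIntegrable_rpow' (a := 0) (b := T') hs)
  exact ⟨hx, (hint.const_mul C).mono' (hx.aestronglyMeasurable measurableSet_Ioc)
    ((ae_restrict_iff' measurableSet_Ioc).2 (Eventually.of_forall hC))⟩

lemma logPow_admissible {s : Set ℕ} {x : ℝ → E₁} (hx : x ∈ logPow E₁ s) (T' : ℝ) :
    x ∈ admissible 𝕜 E₁ T' := by
  have h0 : x ∈ logPow E₁ (Ici 0) := logPow_mono (fun j _ => Nat.zero_le j) hx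
  exact admissible_of_isBigO (show (-1 : ℝ) < ((0 : ℕ) : ℝ) - 1 / 2 by norm_num)
    ((logPow_continuousOn_Ioi hx).mono fun t ht => ht.1) (logPow_isBigO h0 (by norm_num))

namespace Data

variable {V : Data 𝕜 E₁ E₂} {N : ℕ}

lemma eventually_mem_Ioc (V : Data 𝕜 E₁ E₂) : ∀ᶠ t in 𝓝[>] (0 : ℝ), t ∈ Ioc 0 V.T :=
  Ioc_mem_nhdsGT V.T_pos

lemma CondB.exists_curve (hB : V.CondB N) {i : ℕ} (hi : i ∈ Finset.Ico 1 V.n) :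
    CurveExp N (V.α i) (V.α' i 0) ∧
      (fun t => V.α' i t - V.α' i 0) ∈ logExp ℝ N 1 := by
  obtain ⟨hN, -, -, hα⟩ := hB
  obtain ⟨c, hc, hc'⟩ := hα i hi
  have h := Finset.mem_Ico.1 hi
  have ha : 0 < V.α' i 0 := V.α'_zero_pos h.1 h.2.le
  set S : ℝ → ℝ := fun t => ∑ ν ∈ Finset.Icc 1 N, c ν * ((ν : ℝ) * t ^ (ν - 1)) with hS
  have hSS : (fun t => S t - S 0) ∈ logExp ℝ N 1 := by
    have : (fun t => S t - S 0) = fun t => ∑ ν ∈ Finset.Icc 1 N, (c ν * (ν : ℝ)) •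
        (t ^ (ν - 1) - (0 : ℝ) ^ (ν - 1)) := by
      funext t
      rw [hS, ← Finset.sum_sub_distrib]
      refine Finset.sum_congr rfl fun ν _ => ?_
      rw [smul_eq_mul]
      ring
    rw [this]
    exact fun_sum_mem fun ν _ => fun_smul_mem _ (pow_mem_logExp_sub _)
  have hlimS : Tendsto S (𝓝[>] 0) (𝓝 (S 0)) := by
    have : Continuous S := by fun_prop
    exact (this.tendsto 0).mono_left nhdsWithin_le_nhds
  have hlimα : Tendsto (V.α' i) (𝓝[>] 0) (𝓝 (V.α' i 0)) := by
    have h1 : Tendsto (V.α' i) (𝓝[Icc 0 V.T] 0) (𝓝 (V.α' i 0)) :=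
      V.α'_cont i h.2.le 0 ⟨le_rfl, V.T_pos.le⟩
    refine h1.mono_left ?_
    rw [← nhdsWithin_Ioc_eq_nhdsGT V.T_pos]
    exact nhdsWithin_mono _ Ioc_subset_Icc_self
  have hlim0 : Tendsto (fun t => V.α' i t - S t) (𝓝[>] 0) (𝓝 0) := by
    refine hc'.trans_tendsto ?_
    have : Tendsto (fun t : ℝ => t ^ N) (𝓝 0) (𝓝 (0 ^ N)) := (continuous_pow N).tendsto 0
    rw [zero_pow (by omega)] at this
    exact this.mono_left nhdsWithin_le_nhds
  -- Condition (B) does not name the linear coefficient; comparing limits at `0`, where `N ≥ 1`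
  -- makes the error vanish, identifies it with `α'(0)`.
  have hS0 : S 0 = V.α' i 0 := by
    have := tendsto_nhds_unique (hlimα.sub hlimS) hlim0
    linarith
  refine ⟨⟨ha, ?_⟩, ?_⟩
  · refine ⟨fun t => (∑ ν ∈ Finset.Icc 1 N, (c ν / V.α' i 0) • (t ^ (ν - 1) - (0 : ℝ) ^ (ν - 1))) +
      (V.α i t - ∑ ν ∈ Finset.Icc 1 N, c ν * t ^ ν) / (V.α' i 0 * t), ?_, ?_⟩
    · refine fun_add_mem (fun_sum_mem fun ν _ => fun_smul_mem _ (pow_mem_logExp_sub _)) ?_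
      refine negl_le_logExp (mem_negl_of_isBigO ?_)
      obtain ⟨C, hC⟩ := hc.bound
      refine IsBigO.of_bound (C / V.α' i 0) ?_
      filter_upwards [hC, self_mem_nhdsWithin] with t ht ht0
      have ht0' : (0 : ℝ) < t := ht0
      rw [norm_div, norm_mul, Real.norm_of_nonneg ha.le, Real.norm_of_nonneg ht0'.le,
        div_le_iff₀ (by positivity)]
      refine ht.trans (le_of_eq ?_)
      rw [norm_pow, norm_pow, Real.norm_of_nonneg ht0'.le]
      field_simp
      ring
    · filter_upwards [self_mem_nhdsWithin] with t ht0
      have ht0' : (0 : ℝ) < t := ht0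
      have e1 : V.α' i 0 * t * ∑ ν ∈ Finset.Icc 1 N, (c ν / V.α' i 0) •
          (t ^ (ν - 1) - (0 : ℝ) ^ (ν - 1)) = (∑ ν ∈ Finset.Icc 1 N, c ν * t ^ ν) - S 0 * t := by
        rw [hS, Finset.mul_sum, Finset.sum_mul, ← Finset.sum_sub_distrib]
        refine Finset.sum_congr rfl fun ν hν => ?_
        obtain ⟨m, rfl⟩ := Nat.exists_eq_add_of_le' (Finset.mem_Icc.1 hν).1
        rw [Nat.add_sub_cancel, smul_eq_mul]
        rcases Nat.eq_zero_or_pos m with rfl | hm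
        · simp
        · rw [zero_pow hm.ne']
          field_simp
          ring
      rw [mul_add, mul_add, mul_one, e1, hS0]
      field_simp
      ring
  · have h1 : (fun t => V.α' i t - S t) ∈ logExp ℝ N 1 :=
      negl_le_logExp (mem_negl_of_isBigO hc')
    have h2 := fun_add_mem h1 hSS
    rw [hS0] at h2
    simpa only [sub_add_sub_cancel] using h2

lemma CondB.curve (hB : V.CondB N) {i : ℕ} (h1 : 1 ≤ i) (hi : i ≤ V.n) :
    CurveExp N (V.α i) (V.α' i 0) := by
  rcases eq_or_lt_of_le hi with rfl | hlt
  · rw [V.α'_top ⟨le_rfl, V.T_pos.le⟩]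
    refine ⟨one_pos, fun _ => 0, fun_zero_mem, ?_⟩
    filter_upwards [V.eventually_mem_Ioc] with t ht
    rw [V.α_top t ⟨ht.1.le, ht.2⟩]
    ring
  · exact (hB.exists_curve (Finset.mem_Ico.2 ⟨h1, hlt⟩)).1

lemma region_eventually_bound {i : ℕ} (hi : i ∈ Finset.Icc 1 V.n) {F : Type*}
    [NormedAddCommGroup F] {g : ℝ × ℝ → F} {M : ℕ}
    (h : g =O[𝓝[V.region i] (0, 0)] fun z : ℝ × ℝ => (z.1 + z.2) ^ M) :
    ∃ C, 0 ≤ C ∧ ∀ᶠ t in 𝓝[>] (0 : ℝ), ∀ s ∈ Icc (V.α (i - 1) t) (V.α i t),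
      ‖g (t, s)‖ ≤ C * t ^ M := by
  have hi' := Finset.mem_Icc.1 hi
  obtain ⟨C, hC0, hC⟩ := h.exists_nonneg
  have hC' := eventually_nhdsWithin_iff.1 hC.bound
  obtain ⟨δ, hδ, hd⟩ := Metric.eventually_nhds_iff.1 hC'
  refine ⟨C * 2 ^ M, by positivity, ?_⟩
  filter_upwards [V.eventually_mem_Ioc, Ioo_mem_nhdsGT hδ] with t ht htδ s hs
  have ht' : t ∈ Icc 0 V.T := ⟨ht.1.le, ht.2⟩
  have hs0 : 0 ≤ s := (V.α_nonneg (by omega) ht').trans hs.1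
  have hst : s ≤ t := hs.2.trans (V.α_le_self hi'.2 ht')
  have h1 := hd (y := (t, s)) (by
    rw [Prod.dist_eq, Real.dist_eq, Real.dist_eq, sub_zero, sub_zero, abs_of_nonneg hs0,
      abs_of_nonneg ht.1.le]
    exact max_lt htδ.2 (hst.trans_lt htδ.2)) ⟨ht', hs⟩
  refine h1.trans ?_
  rw [mul_assoc, ← mul_pow, Real.norm_of_nonneg (pow_nonneg (add_nonneg ht.1.le hs0) _)]
  refine mul_le_mul_of_nonneg_left (pow_le_pow_left₀ (add_nonneg ht.1.le hs0) ?_ _) hC0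
  linarith

lemma zero_mem_region {i : ℕ} (hi : i ∈ Finset.Icc 1 V.n) : ((0 : ℝ), (0 : ℝ)) ∈ V.region i := by
  have h := Finset.mem_Icc.1 hi
  refine ⟨⟨le_rfl, V.T_pos.le⟩, ?_⟩
  simp only [V.α_zero i h.2, V.α_zero (i - 1) (by omega)]
  exact ⟨le_rfl, le_rfl⟩

lemma CondB.kernel_sub_mem (hB : V.CondB N) {i : ℕ} (hi : i ∈ Finset.Icc 1 V.n) {β : ℝ → ℝ}
    (hβ : β ∈ logExp ℝ N 1)
    (hβr : ∀ᶠ t in 𝓝[>] (0 : ℝ), β t ∈ Icc (V.α (i - 1) t) (V.α i t)) :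
    (fun t => V.K i t (β t) - V.K i 0 0) ∈ logExp (E₁ →L[𝕜] E₂) N 1 := by
  obtain ⟨hN, hK, -, -⟩ := hB
  obtain ⟨P, hP, -⟩ := hK i hi
  have h00 : V.K i 0 0 = ∑ ν ∈ Finset.range (N + 1), ∑ μ ∈ Finset.range (N + 1 - ν),
      ((0 : ℝ) ^ ν * (0 : ℝ) ^ μ) • P ν μ := by
    obtain ⟨C, hC⟩ := hP.bound
    -- The estimate holds at the point `(0, 0)` of the region itself, where its right-hand side is
    -- zero; this identifies the constant coefficient as `K_i(0,0)`.
    have := hC.self_of_nhdsWithin (zero_mem_region hi)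
    simp only [add_zero, ne_eq, Nat.add_eq_zero_iff, one_ne_zero, and_false, not_false_eq_true,
      zero_pow, norm_zero, mul_zero, norm_le_zero_iff] at this
    exact sub_eq_zero.1 this
  obtain ⟨C, hC0, hC⟩ := region_eventually_bound hi hP
  have h1 : (fun t => V.K i t (β t) - ∑ ν ∈ Finset.range (N + 1),
      ∑ μ ∈ Finset.range (N + 1 - ν), (t ^ ν * β t ^ μ) • P ν μ) ∈
      logExp (E₁ →L[𝕜] E₂) N 1 := by
    refine negl_le_logExp (mem_negl_of_isBigO (IsBigO.of_bound C ?_))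
    filter_upwards [hC, hβr, Ioo_mem_nhdsGT (show (0 : ℝ) < 1 by norm_num)] with t e1 e2 e3
    refine (e1 _ e2).trans ?_
    rw [Real.norm_of_nonneg (pow_nonneg e3.1.le _)]
    exact mul_le_mul_of_nonneg_left (pow_le_pow_of_le_one e3.1.le e3.2.le (Nat.le_succ N)) hC0
  have h2 : (fun t => ∑ ν ∈ Finset.range (N + 1), ∑ μ ∈ Finset.range (N + 1 - ν),
      (t ^ ν * β t ^ μ - (0 : ℝ) ^ ν * (0 : ℝ) ^ μ) • P ν μ) ∈ logExp (E₁ →L[𝕜] E₂) N 1 := by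
    refine fun_sum_mem fun ν _ => fun_sum_mem fun μ _ => ?_
    have h3 : (fun t => t ^ ν * β t ^ μ - (0 : ℝ) ^ ν * (0 : ℝ) ^ μ) ∈ logExp ℝ N 1 := by
      rcases Nat.eq_zero_or_pos (ν + μ) with h0 | h0
      · obtain ⟨rfl, rfl⟩ := Nat.add_eq_zero_iff.1 h0
        simp only [pow_zero, sub_self]
        exact fun_zero_mem
      · have e1 : (0 : ℝ) ^ ν * (0 : ℝ) ^ μ = 0 := by rw [← pow_add, zero_pow h0.ne']
        simp only [e1, sub_zero]
        have e2 := logExp_mul (pow_mem_logExp (N := N) ν) (logExp_pow hβ μ)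
        exact logExp_anti (by omega) e2
    exact logExp_smul (b := 0) h3 (const_mem_logExp (P ν μ))
  convert fun_add_mem h1 h2 using 2 with t
  rw [h00]
  simp only [sub_smul, Finset.sum_sub_distrib]
  abel

/-- Evaluation of operators at a vector as a real-linear map. -/
def evalAt (v : E₁) : (E₁ →L[𝕜] E₂) →L[ℝ] E₂ where
  toFun L := L v
  map_add' _ _ := rfl
  map_smul' _ _ := rfl
  cont := (ContinuousLinearMap.apply 𝕜 E₂ v).continuous

lemma CondB.α_mem_region (V : Data 𝕜 E₁ E₂) {i : ℕ} (hi : i ∈ Finset.Icc 1 V.n) :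
    (∀ᶠ t in 𝓝[>] (0 : ℝ), V.α i t ∈ Icc (V.α (i - 1) t) (V.α i t)) ∧
      ∀ᶠ t in 𝓝[>] (0 : ℝ), V.α (i - 1) t ∈ Icc (V.α (i - 1) t) (V.α i t) := by
  constructor <;> filter_upwards [V.eventually_mem_Ioc] with t ht
  · exact ⟨V.α_pred_le hi ⟨ht.1.le, ht.2⟩, le_rfl⟩
  · exact ⟨le_rfl, V.α_pred_le hi ⟨ht.1.le, ht.2⟩⟩

lemma CondB.deriv_f_mem (hB : V.CondB N) : V.f' ∈ logExp E₂ N 0 := by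
  obtain ⟨-, -, ⟨c, -, hc⟩, -⟩ := hB
  have h1 := negl_le_logExp (k := 0) (mem_negl_of_isBigO hc)
  have h2 : (fun t : ℝ => ∑ ν ∈ Finset.Icc 1 N, ((ν : ℝ) * t ^ (ν - 1)) • c ν) ∈
      logExp E₂ N 0 := by
    refine fun_sum_mem fun ν _ => ?_
    have h3 : (fun t : ℝ => (ν : ℝ) • t ^ (ν - 1)) ∈ logExp ℝ N 0 :=
      fun_smul_mem _ (logExp_anti (Nat.zero_le _) (pow_mem_logExp _))
    exact logExp_smul (b := 0) h3 (const_mem_logExp (c ν))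
  simpa only [sub_add_cancel] using fun_add_mem h1 h2

lemma integral_pow_mul_log_pow {m k : ℕ} {Q : ℝ → ℝ} (hQ : Q ∈ logPow ℝ {m + 1})
    (hd : ∀ s : ℝ, 0 < s → HasDerivAt Q (s ^ m * Real.log s ^ k) s) {a b : ℝ} (ha : 0 ≤ a)
    (hab : a ≤ b) : IntervalIntegrable (fun s : ℝ => s ^ m * Real.log s ^ k) volume a b ∧
      ∫ s in a..b, s ^ m * Real.log s ^ k = Q b - Q a := by
  have hadm : (fun s : ℝ => (s ^ m * Real.log s ^ k) • (1 : ℝ)) ∈ admissible ℝ ℝ b :=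
    logPow_admissible (mem_logPow (mem_singleton m) k (1 : ℝ)) b
  simp only [smul_eq_mul, mul_one] at hadm
  have hint : IntervalIntegrable (fun s : ℝ => s ^ m * Real.log s ^ k) volume a b :=
    (intervalIntegrable_iff_integrableOn_Ioc_of_le hab).2
      (hadm.2.mono_set (Ioc_subset_Ioc_left ha))
  refine ⟨hint, intervalIntegral.integral_eq_sub_of_hasDerivAt_of_le hab ?_ ?_ hint⟩
  · have hQ' : Q ∈ logPow ℝ (Ici (m + 1)) := logPow_mono (by simp) hQ
    exact (logPow_continuousOn_Ici (Nat.le_add_left 1 m) hQ').2.mono fun s hs => ha.trans hs.1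
  · exact fun s hs => hd s (ha.trans_lt hs.1)

/-- Integration raises the order by one, so these terms never enter the leading operator. The
derivative kernel is replaced by its polynomial, whose integrals are explicit; the error is at most
`C t^N ∫ ‖x‖`, hence negligible. -/
lemma CondB.integral_mem [CompleteSpace E₂] (hB : V.CondB N) {i : ℕ}
    (hi : i ∈ Finset.Icc 1 V.n) (j k : ℕ) (v : E₁) :
    (fun t => ∫ s in (V.α (i - 1) t)..(V.α i t),
      V.K' i t s ((s ^ j * Real.log s ^ k) • v)) ∈ logExp E₂ N (j + 1) := by
  have hi' := Finset.mem_Icc.1 hi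
  have hN := hB.1
  obtain ⟨P, -, hP⟩ := hB.2.1 i hi
  obtain ⟨C, hC0, hC⟩ := region_eventually_bound hi hP
  choose Q hQ hQd using fun μ : ℕ => exists_antideriv_pow_mul_log_pow (μ + j) k
  set x : ℝ → E₁ := fun s => (s ^ j * Real.log s ^ k) • v with hx
  have hxa : x ∈ admissible 𝕜 E₁ V.T :=
    logPow_admissible (mem_logPow (mem_singleton j) k v) V.T
  have hQm : ∀ μ e, e ≤ V.n → (fun t => Q μ (V.α e t)) ∈ logExp ℝ N (j + 1) := by
    intro μ e he
    rcases Nat.eq_zero_or_pos e with rfl | he1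
    · refine mem_logExp_congr (g := fun _ => 0) fun_zero_mem ?_
      filter_upwards [V.eventually_mem_Ioc] with t ht
      have hQ' : Q μ ∈ logPow ℝ (Ici (μ + j + 1)) := logPow_mono (by simp) (hQ μ)
      rw [V.α_bot t ⟨ht.1.le, ht.2⟩, (logPow_continuousOn_Ici (by omega) hQ').1]
    · exact logExp_anti (by omega) (logPow_mem_curve hN (hQ μ) (hB.curve he1 he))
  set main : ℝ → E₂ := fun t => ∑ ν ∈ Finset.range (N + 1), ∑ μ ∈ Finset.range (N + 1 - ν),
    ((ν : ℝ) • (t ^ (ν - 1) * (Q μ (V.α i t) - Q μ (V.α (i - 1) t)))) • P ν μ v with hmain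
  have hmainm : main ∈ logExp E₂ N (j + 1) := by
    refine fun_sum_mem fun ν _ => fun_sum_mem fun μ _ => ?_
    have h1 := logExp_mul (pow_mem_logExp (N := N) (ν - 1))
      (fun_sub_mem (hQm μ i hi'.2) (hQm μ (i - 1) (by omega)))
    have h2 := fun_smul_mem (ν : ℝ) (logExp_anti (show j + 1 ≤ ν - 1 + (j + 1) by omega) h1)
    exact logExp_smul (b := 0) h2 (const_mem_logExp (P ν μ v))
  set pol : ℝ → ℝ → E₁ →L[𝕜] E₂ := fun t s => ∑ ν ∈ Finset.range (N + 1),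
    ∑ μ ∈ Finset.range (N + 1 - ν), ((ν : ℝ) * t ^ (ν - 1) * s ^ μ) • P ν μ with hpol
  have hpolx : ∀ t s, pol t s (x s) = ∑ ν ∈ Finset.range (N + 1),
      ∑ μ ∈ Finset.range (N + 1 - ν), ((ν : ℝ) * t ^ (ν - 1)) •
        ((s ^ (μ + j) * Real.log s ^ k) • P ν μ v) := by
    intro t s
    simp only [hpol, hx, _root_.sum_apply, _root_.smul_apply, clm_map_real_smul, smul_smul]
    refine Finset.sum_congr rfl fun ν _ => Finset.sum_congr rfl fun μ _ => ?_
    congr 1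
    ring
  have hmaineq : ∀ t ∈ Ioc 0 V.T,
      IntervalIntegrable (fun s => pol t s (x s)) volume (V.α (i - 1) t) (V.α i t) ∧
      ∫ s in (V.α (i - 1) t)..(V.α i t), pol t s (x s) = main t := by
    intro t ht
    have ht' : t ∈ Icc 0 V.T := ⟨ht.1.le, ht.2⟩
    have hle := V.α_pred_le hi ht'
    have h0 := V.α_nonneg (i := i - 1) (by omega) ht'
    have hq := fun μ => integral_pow_mul_log_pow (hQ μ) (hQd μ) h0 hle
    have hii : ∀ ν μ : ℕ, IntervalIntegrable (fun s : ℝ => ((ν : ℝ) * t ^ (ν - 1)) •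
        ((s ^ (μ + j) * Real.log s ^ k) • P ν μ v)) volume (V.α (i - 1) t) (V.α i t) :=
      fun ν μ => by
        have h1 := (intervalIntegrable_iff_integrableOn_Ioc_of_le hle).1 (hq μ).1
        exact (intervalIntegrable_iff_integrableOn_Ioc_of_le hle).2
          ((Integrable.smul_const h1 (P ν μ v)).smul ((ν : ℝ) * t ^ (ν - 1)))
    simp only [hpolx]
    have hii2 : ∀ ν : ℕ, IntervalIntegrable (fun s : ℝ => ∑ μ ∈ Finset.range (N + 1 - ν),
        ((ν : ℝ) * t ^ (ν - 1)) • ((s ^ (μ + j) * Real.log s ^ k) • P ν μ v)) volume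
        (V.α (i - 1) t) (V.α i t) := by
      exact fun ν => (intervalIntegrable_iff_integrableOn_Ioc_of_le hle).2
        (integrable_finsetSum _ fun μ _ =>
          (intervalIntegrable_iff_integrableOn_Ioc_of_le hle).1 (hii ν μ))
    constructor
    · exact (intervalIntegrable_iff_integrableOn_Ioc_of_le hle).2
        (integrable_finsetSum _ fun ν _ =>
          (intervalIntegrable_iff_integrableOn_Ioc_of_le hle).1 (hii2 ν))
    · rw [intervalIntegral.integral_finsetSum fun ν _ => hii2 ν, hmain]
      refine Finset.sum_congr rfl fun ν _ => ?_
      rw [intervalIntegral.integral_finsetSum fun μ _ => hii ν μ]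
      refine Finset.sum_congr rfl fun μ _ => ?_
      rw [intervalIntegral.integral_smul, intervalIntegral.integral_smul_const, (hq μ).2,
        smul_smul, smul_eq_mul, mul_assoc]
  have herr : (fun t => (∫ s in (V.α (i - 1) t)..(V.α i t), V.K' i t s (x s)) - main t) ∈
      negl E₂ N := by
    refine mem_negl_of_isBigO (IsBigO.of_bound (C * ∫ s in Ioc 0 V.T, ‖x s‖) ?_)
    filter_upwards [hC, V.eventually_mem_Ioc] with t e1 ht
    have ht' : t ∈ Icc 0 V.T := ⟨ht.1.le, ht.2⟩
    have hle := V.α_pred_le hi ht'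
    have htN : 0 ≤ t ^ N := pow_nonneg ht.1.le _
    have hii := intervalIntegrable_kernel_apply le_rfl hi (V.K'_cont i hi) hxa ht' le_rfl hle le_rfl
    rw [← (hmaineq t ht).2, ← intervalIntegral.integral_sub hii (hmaineq t ht).1]
    have hxint := (hxa.2.mono_set (Ioc_α_subset le_rfl hi ht')).norm
    refine (intervalIntegral.norm_integral_le_of_norm_le hle (g := fun s => C * t ^ N * ‖x s‖)
      (Eventually.of_forall fun s hs => ?_) ?_).trans ?_
    · rw [← _root_.sub_apply]
      exact (V.K' i t s - pol t s).le_of_opNorm_le (e1 s ⟨hs.1.le, hs.2⟩) _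
    · exact (intervalIntegrable_iff_integrableOn_Ioc_of_le hle).2 (hxint.const_mul _)
    · rw [intervalIntegral.integral_const_mul, intervalIntegral.integral_of_le hle,
        Real.norm_of_nonneg htN]
      have hmono := setIntegral_mono_set hxa.2.norm
        (ae_restrict_of_ae (Eventually.of_forall fun s => norm_nonneg (x s)))
        (LE.le.eventuallyLE (Ioc_α_subset le_rfl hi ht'))
      calc C * t ^ N * ∫ s in Ioc (V.α (i - 1) t) (V.α i t), ‖x s‖
          ≤ C * t ^ N * ∫ s in Ioc 0 V.T, ‖x s‖ := by gcongr
        _ = _ := by ring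
  simpa only [sub_add_cancel] using fun_add_mem (negl_le_logExp herr) hmainm

/-- The leading term of the differentiated operator on a logarithmic monomial. -/
lemma CondB.diffOp_monomial [CompleteSpace E₂] (hB : V.CondB N) (j k : ℕ) (v : E₁) :
    (fun t => V.diffOp (fun s => (s ^ j * Real.log s ^ k) • v) t -
      t ^ j • V.shiftOp j (fun z => z ^ k • v) (Real.log t)) ∈ logExp E₂ N (j + 1) := by
  have hN := hB.1
  have hmon : (fun t : ℝ => t ^ j * Real.log t ^ k) ∈ logExp ℝ N j := by
    have := logExp_mul (pow_mem_logExp (N := N) j) (logExp_pow (log_mem_logExp (N := N)) k)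
    simpa using this
  have hlast : (fun t => (t ^ j * Real.log t ^ k) • (V.K V.n t t - V.K V.n 0 0) v) ∈
      logExp E₂ N (j + 1) := by
    have hn : V.n ∈ Finset.Icc 1 V.n := Finset.mem_Icc.2 ⟨V.one_le_n, le_rfl⟩
    have h1 := hB.kernel_sub_mem hn (hB.curve V.one_le_n le_rfl).mem (α_mem_region V hn).1
    have h2 := logExp_clm (evalAt v) h1
    refine mem_logExp_congr (logExp_smul hmon h2) ?_
    filter_upwards [V.eventually_mem_Ioc] with t ht
    simp only [V.α_top t ⟨ht.1.le, ht.2⟩]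
    rfl
  have hmid : ∀ i ∈ Finset.Ico 1 V.n, (fun t => (V.α' i t * (V.α i t ^ j * Real.log (V.α i t) ^ k)) •
      (V.K i t (V.α i t) - V.K (i + 1) t (V.α i t)) v -
      (V.α' i 0 * ((V.α' i 0 * t) ^ j * (Real.log t + Real.log (V.α' i 0)) ^ k)) •
        (V.K i 0 0 - V.K (i + 1) 0 0) v) ∈ logExp E₂ N (j + 1) := by
    intro i hi
    have h := Finset.mem_Ico.1 hi
    have hi1 : i ∈ Finset.Icc 1 V.n := Finset.mem_Icc.2 ⟨h.1, h.2.le⟩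
    have hi2 : i + 1 ∈ Finset.Icc 1 V.n := Finset.mem_Icc.2 ⟨by omega, h.2⟩
    obtain ⟨hcur, hder⟩ := hB.exists_curve hi
    have hder0 : V.α' i ∈ logExp ℝ N 0 := by
      have := fun_add_mem (logExp_anti (Nat.zero_le 1) hder) (const_mem_logExp (V.α' i 0))
      simpa only [sub_add_cancel] using this
    obtain ⟨c1, c2⟩ := hcur.pow_mul_log_pow_mem hN j k
    have hjump : (fun t => (V.K i t (V.α i t) - V.K (i + 1) t (V.α i t)) v -
        (V.K i 0 0 - V.K (i + 1) 0 0) v) ∈ logExp E₂ N 1 := by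
      have k1 := hB.kernel_sub_mem hi1 hcur.mem (α_mem_region V hi1).1
      have k2 := hB.kernel_sub_mem hi2 hcur.mem (α_mem_region V hi2).2
      have k3 := logExp_clm (evalAt v) (fun_sub_mem k1 k2)
      convert k3 using 2 with t
      have e : ∀ L : E₁ →L[𝕜] E₂, evalAt v L = L v := fun _ => rfl
      simp only [e, _root_.sub_apply]
      abel
    have hmon' : (fun t : ℝ => (V.α' i 0 * t) ^ j * (Real.log t + Real.log (V.α' i 0)) ^ k) ∈
        logExp ℝ N j := by
      have := fun_sub_mem c1 (logExp_anti (Nat.le_succ j) c2)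
      simpa only [sub_sub_cancel] using this
    have h3 := logExp_smul_sub (a := 0) hder0 (by simpa using hder) hmon' c2
    have h4 := logExp_smul_sub (b := 0) (logExp_mul hder0 c1) h3
      (const_mem_logExp ((V.K i 0 0 - V.K (i + 1) 0 0) v))
      (h := fun t => (V.K i t (V.α i t) - V.K (i + 1) t (V.α i t)) v) hjump
    simpa only [smul_eq_mul, zero_add, add_zero] using h4
  have hint := fun_sum_mem (s := Finset.Icc 1 V.n) fun i hi => hB.integral_mem hi j k v
  -- Three deviations, each of order `j + 1`: freezing `K_n` at the origin, linearizing the curves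
  -- and freezing the jumps, and the integral terms.
  convert fun_add_mem (fun_add_mem hlast (fun_sum_mem hmid)) hint using 2 with t
  simp only [diffOp, shiftOp, clm_map_real_smul, _root_.sub_apply, smul_sub, smul_smul, smul_add,
    Finset.sum_sub_distrib, Finset.smul_sum]
  have e1 : ∀ i w, (t ^ j * (V.α' i 0 ^ (1 + j) * (Real.log t + Real.log (V.α' i 0)) ^ k)) • w =
      (V.α' i 0 * ((V.α' i 0 * t) ^ j * (Real.log t + Real.log (V.α' i 0)) ^ k)) • (w : E₂) := by
    intro i w
    congr 1
    rw [mul_pow, pow_add, pow_one]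
    ring
  simp only [e1]
  abel

end Data

end Expansion

/-! ### Formal solvability and the range of weights -/

section Solutions

variable {𝕜 E₁ E₂ : Type*} [RCLike 𝕜]
  [NormedAddCommGroup E₁] [NormedSpace 𝕜 E₁] [NormedSpace ℝ E₁] [IsScalarTower ℝ 𝕜 E₁]
  [NormedAddCommGroup E₂] [NormedSpace 𝕜 E₂] [NormedSpace ℝ E₂] [IsScalarTower ℝ 𝕜 E₂]

namespace Data

variable {V : Data 𝕜 E₁ E₂} {N : ℕ}

lemma shiftOp_sum {ι : Type*} (s : Finset ι) (j : ℕ) (x : ι → ℝ → E₁) (z : ℝ) :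
    V.shiftOp j (fun z => ∑ q ∈ s, x q z) z = ∑ q ∈ s, V.shiftOp j (x q) z := by
  simp only [shiftOp, map_sum, Finset.smul_sum, Finset.sum_add_distrib]
  rw [Finset.sum_comm]

/-- The leading term of the differentiated operator on a logarithmic polynomial. -/
lemma CondB.diffOp_chainFun [CompleteSpace E₂] (hB : V.CondB N) (j : ℕ) (ξ : ℕ → E₁) (D : ℕ) :
    (fun t => V.diffOp (fun s => s ^ j • chainFun ξ D (Real.log s)) t -
      t ^ j • chainFun (opConv (V.charCoeff j) ξ) D (Real.log t)) ∈ logExp E₂ N (j + 1) := by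
  set v : ℕ × ℕ → E₁ := fun q => (1 / (q.1.factorial : ℝ)) • ξ q.2 with hv
  set g : ℕ × ℕ → ℝ → E₁ := fun q s => (s ^ j * Real.log s ^ q.1) • v q with hg
  have hchain : chainFun ξ D = fun z : ℝ => ∑ q ∈ Finset.HasAntidiagonal.antidiagonal D,
      z ^ q.1 • v q := by
    funext z
    refine Finset.sum_congr rfl fun q _ => ?_
    rw [hv, smul_smul, mul_one_div]
  have hsum : (fun s : ℝ => s ^ j • chainFun ξ D (Real.log s)) =
      ∑ q ∈ Finset.HasAntidiagonal.antidiagonal D, g q := by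
    funext s
    rw [hchain, Finset.sum_apply, Finset.smul_sum]
    exact Finset.sum_congr rfl fun q _ => smul_smul _ _ _
  refine mem_logExp_congr (fun_sum_mem (s := Finset.HasAntidiagonal.antidiagonal D)
    fun q _ => hB.diffOp_monomial j q.1 (v q)) ?_
  filter_upwards [V.eventually_mem_Ioc] with t ht
  rw [hsum, diffOp_sum le_rfl _
    (fun q _ => logPow_admissible (mem_logPow (mem_singleton j) q.1 (v q)) V.T) ⟨ht.1.le, ht.2⟩,
    ← V.shiftOp_chainFun, hchain, shiftOp_sum, Finset.smul_sum, ← Finset.sum_sub_distrib]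

lemma diffOp_zero (t : ℝ) : V.diffOp 0 t = 0 := by
  simp [diffOp]

/-- Removal of the terms of orders `k, …, l - 1` of a right-hand side by a log-power sum. -/
lemma CondB.exists_logPow_correction [CompleteSpace E₂] (hB : V.CondB N) {k l : ℕ} (hkl : k ≤ l)
    (hsol : ∀ j, k ≤ j → j < l → ∃ P, ∀ y : E₂, ∃ ξ : ℕ → E₁, ∀ m ≤ P,
      opConv (V.charCoeff j) ξ m = if m = P then y else 0)
    {R : ℝ → E₂} (hR : R ∈ logExp E₂ N k) :
    ∃ y ∈ logPow E₁ (Ico k l), (fun t => R t + V.diffOp y t) ∈ logExp E₂ N l := by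
  induction l, hkl using Nat.le_induction with
  | base => exact ⟨0, Submodule.zero_mem _, by simpa only [diffOp_zero, add_zero] using hR⟩
  | succ l hkl ih =>
    obtain ⟨y, hy, hy'⟩ := ih fun j h1 h2 => hsol j h1 (h2.trans (Nat.lt_succ_self l))
    obtain ⟨η, D, hη⟩ := logExp_leading hy'
    obtain ⟨P, hP⟩ := hsol l hkl (Nat.lt_succ_self l)
    -- Solves `B(l + λ) ξ(λ) = -λ^P η(λ)` up to order `P + D`, so the coefficient at `P + D` cancels
    -- the leading polynomial of order `D`. At singular orders this may raise the degree in `ln t`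
    -- by `P`.
    obtain ⟨ξ, hξ⟩ := exists_opConv_eq (V.charCoeff l) P hP ((-1 : ℝ) • η) D
    have hz := chainFun_mem_logPow l ξ (P + D)
    refine ⟨y + fun t => t ^ l • chainFun ξ (P + D) (Real.log t), Submodule.add_mem _
      (logPow_mono (Ico_subset_Ico_right (Nat.le_succ l)) hy)
      (logPow_mono (singleton_subset_iff.2 (mem_Ico.2 ⟨hkl, Nat.lt_succ_self l⟩)) hz), ?_⟩
    refine mem_logExp_congr (fun_add_mem hη (hB.diffOp_chainFun l ξ (P + D))) ?_
    filter_upwards [V.eventually_mem_Ioc] with t ht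
    rw [diffOp_add le_rfl (logPow_admissible hy V.T) (logPow_admissible hz V.T) ⟨ht.1.le, ht.2⟩,
      chainFun_congr hξ, chainFun_seqShift, chainFun_smul, neg_one_smul, smul_neg]
    abel

/-- At a singular point `P` is the greatest chain length; at a regular point `P = 0` and a constant
sequence built from the inverse suffices. -/
lemma CondC1.exists_opConv_eq_single {Nstar : ℕ} {J : Finset ℕ} {r : ℕ → ℕ}
    {p : (j : ℕ) → Fin (r j) → ℕ} [CompleteSpace E₁] [CompleteSpace E₂]
    (hC : V.CondC1 Nstar J r p) {j : ℕ} (hj : j ≤ Nstar) :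
    ∃ P, ∀ y : E₂, ∃ ξ : ℕ → E₁, ∀ m ≤ P,
      opConv (V.charCoeff j) ξ m = if m = P then y else 0 := by
  by_cases hjJ : j ∈ J
  · obtain ⟨-, hs, hJ⟩ := hC.1 j hjJ
    obtain ⟨ξ, -, -, hξ, hsurj⟩ := hJ.exists_chains hs (V.charCoeff j)
      fun q => V.iteratedDeriv_charOp q j
    exact ⟨_, VolterraFirstKind.exists_opConv_eq_single _ (p j) ξ hξ hsurj⟩
  · obtain ⟨e, he⟩ := hC.2 j hj hjJ
    refine ⟨0, fun y => ⟨fun _ => e.symm y, fun m hm => ?_⟩⟩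
    obtain rfl := Nat.le_zero.1 hm
    have h0 : opConv (V.charCoeff j) (fun _ => e.symm y) 0 = V.charCoeff j 0 (e.symm y) := by
      simp [opConv]
    rw [h0, V.charCoeff_zero, ← he, if_pos rfl]
    exact e.apply_symm_apply y

/-- Continuity extends the bound to the closed interval; the value at `0` is what controls `B(N*)`.
-/
lemma CondD.exists_bound {ε T' : ℝ} {Nstar : ℕ} [CompleteSpace E₁] (hD : V.CondD ε T' Nstar) :
    ∃ q < 1, ∀ t ∈ Icc 0 T', ε ^ Nstar * ∑ i ∈ Finset.Ico 1 V.n, |V.α' i t| *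
      ‖(V.K V.n t t).inverse ∘L (V.K i t (V.α i t) - V.K (i + 1) t (V.α i t))‖ ≤ q := by
  obtain ⟨-, -, hT0, hT, -, -, hinv, q, hq, hb⟩ := hD
  set S : ℝ → ℝ := fun t => ∑ i ∈ Finset.Ico 1 V.n, |V.α' i t| *
    ‖(V.K V.n t t).inverse ∘L (V.K i t (V.α i t) - V.K (i + 1) t (V.α i t))‖ with hS
  have hSc : ContinuousOn S (Icc 0 T') := by
    refine continuousOn_finsetSum _ fun i hi => ?_
    have h := Finset.mem_Ico.1 hi
    exact (((V.α'_cont i h.2.le).mono (Icc_subset_Icc_right hT)).abs).mul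
      (((continuousOn_inverse_diag hT hinv).clm_comp (continuousOn_jump hT hi)).norm)
  refine ⟨q, hq, fun t ht => ?_⟩
  refine le_on_closure (s := Ioo 0 T') hb ?_ continuousOn_const ?_
  · rw [closure_Ioo hT0.ne]
    exact continuousOn_const.mul hSc
  · rwa [closure_Ioo hT0.ne]

/-- Condition (D) gives the contraction condition for all weights `t ^ γ` with `γ` at least
slightly below `N*`. -/
lemma CondD.exists_weight {ε T' : ℝ} {Nstar : ℕ} [CompleteSpace E₁] (hD : V.CondD ε T' Nstar) :
    ∃ q < 1, ∃ η > 0, η ≤ 1 / 2 ∧ ∀ γ : ℝ, 0 ≤ γ → Nstar - η ≤ γ → ∀ t ∈ Ioc 0 T',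
      ∑ i ∈ Finset.Ico 1 V.n, |V.α' i t| *
        ‖(V.K V.n t t).inverse ∘L (V.K i t (V.α i t) - V.K (i + 1) t (V.α i t))‖ *
          (V.α i t / t) ^ γ ≤ q := by
  obtain ⟨q, hq, hSq⟩ := hD.exists_bound
  obtain ⟨hε, hε1, -, hT, -, hα, -⟩ := hD
  -- The strict inequality `q < 1` leaves room for a factor `ε^{-η}` with small `η`, that is, for
  -- weights slightly below `N*`.
  have hlim : Tendsto (fun η : ℝ => q * ε ^ (-η)) (𝓝[>] 0) (𝓝 q) := by
    have h1 : ContinuousAt (fun η : ℝ => q * ε ^ (-η)) 0 := by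
      refine continuousAt_const.mul ?_
      exact (Real.continuousAt_const_rpow hε.ne').comp continuous_neg.continuousAt
    have h2 := h1.tendsto
    simp only [neg_zero, Real.rpow_zero, mul_one] at h2
    exact h2.mono_left nhdsWithin_le_nhds
  obtain ⟨η, hηq, hη⟩ := ((hlim.eventually_lt_const hq).and
    (Ioc_mem_nhdsGT (show (0 : ℝ) < 1 / 2 by norm_num))).exists
  refine ⟨_, hηq, η, hη.1, hη.2, fun γ hγ0 hγ t ht => ?_⟩
  have ht' : t ∈ Icc 0 T' := ⟨ht.1.le, ht.2⟩
  have hstep : ∀ i ∈ Finset.Ico 1 V.n, (V.α i t / t) ^ γ ≤ ε ^ (Nstar : ℕ) * ε ^ (-η) := by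
    intro i hi
    have h := Finset.mem_Ico.1 hi
    have hpos : 0 < V.α i t := V.α_pos h.1 h.2.le ⟨ht.1, ht.2.trans hT⟩
    have hd : 0 < V.α i t / t := div_pos hpos ht.1
    rw [← Real.rpow_natCast, ← Real.rpow_add hε, ← sub_eq_add_neg]
    exact (Real.rpow_le_rpow hd.le (hα i hi t ht) hγ0).trans
      (Real.rpow_le_rpow_of_exponent_ge hε hε1.le hγ)
  calc ∑ i ∈ Finset.Ico 1 V.n, |V.α' i t| *
        ‖(V.K V.n t t).inverse ∘L (V.K i t (V.α i t) - V.K (i + 1) t (V.α i t))‖ *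
          (V.α i t / t) ^ γ
      ≤ ∑ i ∈ Finset.Ico 1 V.n, |V.α' i t| *
        ‖(V.K V.n t t).inverse ∘L (V.K i t (V.α i t) - V.K (i + 1) t (V.α i t))‖ *
          (ε ^ Nstar * ε ^ (-η)) :=
        Finset.sum_le_sum fun i hi => mul_le_mul_of_nonneg_left (hstep i hi) (by positivity)
    _ = (ε ^ Nstar * ∑ i ∈ Finset.Ico 1 V.n, |V.α' i t| *
        ‖(V.K V.n t t).inverse ∘L (V.K i t (V.α i t) - V.K (i + 1) t (V.α i t))‖) *
          ε ^ (-η) := by rw [← Finset.sum_mul]; ring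
    _ ≤ q * ε ^ (-η) :=
        mul_le_mul_of_nonneg_right (hSq t ht') (Real.rpow_nonneg hε.le _)

end Data

end Solutions

/-! ### Independence through leading terms -/

section Independence

lemma chainFun_sum_smul {𝕜 E ι : Type*} [RCLike 𝕜] [NormedAddCommGroup E] [NormedSpace 𝕜 E]
    [NormedSpace ℝ E] [IsScalarTower ℝ 𝕜 E] (s : Finset ι) (c : ι → 𝕜) (ξ : ι → ℕ → E) (D : ℕ)
    (z : ℝ) : chainFun (fun m => ∑ i ∈ s, c i • ξ i m) D z = ∑ i ∈ s, c i • chainFun (ξ i) D z := by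
  have : SMulCommClass ℝ 𝕜 E := IsScalarTower.to_smulCommClass
  simp only [chainFun, Finset.smul_sum]
  rw [Finset.sum_comm]
  exact Finset.sum_congr rfl fun i _ => Finset.sum_congr rfl fun q _ => smul_comm _ _ _

/-- Functions with leading terms `t ^ j • chainFun (ξ j i) l (ln t)` are linearly independent. -/
lemma eq_zero_of_sum_smul_eventually_eq_zero {𝕜 E : Type*} [RCLike 𝕜] [NormedAddCommGroup E]
    [NormedSpace 𝕜 E] [NormedSpace ℝ E] [IsScalarTower ℝ 𝕜 E] {J : Finset ℕ} {r : ℕ → ℕ}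
    {p : (j : ℕ) → Fin (r j) → ℕ} {ξ : (j : ℕ) → Fin (r j) → ℕ → E}
    (hξ : ∀ j ∈ J, LinearIndependent 𝕜 fun i => ξ j i 0)
    {x : (j : ℕ) → (i : Fin (r j)) → Fin (p j i) → ℝ → E}
    (hx : ∀ j ∈ J, ∀ i l, (fun t => x j i l t - t ^ j • chainFun (ξ j i) l (Real.log t))
      =O[𝓝[>] 0] fun t : ℝ => t ^ ((j : ℝ) + 1 / 2))
    {c : (j : ℕ) → (i : Fin (r j)) → Fin (p j i) → 𝕜}
    (h : ∀ᶠ t in 𝓝[>] (0 : ℝ), ∑ j ∈ J, ∑ i, ∑ l, c j i l • x j i l t = 0) :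
    ∀ j ∈ J, ∀ i l, c j i l = 0 := by
  intro j
  induction j using Nat.strong_induction_on with
  | _ j ih =>
  intro hj
  set X : ℕ → ℝ → E := fun j t => ∑ i, ∑ l, c j i l • x j i l t with hX
  set S : ℝ → E := fun z => ∑ i, ∑ l : Fin (p j i), c j i l • chainFun (ξ j i) l z with hS
  have h1 : (fun t => X j t - t ^ j • S (Real.log t)) =O[𝓝[>] 0]
      fun t : ℝ => t ^ ((j : ℝ) + 1 / 2) := by
    have hcomm : SMulCommClass ℝ 𝕜 E := IsScalarTower.to_smulCommClass
    have e : (fun t => X j t - t ^ j • S (Real.log t)) = fun t => ∑ i, ∑ l, c j i l •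
        (x j i l t - t ^ j • chainFun (ξ j i) l (Real.log t)) := by
      funext t
      simp only [hX, hS, Finset.smul_sum, smul_sub, Finset.sum_sub_distrib]
      congr 1
      exact Finset.sum_congr rfl fun i _ => Finset.sum_congr rfl fun l _ => smul_comm _ _ _
    rw [e]
    exact IsBigO.fun_sum fun i _ => IsBigO.fun_sum fun l _ => (hx j hj i l).const_smul_left (c j i l)
  -- Exponents below `j` have zero coefficients by induction, and larger ones are of higher order.
  -- Thus the polynomial `S` in `ln t` at exponent `j` must tend to zero.
  have h2 : ∀ k ∈ J.erase j, X k =O[𝓝[>] 0] fun t : ℝ => t ^ ((j : ℝ) + 1 / 2) := by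
    intro k hk
    obtain ⟨hkj, hk⟩ := Finset.mem_erase.1 hk
    refine IsBigO.fun_sum fun i _ => IsBigO.fun_sum fun l _ => ?_
    rcases lt_or_gt_of_ne hkj with hlt | hlt
    · simp only [ih k hlt hk i l, zero_smul]
      exact isBigO_zero _ _
    · refine IsBigO.const_smul_left ?_ _
      have hle : (j : ℝ) + 1 ≤ k := by exact_mod_cast hlt
      have e1 := (hx k hk i l).trans (isBigO_rpow_rpow_of_le (b := (j : ℝ) + 1 / 2) (by linarith))
      have e2 := (logPow_isBigO (k := k) (logPow_mono (by simp) (chainFun_mem_logPow k (ξ k i) l))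
        (show (0 : ℝ) < 1 / 2 by norm_num)).trans
        (isBigO_rpow_rpow_of_le (b := (j : ℝ) + 1 / 2) (by linarith))
      simpa only [sub_add_cancel] using e1.add e2
  have h3 : (fun t : ℝ => t ^ j • S (Real.log t)) =O[𝓝[>] 0]
      fun t : ℝ => t ^ ((j : ℝ) + 1 / 2) := by
    refine ((IsBigO.fun_sum h2).add h1).neg_left.congr' ?_ EventuallyEq.rfl
    filter_upwards [h] with t ht
    have e : X j t + ∑ k ∈ J.erase j, X k t = 0 := by
      rw [Finset.add_sum_erase J (fun k => X k t) hj]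
      exact ht
    rw [eq_neg_of_add_eq_zero_left e]
    abel
  have h4 : Tendsto (fun t => S (Real.log t)) (𝓝[>] 0) (𝓝 0) := by
    have e1 : (fun t => S (Real.log t)) =O[𝓝[>] 0] fun t : ℝ => t ^ (1 / 2 : ℝ) := by
      obtain ⟨C, hC⟩ := h3.bound
      refine IsBigO.of_bound C ?_
      filter_upwards [hC, self_mem_nhdsWithin] with t ht ht0
      have ht0' : (0 : ℝ) < t := ht0
      have hpos : 0 < t ^ j := pow_pos ht0' j
      rw [Real.rpow_add ht0', Real.rpow_natCast, norm_smul, norm_mul,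
        Real.norm_of_nonneg hpos.le, mul_left_comm] at ht
      exact le_of_mul_le_mul_left ht hpos
    refine e1.trans_tendsto ?_
    have e2 := (Real.continuousAt_rpow_const 0 (1 / 2 : ℝ) (Or.inr (by norm_num))).tendsto
    rw [Real.zero_rpow (by norm_num)] at e2
    exact e2.mono_left nhdsWithin_le_nhds
  set D := Finset.univ.sup (p j) with hDdef
  have hpD : ∀ i, p j i ≤ D := fun i => Finset.le_sup (Finset.mem_univ i)
  -- Truncations at different positions `l` are lifted to one order `D` by shifts `D - l`, so the
  -- coefficients of `S` form the triangular system.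
  have hSchain : S = chainFun (fun m => ∑ i, ∑ l : Fin (p j i),
      c j i l • seqShift (D - l) (ξ j i) m) D := by
    funext z
    have e1 := chainFun_sum_smul Finset.univ (fun _ => (1 : 𝕜))
      (fun i m => ∑ l : Fin (p j i), c j i l • seqShift (D - l) (ξ j i) m) D z
    simp only [one_smul] at e1
    rw [e1]
    refine Finset.sum_congr rfl fun i _ => ?_
    rw [chainFun_sum_smul]
    refine Finset.sum_congr rfl fun l _ => ?_
    have hl : D = D - l + l := (Nat.sub_add_cancel (l.2.le.trans (hpD i))).symm
    conv_rhs => rw [hl]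
    rw [Nat.sub_add_cancel (l.2.le.trans (hpD i)), ← chainFun_seqShift (ξ j i) (D - l) l, ← hl]
  rw [hSchain] at h4
  have h5 := linearIndependent_seqShift (p j) (ξ j) (hξ j hj) (c j) D
    (fun i => (hpD i).trans (Nat.le_succ D)) (chainFun_log_eq_zero h4)
  exact fun i l => congrFun (congrFun h5 i) l

end Independence

/-! ### Passage to explicit coefficients -/

section LogPowerSum

variable {𝕜 E : Type*} [RCLike 𝕜] [NormedAddCommGroup E] [NormedSpace 𝕜 E] [NormedSpace ℝ E]
  [IsScalarTower ℝ 𝕜 E]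

lemma logPowerSum_add (M d : ℕ) (a b : ℕ → ℕ → E) (t : ℝ) :
    logPowerSum M d (a + b) t = logPowerSum M d a t + logPowerSum M d b t := by
  simp only [logPowerSum, Pi.add_apply, smul_add, Finset.sum_add_distrib]

lemma logPowerSum_smul (M d : ℕ) (c : 𝕜) (a : ℕ → ℕ → E) (t : ℝ) :
    logPowerSum M d (c • a) t = c • logPowerSum M d a t := by
  have : SMulCommClass ℝ 𝕜 E := IsScalarTower.to_smulCommClass
  simp only [logPowerSum, Pi.smul_apply, Finset.smul_sum]
  exact Finset.sum_congr rfl fun j _ => Finset.sum_congr rfl fun k _ => by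
    rw [smul_comm (Real.log t ^ k) c, smul_comm (t ^ j) c]

lemma logPowerSum_sum_smul {ι : Type*} (M d : ℕ) (s : Finset ι) (c : ι → 𝕜)
    (a : ι → ℕ → ℕ → E) (t : ℝ) :
    logPowerSum M d (∑ i ∈ s, c i • a i) t = ∑ i ∈ s, c i • logPowerSum M d (a i) t := by
  classical
  induction s using Finset.induction_on with
  | empty => simp [logPowerSum]
  | insert i s hi ih => rw [Finset.sum_insert hi, Finset.sum_insert hi, logPowerSum_add,
      logPowerSum_smul, ih]

/-- All larger degrees are allowed so that finitely many functions can be written with one common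
degree. -/
lemma exists_eq_logPowerSum {M : ℕ} {g : ℝ → E} (hg : g ∈ logPow E (Iic M)) :
    ∃ d₀, ∀ d, d₀ ≤ d → ∃ a, g = logPowerSum M d a := by
  induction hg using Submodule.span_induction with
  | mem g h =>
    obtain ⟨j, i, v, hj, rfl⟩ := h
    refine ⟨i, fun d hd => ⟨fun j' i' => if j' = j then if i' = i then v else 0 else 0, ?_⟩⟩
    funext t
    rw [logPowerSum, Finset.sum_eq_single_of_mem j
      (Finset.mem_range.2 (Nat.lt_succ_of_le hj)), Finset.sum_eq_single_of_mem i
      (Finset.mem_range.2 (Nat.lt_succ_of_le hd)), if_pos rfl, if_pos rfl, smul_smul]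
    · intro b _ hb
      rw [if_pos rfl, if_neg hb, smul_zero]
    · intro b _ hb
      simp only [if_neg hb, smul_zero, Finset.sum_const_zero]
  | zero => exact ⟨0, fun d _ => ⟨0, by funext t; simp [logPowerSum]⟩⟩
  | add g h _ _ ihg ihh =>
    obtain ⟨d₁, h₁⟩ := ihg
    obtain ⟨d₂, h₂⟩ := ihh
    refine ⟨max d₁ d₂, fun d hd => ?_⟩
    obtain ⟨a, rfl⟩ := h₁ d ((le_max_left _ _).trans hd)
    obtain ⟨b, rfl⟩ := h₂ d ((le_max_right _ _).trans hd)
    exact ⟨a + b, by funext t; rw [logPowerSum_add]; rfl⟩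
  | smul c g _ ih =>
    obtain ⟨d₁, h₁⟩ := ih
    refine ⟨d₁, fun d hd => ?_⟩
    obtain ⟨a, rfl⟩ := h₁ d hd
    exact ⟨c • a, by funext t; rw [logPowerSum_smul (𝕜 := ℝ)]; rfl⟩

end LogPowerSum

/-! ### Correcting approximate solutions by small remainders -/

section Remainder

/-- The remainder terms `w` allowed next to a log-power sum of degree `M`. -/
def remainder (𝕜 E : Type*) [RCLike 𝕜] [NormedAddCommGroup E] [NormedSpace 𝕜 E] (T' : ℝ)
    (M N : ℕ) : Submodule 𝕜 (ℝ → E) where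
  carrier := {w | ContinuousOn w (Ioc 0 T') ∧
    (∀ η : ℝ, 0 < η → w =O[𝓝[>] 0] fun t : ℝ => t ^ ((M : ℝ) - η)) ∧
    (M < N → w =O[𝓝[>] 0] fun t : ℝ => t ^ ((M : ℝ) + 1 / 2))}
  add_mem' h1 h2 := ⟨h1.1.add h2.1, fun η hη => (h1.2.1 η hη).add (h2.2.1 η hη),
    fun h => (h1.2.2 h).add (h2.2.2 h)⟩
  zero_mem' := ⟨continuousOn_const, fun _ _ => isBigO_zero _ _, fun _ => isBigO_zero _ _⟩
  smul_mem' c _ h1 := ⟨h1.1.const_smul c, fun η hη => (h1.2.1 η hη).const_smul_left c,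
    fun h => (h1.2.2 h).const_smul_left c⟩

variable {𝕜 E₁ E₂ : Type*} [RCLike 𝕜]
  [NormedAddCommGroup E₁] [NormedSpace 𝕜 E₁] [NormedSpace ℝ E₁] [IsScalarTower ℝ 𝕜 E₁]
  [NormedAddCommGroup E₂] [NormedSpace 𝕜 E₂] [NormedSpace ℝ E₂] [IsScalarTower ℝ 𝕜 E₂]

lemma admissible_of_remainder {T' : ℝ} {M N : ℕ} {w : ℝ → E₁} (hw : w ∈ remainder 𝕜 E₁ T' M N) :
    w ∈ admissible 𝕜 E₁ T' := by
  refine admissible_of_isBigO (s := (M : ℝ) - 1 / 2) ?_ hw.1 (hw.2.1 _ (by norm_num))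
  have : (0 : ℝ) ≤ M := Nat.cast_nonneg M
  linarith

lemma isBigO_rpow_of_bound {E : Type*} [NormedAddCommGroup E] {T' : ℝ} (hT0 : 0 < T') {w : ℝ → E}
    {C s : ℝ} (h : ∀ t ∈ Ioc 0 T', ‖w t‖ ≤ C * t ^ s) : w =O[𝓝[>] 0] fun t : ℝ => t ^ s := by
  refine IsBigO.of_bound C ?_
  filter_upwards [Ioc_mem_nhdsGT hT0] with t ht
  rw [Real.norm_of_nonneg (Real.rpow_nonneg ht.1.le _)]
  exact h t ht

namespace Data

variable {V : Data 𝕜 E₁ E₂} {N Nstar : ℕ} {ε T' : ℝ}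

lemma diffOp_sub (hT : T' ≤ V.T) {x y : ℝ → E₁} (hx : x ∈ admissible 𝕜 E₁ T')
    (hy : y ∈ admissible 𝕜 E₁ T') {t : ℝ} (ht : t ∈ Icc 0 T') :
    V.diffOp (x - y) t = V.diffOp x t - V.diffOp y t := by
  have h1 : x - y = x + (-1 : 𝕜) • y := by rw [neg_one_smul, sub_eq_add_neg]
  rw [h1, diffOp_add hT hx (Submodule.smul_mem _ _ hy) ht, diffOp_smul, neg_one_smul,
    sub_eq_add_neg]

lemma diffOp_congr (hT : T' ≤ V.T) {x y : ℝ → E₁} (h : EqOn x y (Ioc 0 T')) {t : ℝ}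
    (ht : t ∈ Ioc 0 T') : V.diffOp x t = V.diffOp y t := by
  have ht' : t ∈ Icc 0 T' := ⟨ht.1.le, ht.2⟩
  have htT : t ∈ Icc 0 V.T := ⟨ht.1.le, ht.2.trans hT⟩
  rw [diffOp, diffOp, h ht]
  congr 1
  · congr 1
    refine Finset.sum_congr rfl fun i hi => ?_
    have hi' := Finset.mem_Ico.1 hi
    rw [h ⟨V.α_pos hi'.1 hi'.2.le ⟨ht.1, htT.2⟩, (V.α_le_self hi'.2.le htT).trans ht.2⟩]
  · refine Finset.sum_congr rfl fun i hi => ?_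
    rw [intervalIntegral.integral_of_le (V.α_pred_le hi htT),
      intervalIntegral.integral_of_le (V.α_pred_le hi htT)]
    refine setIntegral_congr_fun measurableSet_Ioc fun s hs => ?_
    have hs' := Ioc_α_subset hT hi ht' hs
    simp only [h hs']

/-- If `N > N*`, the residual has order `N* + 1` up to logarithms and `γ = N* + 1/2` is available.
If `N = N*`, it is only `O(t^{N*-η'})` for every `η' > 0`; the weights `N* - η'` are used and
uniqueness identifies the resulting solutions. -/
lemma CondD.exists_small_solution [CompleteSpace E₁] [CompleteSpace E₂] (hN1 : 1 ≤ N)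
    (hN : Nstar ≤ N) (hD : V.CondD ε T' Nstar) {ρ : ℝ → E₂} (hρ : ContinuousOn ρ (Ioc 0 T'))
    (hρm : ρ ∈ logExp E₂ N (min N (Nstar + 1))) :
    ∃ w ∈ remainder 𝕜 E₁ T' Nstar N, ∀ t ∈ Ioc 0 T', V.diffOp w t = ρ t := by
  obtain ⟨q, hq, η, hη, hη2, hcond⟩ := hD.exists_weight
  obtain ⟨-, -, hT0, hT, -, -, hinv, -⟩ := hD
  have hM0 : (0 : ℝ) ≤ Nstar := Nat.cast_nonneg _
  rcases lt_or_eq_of_le hN with hlt | rfl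
  · rw [min_eq_right (Nat.succ_le_of_lt hlt)] at hρm
    have h1 := logExp_isBigO (Nat.succ_le_of_lt hlt) hρm (show (0 : ℝ) < 1 / 2 by norm_num)
    rw [show ((Nstar + 1 : ℕ) : ℝ) - 1 / 2 = Nstar + 1 / 2 by push_cast; ring] at h1
    obtain ⟨C, hC⟩ := exists_bound_of_isBigO_rpow hρ h1
    obtain ⟨w, hw, ⟨D, hD⟩, hw'⟩ := exists_diffOp_eq hT hT0 hinv
      (γ := (Nstar : ℝ) + 1 / 2) (by linarith) hq
      (hcond _ (by linarith) (by linarith)) hρ hC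
    have h2 := isBigO_rpow_of_bound hT0 hD
    exact ⟨w, ⟨hw, fun η hη => h2.trans (isBigO_rpow_rpow_of_le (by linarith)), fun _ => h2⟩, hw'⟩
  · rw [min_eq_left (Nat.le_succ _)] at hρm
    have hM1 : (1 : ℝ) ≤ Nstar := by exact_mod_cast hN1
    have hex : ∀ η' : ℝ, 0 < η' → η' ≤ η → ∃ w : ℝ → E₁, ContinuousOn w (Ioc 0 T') ∧
        w =O[𝓝[>] 0] (fun t : ℝ => t ^ ((Nstar : ℝ) - η')) ∧
        ∀ t ∈ Ioc 0 T', V.diffOp w t = ρ t := by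
      intro η' h0 hle
      obtain ⟨C, hC⟩ := exists_bound_of_isBigO_rpow hρ (logExp_isBigO le_rfl hρm h0)
      have hγ : (0 : ℝ) ≤ (Nstar : ℝ) - η' := by linarith
      obtain ⟨w, hw, ⟨D, hD⟩, hw'⟩ := exists_diffOp_eq hT hT0 hinv hγ hq
        (hcond _ hγ (by linarith)) hρ hC
      exact ⟨w, hw, isBigO_rpow_of_bound hT0 hD, hw'⟩
    obtain ⟨w, hw, hwO, hw'⟩ := hex η hη le_rfl
    have hγ : (0 : ℝ) ≤ (Nstar : ℝ) - η := by linarith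
    have hadm : ∀ x : ℝ → E₁, ContinuousOn x (Ioc 0 T') →
        x =O[𝓝[>] 0] (fun t : ℝ => t ^ ((Nstar : ℝ) - η)) → x ∈ admissible 𝕜 E₁ T' :=
      fun x h1 h2 => admissible_of_isBigO (by linarith) h1 h2
    refine ⟨w, ⟨hw, fun η'' hη'' => ?_, fun h => absurd h (lt_irrefl _)⟩, hw'⟩
    -- A solution with the sharper decay also lies in the class where uniqueness holds, so it equals
    -- `w` and passes its decay on to it.
    obtain ⟨z, hz, hzO, hz'⟩ := hex (min η η'') (lt_min hη hη'') (min_le_left _ _)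
    have hzO' : z =O[𝓝[>] 0] (fun t : ℝ => t ^ ((Nstar : ℝ) - η)) :=
      hzO.trans (isBigO_rpow_rpow_of_le (by linarith [min_le_left η η'']))
    obtain ⟨C, hC⟩ := exists_bound_of_isBigO_rpow (hw.sub hz) (hwO.sub hzO')
    have h0 := eq_zero_of_diffOp_eq_zero hT hT0 hinv hγ hq (hcond _ hγ le_rfl) (x := w - z) hC
      fun t ht => by
        rw [diffOp_sub hT (hadm w hw hwO) (hadm z hz hzO') ⟨ht.1.le, ht.2⟩, hw' t ht, hz' t ht,
          sub_self]
    refine (EventuallyEq.trans_isBigO ?_ hzO).trans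
      (isBigO_rpow_rpow_of_le (by linarith [min_le_right η η'']))
    filter_upwards [Ioc_mem_nhdsGT hT0] with t ht
    exact sub_eq_zero.1 (h0 t ht)

/-- An approximate solution of the differentiated equation can be corrected to a solution. -/
lemma CondB.exists_solution [CompleteSpace E₁] [CompleteSpace E₂] (hB : V.CondB N)
    (hN : Nstar ≤ N) (hD : V.CondD ε T' Nstar)
    (hsol : ∀ j ≤ Nstar, ∃ P, ∀ y : E₂, ∃ ξ : ℕ → E₁, ∀ m ≤ P,
      opConv (V.charCoeff j) ξ m = if m = P then y else 0)
    {s : Set ℕ} {x₀ : ℝ → E₁} (hx₀ : x₀ ∈ logPow E₁ s) {F : ℝ → E₂}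
    (hF : ContinuousOn F (Ioc 0 T')) {k : ℕ} (hkN : k ≤ N) (hkM : k ≤ Nstar + 1)
    (hres : (fun t => V.diffOp x₀ t - F t) ∈ logExp E₂ N k) :
    ∃ y ∈ logPow E₁ (Ico k (Nstar + 1)), ∃ w ∈ remainder 𝕜 E₁ T' Nstar N,
      ∀ t ∈ Ioc 0 T', V.diffOp (x₀ + y + w) t = F t := by
  -- Correction stops at `min N (N* + 1)`: expansions are known only up to order `N`, and
  -- solvability of the leading equation only up to `N*`.
  obtain ⟨y, hy, hy'⟩ := hB.exists_logPow_correction (le_min hkN hkM)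
    (fun j _ h2 => hsol j (by omega)) hres
  have hT := hD.2.2.2.1
  have ax : x₀ ∈ admissible 𝕜 E₁ T' := logPow_admissible hx₀ T'
  have ay : y ∈ admissible 𝕜 E₁ T' := logPow_admissible hy T'
  set ρ : ℝ → E₂ := fun t => (-1 : ℝ) • (V.diffOp x₀ t - F t + V.diffOp y t) with hρ
  have hρc : ContinuousOn ρ (Ioc 0 T') :=
    (((continuousOn_diffOp hT ax).sub hF).add (continuousOn_diffOp hT ay)).const_smul _
  obtain ⟨w, hw, hw'⟩ := hD.exists_small_solution hB.1 hN hρc (fun_smul_mem (-1) hy')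
  refine ⟨y, logPow_mono (Ico_subset_Ico_right (min_le_right _ _)) hy, w, hw, fun t ht => ?_⟩
  have ht' : t ∈ Icc 0 T' := ⟨ht.1.le, ht.2⟩
  rw [diffOp_add hT (Submodule.add_mem _ ax ay) (admissible_of_remainder hw) ht',
    diffOp_add hT ax ay ht', hw' t ht, hρ]
  simp only [neg_one_smul]
  abel

/-- Since `α_i'(0) ≤ ε`, condition (D) at `t = 0` says that `K_n(0,0)⁻¹ B(N*)` is the identity plus
an operator of norm below one. Hence `N*` is never a singular point. -/
lemma CondD.eq_zero_of_charOp_eq_zero [CompleteSpace E₁] (hD : V.CondD ε T' Nstar) {v : E₁}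
    (hv : V.charOp Nstar v = 0) : v = 0 := by
  obtain ⟨q, hq, hb⟩ := hD.exists_bound
  obtain ⟨hε, hε1, hT0, hT, hα', -, hinv, -⟩ := hD
  have h0 : (0 : ℝ) ∈ Icc 0 T' := ⟨le_rfl, hT0.le⟩
  obtain ⟨e, he⟩ := hinv 0 h0
  have hb0 := hb 0 h0
  have hLe : ∀ x, (V.K V.n 0 0).inverse (V.K V.n 0 0 x) = x := by
    intro x
    rw [← he, ContinuousLinearMap.inverse_equiv]
    exact e.symm_apply_apply x
  set L := (V.K V.n 0 0).inverse with hL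
  have h1 : v = -∑ i ∈ Finset.Ico 1 V.n, V.α' i 0 ^ (1 + Nstar) •
      (L ∘L (V.K i 0 0 - V.K (i + 1) 0 0)) v := by
    have h2 := congrArg L hv
    simp only [charOp, _root_.add_apply, _root_.sum_apply, _root_.smul_apply, map_add, map_sum,
      map_zero, hLe, clm_map_real_smul] at h2
    refine (eq_neg_of_add_eq_zero_left h2).trans ?_
    congr 1
    refine Finset.sum_congr rfl fun i _ => ?_
    rw [← Nat.cast_one, ← Nat.cast_add, Real.rpow_natCast]
    rfl
  have h2 : ‖v‖ ≤ q * ‖v‖ := by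
    calc ‖v‖ ≤ ∑ i ∈ Finset.Ico 1 V.n, ‖V.α' i 0 ^ (1 + Nstar) •
          (L ∘L (V.K i 0 0 - V.K (i + 1) 0 0)) v‖ := by
          conv_lhs => rw [h1, norm_neg]
          exact norm_sum_le _ _
      _ ≤ ∑ i ∈ Finset.Ico 1 V.n, ε ^ Nstar * (|V.α' i 0| *
          ‖L ∘L (V.K i 0 0 - V.K (i + 1) 0 0)‖) * ‖v‖ := by
          refine Finset.sum_le_sum fun i hi => ?_
          rw [norm_smul, norm_pow, Real.norm_eq_abs, pow_add, pow_one]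
          have e1 : |V.α' i 0| ^ Nstar ≤ ε ^ Nstar :=
            pow_le_pow_left₀ (abs_nonneg _) (hα' i hi 0 h0) _
          have e2 := (L ∘L (V.K i 0 0 - V.K (i + 1) 0 0)).le_opNorm v
          calc |V.α' i 0| * |V.α' i 0| ^ Nstar * ‖(L ∘L (V.K i 0 0 - V.K (i + 1) 0 0)) v‖
              ≤ |V.α' i 0| * ε ^ Nstar * (‖L ∘L (V.K i 0 0 - V.K (i + 1) 0 0)‖ * ‖v‖) := by
                gcongr
            _ = _ := by ring
      _ = (ε ^ Nstar * ∑ i ∈ Finset.Ico 1 V.n, |V.α' i 0| *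
          ‖L ∘L (V.K i 0 0 - V.K (i + 1) 0 0)‖) * ‖v‖ := by
          rw [← Finset.sum_mul, ← Finset.mul_sum]
      _ ≤ q * ‖v‖ := by
          refine mul_le_mul_of_nonneg_right ?_ (norm_nonneg v)
          have hz : ∀ i ∈ Finset.Ico 1 V.n, V.α i 0 = 0 := fun i hi =>
            V.α_zero i (Finset.mem_Ico.1 hi).2.le
          refine le_trans (le_of_eq ?_) hb0
          congr 1
          exact Finset.sum_congr rfl fun i hi => by rw [hz i hi]
  by_contra hne
  have := norm_pos_iff.2 hne
  nlinarith

/-- Solutions of the homogeneous differentiated equation with prescribed leading terms. -/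
lemma CondC1.exists_fundamental_system [CompleteSpace E₁] [CompleteSpace E₂] {J : Finset ℕ}
    {r : ℕ → ℕ} {p : (j : ℕ) → Fin (r j) → ℕ} (hB : V.CondB N) (hN : Nstar ≤ N)
    (hD : V.CondD ε T' Nstar) (hC : V.CondC1 Nstar J r p) {j : ℕ} (hj : j ∈ J) :
    ∃ ξ : Fin (r j) → ℕ → E₁, LinearIndependent 𝕜 (fun i => ξ i 0) ∧
      ∀ i, ∀ l < p j i, ∃ x ∈ logPow E₁ (Iic Nstar), ∃ w ∈ remainder 𝕜 E₁ T' Nstar N,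
        (∀ t ∈ Ioc 0 T', V.diffOp (x + w) t = 0) ∧
        (fun t => (x + w) t - t ^ j • chainFun (ξ i) l (Real.log t)) =O[𝓝[>] 0]
          fun t : ℝ => t ^ ((j : ℝ) + 1 / 2) := by
  obtain ⟨hjN, hs, hJ⟩ := hC.1 j hj
  obtain ⟨ξ, hli, hp, hξ, -⟩ := hJ.exists_chains hs (V.charCoeff j)
    fun q => V.iteratedDeriv_charOp q j
  refine ⟨ξ, hli, fun i l hl => ?_⟩
  -- The start of a chain at `N*` would be a nonzero kernel vector. With `j < N*`, even the
  -- remainder `O(t^{N*-1/2})` is `O(t^{j+1/2})` and leaves the leading term intact.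
  have hjlt : j < Nstar := by
    refine lt_of_le_of_ne hjN ?_
    rintro rfl
    refine hli.ne_zero i (hD.eq_zero_of_charOp_eq_zero ?_)
    have h1 := hξ i 0 (hp i)
    simpa [opConv, V.charCoeff_zero] using h1
  have hz := chainFun_mem_logPow j (ξ i) l
  set z : ℝ → E₁ := fun t => t ^ j • chainFun (ξ i) l (Real.log t) with hzdef
  have hconv : ∀ t : ℝ, chainFun (opConv (V.charCoeff j) (ξ i)) l (Real.log t) = 0 := by
    intro t
    rw [chainFun_congr (η := fun _ => 0) fun m hm => hξ i m (hm.trans_lt hl)]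
    simp [chainFun]
  have hres : (fun t => V.diffOp z t - (0 : E₂)) ∈ logExp E₂ N (j + 1) := by
    have h1 := hB.diffOp_chainFun j (ξ i) l
    simpa only [hconv, smul_zero] using h1
  obtain ⟨y, hy, w, hw, hyw⟩ := hB.exists_solution hN hD (fun k hk => hC.exists_opConv_eq_single hk)
    hz (F := fun _ => 0) continuousOn_const (by omega) (by omega) hres
  refine ⟨z + y, Submodule.add_mem _ (logPow_mono (singleton_subset_iff.2 (mem_Iic.2 hjN)) hz)
    (logPow_mono (fun m hm => Nat.le_of_lt_succ hm.2) hy), w, hw, hyw, ?_⟩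
  have e1 := logPow_isBigO (logPow_mono Ico_subset_Ici_self hy) (show (0 : ℝ) < 1 / 2 by norm_num)
  have e2 := hw.2.1 (1 / 2) (by norm_num)
  have hle : (j : ℝ) + 1 ≤ Nstar := by exact_mod_cast hjlt
  have e3 := (e1.trans (isBigO_rpow_rpow_of_le (b := (j : ℝ) + 1 / 2) (by push_cast; linarith))).add
    (e2.trans (isBigO_rpow_rpow_of_le (b := (j : ℝ) + 1 / 2) (by linarith)))
  refine e3.congr_left fun t => ?_
  simp only [Pi.add_apply, hzdef]
  abel

end Data

end Remainder

/-! ### Dividing the remainder by the power of t -/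

section Scaling

variable {𝕜 E : Type*} [RCLike 𝕜] [NormedAddCommGroup E] [NormedSpace 𝕜 E] [NormedSpace ℝ E]
  [IsScalarTower ℝ 𝕜 E]

variable (𝕜 E) in
/-- Division by `t ^ M`, with value `0` at `t = 0`. -/
def scaleDown (M : ℕ) : (ℝ → E) →ₗ[𝕜] (ℝ → E) where
  toFun w t := if t = 0 then 0 else (t ^ M)⁻¹ • w t
  map_add' w z := by
    funext t
    by_cases ht : t = 0 <;> simp [ht]
  map_smul' c w := by
    have : SMulCommClass ℝ 𝕜 E := IsScalarTower.to_smulCommClass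
    funext t
    by_cases ht : t = 0
    · simp [ht]
    · simp only [Pi.smul_apply, ht, if_false, RingHom.id_apply]
      exact smul_comm _ _ _

lemma scaleDown_zero (M : ℕ) (w : ℝ → E) : scaleDown 𝕜 E M w 0 = 0 := if_pos rfl

lemma scaleDown_of_pos (M : ℕ) (w : ℝ → E) {t : ℝ} (ht : 0 < t) :
    scaleDown 𝕜 E M w t = (t ^ M)⁻¹ • w t := if_neg ht.ne'

lemma pow_smul_scaleDown (M : ℕ) (w : ℝ → E) {t : ℝ} (ht : 0 < t) :
    t ^ M • scaleDown 𝕜 E M w t = w t := by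
  rw [scaleDown_of_pos M w ht, smul_inv_smul₀ (pow_pos ht M).ne']

lemma scaleDown_isBigO {M : ℕ} {w : ℝ → E} {s : ℝ}
    (h : w =O[𝓝[>] 0] fun t : ℝ => t ^ ((M : ℝ) + s)) :
    scaleDown 𝕜 E M w =O[𝓝[>] 0] fun t : ℝ => t ^ s := by
  obtain ⟨C, hC⟩ := h.bound
  refine IsBigO.of_bound C ?_
  filter_upwards [hC, self_mem_nhdsWithin] with t ht ht0
  have ht0' : (0 : ℝ) < t := ht0
  have hpos : 0 < t ^ M := pow_pos ht0' M
  rw [← pow_smul_scaleDown (𝕜 := 𝕜) M w ht0', Real.rpow_add ht0', Real.rpow_natCast, norm_smul,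
    norm_mul, Real.norm_of_nonneg hpos.le, mul_left_comm] at ht
  exact le_of_mul_le_mul_left ht hpos

lemma tendsto_rpow_nhdsGT_zero {s : ℝ} (hs : 0 < s) :
    Tendsto (fun t : ℝ => t ^ s) (𝓝[>] 0) (𝓝 0) := by
  have h := (Real.continuousAt_rpow_const 0 s (Or.inr hs.le)).tendsto
  rw [Real.zero_rpow hs.ne'] at h
  exact h.mono_left nhdsWithin_le_nhds

variable {T' : ℝ} {M N : ℕ} {w : ℝ → E}

lemma scaleDown_continuousOn_Ioc (hw : w ∈ remainder 𝕜 E T' M N) :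
    ContinuousOn (scaleDown 𝕜 E M w) (Ioc 0 T') := by
  refine ContinuousOn.congr (f := fun t => (t ^ M)⁻¹ • w t) ?_ fun t ht =>
    scaleDown_of_pos M w ht.1
  exact ((continuous_pow M).continuousOn.inv₀ fun t ht => (pow_pos ht.1 M).ne').smul hw.1

lemma rpow_smul_scaleDown_tendsto (hw : w ∈ remainder 𝕜 E T' M N) {η : ℝ} (hη : 0 < η) :
    Tendsto (fun t : ℝ => t ^ η • scaleDown 𝕜 E M w t) (𝓝[>] 0) (𝓝 0) := by
  have h1 : scaleDown 𝕜 E M w =O[𝓝[>] 0] fun t : ℝ => t ^ (-(η / 2)) :=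
    scaleDown_isBigO (by simpa only [← sub_eq_add_neg] using hw.2.1 (η / 2) (by linarith))
  have h2 := (isBigO_refl (fun t : ℝ => t ^ η) (𝓝[>] 0)).smul h1
  have h3 := rpow_mul_rpow_eventuallyEq η (-(η / 2))
  rw [show η + -(η / 2) = η / 2 by ring] at h3
  exact (h2.trans_eventuallyEq h3).trans_tendsto (tendsto_rpow_nhdsGT_zero (by linarith))

/-- For `M < N` the remainder is `O(t^{M+1/2})`, so the conventional value `0` at `t = 0` is the
actual limit. -/
lemma scaleDown_continuousOn_Icc (hw : w ∈ remainder 𝕜 E T' M N) (hMN : M < N) :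
    ContinuousOn (scaleDown 𝕜 E M w) (Icc 0 T') := by
  intro t ht
  rcases eq_or_lt_of_le ht.1 with rfl | h0
  · have h1 := (scaleDown_isBigO (𝕜 := 𝕜) (hw.2.2 hMN)).trans_tendsto
      (tendsto_rpow_nhdsGT_zero (show (0 : ℝ) < 1 / 2 by norm_num))
    rw [← scaleDown_zero (𝕜 := 𝕜) M w] at h1
    have h2 : ContinuousWithinAt (scaleDown 𝕜 E M w) (Ioi 0) 0 := h1
    exact (continuousWithinAt_Ioi_iff_Ici.1 h2).mono fun s hs => hs.1
  · have h1 := scaleDown_continuousOn_Ioc hw t ⟨h0, ht.2⟩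
    refine h1.mono_of_mem_nhdsWithin ?_
    filter_upwards [self_mem_nhdsWithin, mem_nhdsWithin_of_mem_nhds (Ioi_mem_nhds h0)] with s hs hs0
    exact ⟨hs0, hs.2⟩

end Scaling

/-! ### Fundamental family and particular solution -/

section Family

variable {𝕜 E₁ E₂ : Type*} [RCLike 𝕜]
  [NormedAddCommGroup E₁] [NormedSpace 𝕜 E₁] [NormedSpace ℝ E₁] [IsScalarTower ℝ 𝕜 E₁]
  [NormedAddCommGroup E₂] [NormedSpace 𝕜 E₂] [NormedSpace ℝ E₂] [IsScalarTower ℝ 𝕜 E₂]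

namespace Data

variable {V : Data 𝕜 E₁ E₂} {N Nstar : ℕ} {ε T' : ℝ} {J : Finset ℕ} {r : ℕ → ℕ}
  {p : (j : ℕ) → Fin (r j) → ℕ}

lemma CondC1.exists_fundamental_family [CompleteSpace E₁] [CompleteSpace E₂] (hB : V.CondB N)
    (hN : Nstar ≤ N) (hD : V.CondD ε T' Nstar) (hC : V.CondC1 Nstar J r p) :
    ∃ (ξ : (j : ℕ) → Fin (r j) → ℕ → E₁) (x w : (j : ℕ) → (i : Fin (r j)) → Fin (p j i) → ℝ → E₁),
      (∀ j ∈ J, LinearIndependent 𝕜 fun i => ξ j i 0) ∧ ∀ j ∈ J, ∀ i l,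
        x j i l ∈ logPow E₁ (Iic Nstar) ∧ w j i l ∈ remainder 𝕜 E₁ T' Nstar N ∧
        (∀ t ∈ Ioc 0 T', V.diffOp (x j i l + w j i l) t = 0) ∧
        (fun t => (x j i l + w j i l) t - t ^ j • chainFun (ξ j i) l (Real.log t)) =O[𝓝[>] 0]
          fun t : ℝ => t ^ ((j : ℝ) + 1 / 2) := by
  have h : ∀ j, ∃ (ξ : Fin (r j) → ℕ → E₁) (x w : (i : Fin (r j)) → Fin (p j i) → ℝ → E₁),
      j ∈ J → (LinearIndependent 𝕜 fun i => ξ i 0) ∧ ∀ i l,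
        x i l ∈ logPow E₁ (Iic Nstar) ∧ w i l ∈ remainder 𝕜 E₁ T' Nstar N ∧
        (∀ t ∈ Ioc 0 T', V.diffOp (x i l + w i l) t = 0) ∧
        (fun t => (x i l + w i l) t - t ^ j • chainFun (ξ i) l (Real.log t)) =O[𝓝[>] 0]
          fun t : ℝ => t ^ ((j : ℝ) + 1 / 2) := by
    intro j
    by_cases hj : j ∈ J
    · obtain ⟨ξ, hli, h⟩ := hC.exists_fundamental_system hB hN hD hj
      choose x hx w hw h1 h2 using fun i (l : Fin (p j i)) => h i l l.2
      exact ⟨ξ, x, w, fun _ => ⟨hli, fun i l => ⟨hx i l, hw i l, h1 i l, h2 i l⟩⟩⟩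
    · exact ⟨fun _ _ => 0, fun _ _ => 0, fun _ _ => 0, fun h => absurd h hj⟩
  choose ξ x w h using h
  exact ⟨ξ, x, w, fun j hj => (h j hj).1, fun j hj => (h j hj).2⟩

/-- The correction procedure starts from the zero function, whose residual `-f'` has an expansion
from order `0`. -/
lemma CondB.exists_particular_solution [CompleteSpace E₁] [CompleteSpace E₂] (hB : V.CondB N)
    (hN : Nstar ≤ N) (hD : V.CondD ε T' Nstar) (hC : V.CondC1 Nstar J r p) :
    ∃ x ∈ logPow E₁ (Iic Nstar), ∃ w ∈ remainder 𝕜 E₁ T' Nstar N,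
      ∀ t ∈ Ioc 0 T', V.diffOp (x + w) t = V.f' t := by
  have hT := hD.2.2.2.1
  obtain ⟨y, hy, w, hw, h⟩ := hB.exists_solution hN hD (fun k hk => hC.exists_opConv_eq_single hk)
    (Submodule.zero_mem (logPow E₁ ∅)) (F := V.f')
    (V.f'_cont.mono fun t ht => ⟨ht.1.le, ht.2.trans hT⟩) (Nat.zero_le _) (Nat.zero_le _)
    (by simpa only [diffOp_zero, zero_sub, neg_one_smul] using fun_smul_mem (-1) hB.deriv_f_mem)
  exact ⟨y, logPow_mono (fun m hm => Nat.le_of_lt_succ hm.2) hy, w, hw,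
    by simpa only [zero_add] using h⟩

lemma isSolutionOn_of_diffOp_eq [CompleteSpace E₂] (hT : T' ≤ V.T) (hf0 : V.f 0 = 0)
    {x y : ℝ → E₁} (hx : x ∈ admissible 𝕜 E₁ T') (h : ∀ t ∈ Ioc 0 T', V.diffOp x t = V.f' t)
    (hyx : EqOn y x (Ioc 0 T')) : V.IsSolutionOn T' y := by
  have hy : y ∈ admissible 𝕜 E₁ T' :=
    ⟨hx.1.congr hyx, hx.2.congr_fun hyx.symm measurableSet_Ioc⟩
  exact ⟨hy.1, hy.2, (intOp_eq_iff hT hf0 hy).2 fun t ht => by rw [diffOp_congr hT hyx ht, h t ht]⟩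

/-- Two solutions that differ by `O(t ^ N*)` coincide. -/
lemma CondD.eqOn_of_isSolutionOn [CompleteSpace E₁] [CompleteSpace E₂]
    (hD : V.CondD ε T' Nstar) (hf0 : V.f 0 = 0) {x y : ℝ → E₁} (hx : V.IsSolutionOn T' x)
    (hy : V.IsSolutionOn T' y) {C : ℝ} (hC : ∀ t ∈ Ioc 0 T', ‖x t - y t‖ ≤ C * t ^ Nstar) :
    EqOn x y (Ioc 0 T') := by
  obtain ⟨q, hq, η, hη, -, hcond⟩ := hD.exists_weight
  obtain ⟨-, -, hT0, hT, -, -, hinv, -⟩ := hD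
  have hM0 : (0 : ℝ) ≤ Nstar := Nat.cast_nonneg _
  have ax : x ∈ admissible 𝕜 E₁ T' := ⟨hx.1, hx.2.1⟩
  have ay : y ∈ admissible 𝕜 E₁ T' := ⟨hy.1, hy.2.1⟩
  have dx := (intOp_eq_iff hT hf0 ax).1 hx.2.2
  have dy := (intOp_eq_iff hT hf0 ay).1 hy.2.2
  have h0 := eq_zero_of_diffOp_eq_zero hT hT0 hinv hM0 hq (hcond _ hM0 (by linarith)) (x := x - y)
    (C := C) (fun t ht => by rw [Real.rpow_natCast]; exact hC t ht) fun t ht => by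
      rw [diffOp_sub hT ax ay ⟨ht.1.le, ht.2⟩, dx t ht, dy t ht, sub_self]
  exact fun t ht => sub_eq_zero.1 (h0 t ht)

end Data

/-- The affine map `c ↦ v₀ + ∑ c k • v k`. -/
def affineFamily (𝕜 : Type*) {M ι : Type*} [Ring 𝕜] [AddCommGroup M] [Module 𝕜 M] [Fintype ι]
    (v₀ : M) (v : ι → M) : (ι → 𝕜) →ᵃ[𝕜] M :=
  (Fintype.linearCombination 𝕜 v).toAffineMap + AffineMap.const 𝕜 (ι → 𝕜) v₀

lemma affineFamily_apply {𝕜 M ι : Type*} [Ring 𝕜] [AddCommGroup M] [Module 𝕜 M] [Fintype ι]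
    (v₀ : M) (v : ι → M) (c : ι → 𝕜) : affineFamily 𝕜 v₀ v c = v₀ + ∑ k, c k • v k := by
  simp [affineFamily, Fintype.linearCombination_apply, add_comm]

end Family

end VolterraFirstKind

end

/-! ### Assembly of the affine family of solutions -/

theorem theorem3 {𝕜 E₁ E₂ : Type*} [RCLike 𝕜]
    [NormedAddCommGroup E₁] [NormedSpace 𝕜 E₁] [NormedSpace ℝ E₁] [IsScalarTower ℝ 𝕜 E₁]
    [CompleteSpace E₁]
    [NormedAddCommGroup E₂] [NormedSpace 𝕜 E₂] [NormedSpace ℝ E₂] [IsScalarTower ℝ 𝕜 E₂]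
    [CompleteSpace E₂]
    (V : VolterraFirstKind.Data 𝕜 E₁ E₂)
    (N Nstar : ℕ) (hN : Nstar ≤ N) (ε T' : ℝ)
    (J : Finset ℕ) (r : ℕ → ℕ) (p : (j : ℕ) → Fin (r j) → ℕ)
    (hB : V.CondB N) (hD : V.CondD ε T' Nstar) (hC1 : V.CondC1 Nstar J r p)
    (hf0 : V.f 0 = 0) :
    ∃ (d : ℕ)
      (a : (Fin (∑ j ∈ J, ∑ i, p j i) → 𝕜) →ᵃ[𝕜] (ℕ → ℕ → E₁))
      (u : (Fin (∑ j ∈ J, ∑ i, p j i) → 𝕜) →ᵃ[𝕜] (ℝ → E₁)),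
      -- each member of the family is a solution on `(0, T']`
      (∀ c, V.IsSolutionOn T'
        (fun t => VolterraFirstKind.logPowerSum Nstar d (a c) t + t ^ Nstar • u c t)) ∧
      -- different values of the parameters give different solutions
      (∀ c c', (∀ t ∈ Ioc 0 T',
          VolterraFirstKind.logPowerSum Nstar d (a c) t + t ^ Nstar • u c t =
            VolterraFirstKind.logPowerSum Nstar d (a c') t + t ^ Nstar • u c' t) → c = c') ∧
      -- the remainder
      (∀ c, ContinuousOn (u c) (Ioc 0 T') ∧
        ∀ η : ℝ, 0 < η → Tendsto (fun t : ℝ => t ^ η • u c t) (𝓝[>] 0) (𝓝 0)) ∧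
      (Nstar < N → ∀ c, ContinuousOn (u c) (Icc 0 T') ∧
        ∀ v : ℝ → E₁, ContinuousOn v (Icc 0 T') →
          V.IsSolutionOn T'
            (fun t => VolterraFirstKind.logPowerSum Nstar d (a c) t + t ^ Nstar • v t) →
          EqOn v (u c) (Icc 0 T')) := by
  obtain ⟨x₀, hx₀, w₀, hw₀, hsol₀⟩ := hB.exists_particular_solution hN hD hC1
  obtain ⟨ξ, x, w, hξ, hxw⟩ := hC1.exists_fundamental_family hB hN hD
  have hT0 : 0 < T' := hD.2.2.1
  have hT : T' ≤ V.T := hD.2.2.2.1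
  -- One constant for each singular order, each chain and each position in the chain.
  let I := (j : J) × (i : Fin (r j)) × Fin (p j i)
  have hcard : Fintype.card I = ∑ j ∈ J, ∑ i, p j i := by
    simp only [I, Fintype.card_sigma, Fintype.card_fin]
    exact Finset.sum_coe_sort J fun j => ∑ i, p j i
  set m := ∑ j ∈ J, ∑ i, p j i with hm
  let e : I ≃ Fin m := Fintype.equivFinOfCardEq hcard
  let X : Fin m → ℝ → E₁ := fun k => x (e.symm k).1 (e.symm k).2.1 (e.symm k).2.2
  let W : Fin m → ℝ → E₁ := fun k => w (e.symm k).1 (e.symm k).2.1 (e.symm k).2.2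
  have hXW := fun k => hxw (e.symm k).1 (e.symm k).1.2 (e.symm k).2.1 (e.symm k).2.2
  have hX : ∀ k, X k ∈ VolterraFirstKind.logPow E₁ (Iic Nstar) := fun k => (hXW k).1
  have hW : ∀ k, W k ∈ VolterraFirstKind.remainder 𝕜 E₁ T' Nstar N := fun k => (hXW k).2.1
  have hsol : ∀ k, ∀ t ∈ Ioc 0 T', V.diffOp (X k + W k) t = 0 := fun k => (hXW k).2.2.1
  obtain ⟨d₀, hd₀⟩ := VolterraFirstKind.exists_eq_logPowerSum hx₀
  choose dk hdk using fun k => VolterraFirstKind.exists_eq_logPowerSum (hX k)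
  -- A common degree for the particular and all homogeneous solutions, hence independent of `c`.
  set d := max d₀ (Finset.univ.sup dk) with hd
  obtain ⟨a₀, ha₀⟩ := hd₀ d (le_max_left _ _)
  choose a ha using fun k => hdk k d ((Finset.le_sup (Finset.mem_univ k)).trans (le_max_right _ _))
  let A := VolterraFirstKind.affineFamily 𝕜 a₀ a
  let R := VolterraFirstKind.affineFamily 𝕜 w₀ W
  let u := (VolterraFirstKind.scaleDown 𝕜 E₁ Nstar).toAffineMap.comp R
  have hR : ∀ c, R c ∈ VolterraFirstKind.remainder 𝕜 E₁ T' Nstar N := fun c => by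
    rw [VolterraFirstKind.affineFamily_apply]
    exact Submodule.add_mem _ hw₀ (Submodule.sum_mem _ fun k _ => Submodule.smul_mem _ _ (hW k))
  let G : (Fin m → 𝕜) → ℝ → E₁ := fun c => (x₀ + w₀) + ∑ k, c k • (X k + W k)
  have hG : ∀ c, EqOn (fun t => VolterraFirstKind.logPowerSum Nstar d (A c) t + t ^ Nstar • u c t)
      (G c) (Ioc 0 T') := by
    intro c t ht
    have h1 : t ^ Nstar • u c t = R c t := VolterraFirstKind.pow_smul_scaleDown (𝕜 := 𝕜) Nstar (R c) ht.1
    have h2 : VolterraFirstKind.logPowerSum Nstar d (A c) t = x₀ t + ∑ k, c k • X k t := by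
      simp only [A, VolterraFirstKind.affineFamily_apply, VolterraFirstKind.logPowerSum_add,
        VolterraFirstKind.logPowerSum_sum_smul, ← ha₀, ← ha]
    simp only [h1, h2, R, G, VolterraFirstKind.affineFamily_apply, Pi.add_apply, Finset.sum_apply,
      Pi.smul_apply, smul_add, Finset.sum_add_distrib]
    abel
  have hadm₀ : x₀ + w₀ ∈ VolterraFirstKind.admissible 𝕜 E₁ T' :=
    Submodule.add_mem _ (VolterraFirstKind.logPow_admissible hx₀ T')
      (VolterraFirstKind.admissible_of_remainder hw₀)
  have hadm : ∀ (c : 𝕜) k, c • (X k + W k) ∈ VolterraFirstKind.admissible 𝕜 E₁ T' := fun c k =>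
    Submodule.smul_mem _ _ (Submodule.add_mem _ (VolterraFirstKind.logPow_admissible (hX k) T')
      (VolterraFirstKind.admissible_of_remainder (hW k)))
  have hsum : ∀ c : Fin m → 𝕜, ∑ k, c k • (X k + W k) ∈ VolterraFirstKind.admissible 𝕜 E₁ T' :=
    fun c => Submodule.sum_mem _ fun k _ => hadm (c k) k
  have hGadm : ∀ c, G c ∈ VolterraFirstKind.admissible 𝕜 E₁ T' := fun c =>
    Submodule.add_mem _ hadm₀ (hsum c)
  have hGsol : ∀ c, ∀ t ∈ Ioc 0 T', V.diffOp (G c) t = V.f' t := by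
    intro c t ht
    have ht' : t ∈ Icc 0 T' := ⟨ht.1.le, ht.2⟩
    rw [VolterraFirstKind.Data.diffOp_add hT hadm₀ (hsum c) ht',
      VolterraFirstKind.Data.diffOp_sum hT _ (fun k _ => hadm (c k) k) ht', hsol₀ t ht,
      Finset.sum_eq_zero, add_zero]
    intro k _
    rw [VolterraFirstKind.Data.diffOp_smul, hsol k t ht, smul_zero]
  have hsolution : ∀ c, V.IsSolutionOn T'
      (fun t => VolterraFirstKind.logPowerSum Nstar d (A c) t + t ^ Nstar • u c t) := fun c =>
    VolterraFirstKind.Data.isSolutionOn_of_diffOp_eq hT hf0 (hGadm c) (hGsol c) (hG c)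
  refine ⟨d, A, u, hsolution, fun c c' hcc => ?_, fun c =>
    ⟨VolterraFirstKind.scaleDown_continuousOn_Ioc (hR c),
      fun η hη => VolterraFirstKind.rpow_smul_scaleDown_tendsto (hR c) hη⟩, fun hlt c =>
    ⟨VolterraFirstKind.scaleDown_continuousOn_Icc (hR c) hlt, fun v hv hvsol => ?_⟩⟩
  · classical
    -- The coefficients are extended by zero off `J`, since independence is stated for families
    -- indexed by all `j`.
    let b : (j : ℕ) → (i : Fin (r j)) → Fin (p j i) → 𝕜 := fun j i l =>
      if hj : j ∈ J then (c - c') (e ⟨⟨j, hj⟩, i, l⟩) else 0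
    have hzero : ∀ t ∈ Ioc 0 T', ∑ j ∈ J, ∑ i, ∑ l, b j i l • (x j i l + w j i l) t = 0 := by
      intro t ht
      have h1 : G c t = G c' t := by rw [← hG c ht, ← hG c' ht]; exact hcc t ht
      have h2 : ∑ k, (c - c') k • (X k + W k) t = 0 := by
        simp only [Pi.sub_apply, sub_smul, Finset.sum_sub_distrib]
        simp only [G, Pi.add_apply, Finset.sum_apply, Pi.smul_apply] at h1
        exact sub_eq_zero.2 (add_left_cancel h1)
      rw [← Equiv.sum_comp e, Fintype.sum_sigma] at h2
      rw [← Finset.sum_coe_sort J, ← h2]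
      refine Finset.sum_congr rfl fun j _ => ?_
      rw [Fintype.sum_sigma]
      refine Finset.sum_congr rfl fun i _ => Finset.sum_congr rfl fun l _ => ?_
      have h3 : X (e ⟨j, i, l⟩) + W (e ⟨j, i, l⟩) = x j i l + w j i l :=
        congrArg (fun s : I => x s.1 s.2.1 s.2.2 + w s.1 s.2.1 s.2.2)
          (e.symm_apply_apply ⟨j, i, l⟩)
      simp only [b, dif_pos j.2, h3]
    have hb := VolterraFirstKind.eq_zero_of_sum_smul_eventually_eq_zero hξ
      (x := fun j i l => x j i l + w j i l) (fun j hj i l => (hxw j hj i l).2.2.2) (c := b)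
      (by filter_upwards [Ioc_mem_nhdsGT hT0] with t ht using hzero t ht)
    funext k
    have h1 := hb (e.symm k).1 (e.symm k).1.2 (e.symm k).2.1 (e.symm k).2.2
    simp only [b, dif_pos (e.symm k).1.2] at h1
    have h2 : (c - c') (e (e.symm k)) = 0 := h1
    rw [Equiv.apply_symm_apply] at h2
    exact sub_eq_zero.1 h2
  · have hu := VolterraFirstKind.scaleDown_continuousOn_Icc (hR c) hlt
    -- `v - u c` is bounded on the compact interval, so the two solutions differ by `O(t^{N*})` and
    -- uniqueness with weight `γ = N*` applies; the point `t = 0` follows by continuity.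
    obtain ⟨C, hC⟩ := isCompact_Icc.exists_bound_of_continuousOn (hv.sub hu)
    have h1 := hD.eqOn_of_isSolutionOn hf0 hvsol (hsolution c) (C := C) fun t ht => by
      rw [add_sub_add_left_eq_sub, ← smul_sub, norm_smul, mul_comm,
        Real.norm_of_nonneg (pow_nonneg ht.1.le _)]
      exact mul_le_mul_of_nonneg_right (hC t ⟨ht.1.le, ht.2⟩) (pow_nonneg ht.1.le _)
    refine EqOn.of_subset_closure (s := Ioc 0 T') (fun t ht => ?_) hv hu Ioc_subset_Icc_self ?_
    · have h2 := add_left_cancel (h1 ht)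
      exact smul_right_injective E₁ (pow_pos ht.1 Nstar).ne' h2
    · rw [closure_Ioc hT0.ne]
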